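/- Let $M$ be a compact real analytic manifold of dimension $m$, $f:M\to\mathbb{R}$ a $C^2$ Morse function and $\xi$ a $C^2$ vector field on $M$. Write $\mathrm{Cr}_f$ for the critical set and $\lambda(p)$ for the Morse index of $p\in\mathrm{Cr}_f$. Assume that $(f,\xi)$ is a Morse pair: $\xi\cdot f<0$ on $M\setminus \mathrm{Cr}_f$, and every $p\in \mathrm{Cr}_f$ has an adapted chart, i.e. a $C^2$ diffeomorphism $\Psi:U_p\to\mathbb{D}^m$ from an open neighbourhood $U_p$ of $p$ onto the open unit ball, and numbers $\mu_1,\dots,\mu_m>0$, with $\Psi(p)=0$ and $\Psi_*\xi=\sum_{i\le\lambda(p)}\mu_iu^i\partial_{u^i}-\sum_{j>\lambda(p)}\mu_ju^j\partial_{u^j}$. Let $\Phi_t$ be the flow of $\xi$, and for $p\in\mathrm{Cr}_f$ let $W^-_p=\{x:\lim_{t\to-\infty}\Phi_t(x)=p\}$ and $W^+_p=\{x:\lim_{t\to\infty}\Phi_t(x)=p\}$. Assume the Morse–Smale condition: $W^-_p$ and $W^+_q$ intersect transversally for all $p,q\in \mathrm{Cr}_f$ with $f(p)>f(q)$. For $p\in\mathrm{Cr}_f$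 with $0<\lambda(p)<m$ set $\gamma_u(p)=\min_{i\le\lambda(p)}\mu_i$, $\gamma_s(p)=\min_{j>\lambda(p)}\mu_j$, $\Gamma_s(p)=\max_{j>\lambda(p)}\mu_j$, and let $$\nu=\min\Bigl\{\frac{\gamma_u(p)+\gamma_s(p)}{\Gamma_s(p)}:\ p\in\mathrm{Cr}_f,\ 0<\lambda(p)<m\Bigr\}$$ (if there is no such $p$, let $\nu$ be any positive real number). Assume that $\xi$ is $(\lfloor\nu\rfloor+1)$-times differentiable. For subspaces $U,V$ of a Euclidean space put $\delta(U,V)=\sup\{\mathrm{dist}(u,V):u\in U,\ |u|=1\}$ (with $\delta(0,V)=0$). Let $M_k=\bigcup_{\lambda(p)\le k}W^-_p$. Then: (a) (Frontier property) For every integer $k$, $\mathrm{cl}(M_k)\setminus M_k\subset M_{k-1}$, and $\mathrm{cl}(M_k\setminus M_{k-1})\setminus (M_k\setminus M_{k-1})\subset M_{k-1}$. (b) Let $p,q\in\mathrm{Cr}_f$ and $z\in W^-_q\cap\mathrm{cl}(W^-_p)$. For an exponent $\alpha$ and a map $\varphi$ from a neighbourhood of $z$ to a Euclidean space consider the estimate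 $$\delta\bigl(d\varphi(T_xW^-_q),\,d\varphi(T_yW^-_p)\bigr)\le C\,|\varphi(x)-\varphi(y)|^{\alpha}\qquad\forall x\in U\cap W^-_q,\ \forall y\in U\cap W^-_p,\tag{$V_\alpha$}$$ for some open neighbourhood $U$ of $z$ and some constant $C>0$. (i) $(V_\nu)$ holds in the adapted coordinates at $q$ carried along $W^-_q$ by the flow: if $\Psi:U_q\to\mathbb{D}^m$ is any adapted chart at $q$ and $t\in\mathbb{R}$ is such that $\Phi_{-s}(z)\in U_q$ for all $s\ge t$ (which is the case for all large $t$), then $(V_\nu)$ holds for $\varphi=\Psi\circ\Phi_{-t}$. (ii) $(V_{\min(\nu,1)})$ holds for every $C^2$ map $\varphi$ from $M$ to a Euclidean space $\mathbb{R}^N$ (only its behaviour near $z$ matters) that is an immersion at $z$, in particular for every $C^2$ chart around $z$ and every $C^2$ embedding of $M$. (iii) If $\nu\ge1$, then the pair $(W^-_q,W^-_p)$ satisfies Verdier's regularity condition at $z$, i.e. $(V_1)$ holds for every $\varphi$ as in (ii). -/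

import Mathlib

open scoped Manifold ContDiff Topology
open Set Filter

namespace MorseFlow

/-- The gap `δ(U, V) = sup { dist(u, V) : u ∈ U, |u| = 1 }` between two subspaces of a Euclidean
space (it is `0` for `U = 0`). -/
noncomputable def gap {E : Type*} [NormedAddCommGroup E] [InnerProductSpace ℝ E]
    (U V : Submodule ℝ E) : ℝ :=
  sSup {r : ℝ | ∃ u ∈ U, ‖u‖ = 1 ∧ r = Metric.infDist u (V : Set E)}

section

variable {m : ℕ} {M : Type*} [TopologicalSpace M] [ChartedSpace (EuclideanSpace ℝ (Fin m)) M]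

/-- Critical points of a differentiable function. -/
def IsCrit (f : M → ℝ) (p : M) : Prop :=
  mfderiv (𝓡 m) 𝓘(ℝ, ℝ) f p = 0

/-- The second derivative of `f` at `p`, read in the preferred chart at `p`. At a critical point
of a `C²` function this is the Hessian. -/
noncomputable def hessian (f : M → ℝ) (p : M) :
    EuclideanSpace ℝ (Fin m) →L[ℝ] EuclideanSpace ℝ (Fin m) →L[ℝ] ℝ :=
  fderiv ℝ (fderiv ℝ (f ∘ (extChartAt (𝓡 m) p).symm)) (extChartAt (𝓡 m) p p)

/-- The Morse index: the largest dimension of a subspace on which the Hessian is negative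
definite. -/
noncomputable def morseIndex (f : M → ℝ) (p : M) : ℕ :=
  sSup {d : ℕ | ∃ V : Submodule ℝ (EuclideanSpace ℝ (Fin m)),
    Module.finrank ℝ V = d ∧ ∀ v ∈ V, v ≠ 0 → hessian (m := m) f p v v < 0}

/-- A `C²` chart `Ψ : U_p → 𝔻^m` onto the open unit ball, centred at `p`, in which `ξ` becomes
`∑_{i ≤ λ} μ_i u^i ∂_i - ∑_{j > λ} μ_j u^j ∂_j`, where `λ` is the Morse index of `f` at `p`. -/
structure AdaptedChart (f : M → ℝ) (ξ : (x : M) → TangentSpace (𝓡 m) x) (p : M) where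
  chart : OpenPartialHomeomorph M (EuclideanSpace ℝ (Fin m))
  μ : Fin m → ℝ
  μ_pos : ∀ i, 0 < μ i
  mem_source : p ∈ chart.source
  map_center : chart p = 0
  target_eq : chart.target = Metric.ball 0 1
  contMDiffOn : ContMDiffOn (𝓡 m) 𝓘(ℝ, EuclideanSpace ℝ (Fin m)) 2 chart chart.source
  contMDiffOn_symm :
    ContMDiffOn 𝓘(ℝ, EuclideanSpace ℝ (Fin m)) (𝓡 m) 2 chart.symm chart.target
  map_field : ∀ x ∈ chart.source,
    (mfderiv (𝓡 m) 𝓘(ℝ, EuclideanSpace ℝ (Fin m)) chart x (ξ x) : EuclideanSpace ℝ (Fin m)) =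
      WithLp.toLp 2 (fun i : Fin m =>
        if (i : ℕ) < morseIndex (m := m) f p then μ i * chart x i else -(μ i * chart x i))

namespace AdaptedChart

variable {f : M → ℝ} {ξ : (x : M) → TangentSpace (𝓡 m) x} {p : M}

/-- `γ_u`: the smallest of the finitely many `μ_i` with `i ≤ λ`. -/
noncomputable def gammaU (Ψ : AdaptedChart f ξ p) : ℝ :=
  sInf (Ψ.μ '' {i | (i : ℕ) < morseIndex (m := m) f p})

/-- `γ_s`: the smallest of the finitely many `μ_j` with `j > λ`. -/
noncomputable def gammaS (Ψ : AdaptedChart f ξ p) : ℝ :=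
  sInf (Ψ.μ '' {i | morseIndex (m := m) f p ≤ (i : ℕ)})

/-- `Γ_s`: the largest of the finitely many `μ_j` with `j > λ`. -/
noncomputable def bigGammaS (Ψ : AdaptedChart f ξ p) : ℝ :=
  sSup (Ψ.μ '' {i | morseIndex (m := m) f p ≤ (i : ℕ)})

end AdaptedChart

/-- The derivative `ξ · f` of `f` along `ξ`. -/
noncomputable def derivAlong (f : M → ℝ) (ξ : (x : M) → TangentSpace (𝓡 m) x) (x : M) : ℝ :=
  mfderiv (𝓡 m) 𝓘(ℝ, ℝ) f x (ξ x)

/-- `(f, ξ)` is a Morse pair: `f` is a `C²` Morse function, `ξ` is a `C²` vector field,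
`ξ · f < 0` off the critical set, and there is an adapted chart at every critical point. -/
structure IsMorsePair [IsManifold (𝓡 m) ω M]
    (f : M → ℝ) (ξ : (x : M) → TangentSpace (𝓡 m) x) : Prop where
  contMDiff_fun : ContMDiff (𝓡 m) 𝓘(ℝ, ℝ) 2 f
  contMDiff_field :
    ContMDiff (𝓡 m) (𝓡 m).tangent 2 (fun x => (⟨x, ξ x⟩ : TangentBundle (𝓡 m) M))
  nondegenerate : ∀ p, IsCrit (m := m) f p →
    ∀ v, (∀ w, hessian (m := m) f p v w = 0) → v = 0
  decreasing : ∀ x, ¬ IsCrit (m := m) f x →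
    derivAlong f ξ x < 0
  adapted : ∀ p, IsCrit (m := m) f p → Nonempty (AdaptedChart f ξ p)

/-- The vector field `ξ` is `n` times differentiable: its coordinate representation in each chart
of the atlas is. -/
def IsTimesDifferentiable (n : ℕ) (ξ : (x : M) → TangentSpace (𝓡 m) x) : Prop :=
  ∀ x₀ : M, ∀ k < n, DifferentiableOn ℝ
    (iteratedFDeriv ℝ k (fun y : EuclideanSpace ℝ (Fin m) =>
      (mfderiv (𝓡 m) 𝓘(ℝ, EuclideanSpace ℝ (Fin m)) (extChartAt (𝓡 m) x₀)
        ((extChartAt (𝓡 m) x₀).symm y) (ξ ((extChartAt (𝓡 m) x₀).symm y)) :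
          EuclideanSpace ℝ (Fin m))))
    (extChartAt (𝓡 m) x₀).target

open Classical in
/-- The flow of `ξ`: `flow ξ t x` is the value at time `t` of the integral curve of `ξ` defined on
the whole line and starting at `x`. For a `C¹` field on a compact Hausdorff manifold that curve
exists and is unique, so that the second case does not occur. -/
noncomputable def flow (ξ : (x : M) → TangentSpace (𝓡 m) x) (t : ℝ) (x : M) : M :=
  if h : ∃ γ : ℝ → M, γ 0 = x ∧ IsMIntegralCurve γ ξ then h.choose t else x

/-- The unstable manifold `W⁻_p`. -/
def Wminus (ξ : (x : M) → TangentSpace (𝓡 m) x) (p : M) : Set M :=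
  {x | Tendsto (fun t => flow ξ t x) atBot (𝓝 p)}

/-- The stable manifold `W⁺_p`. -/
def Wplus (ξ : (x : M) → TangentSpace (𝓡 m) x) (p : M) : Set M :=
  {x | Tendsto (fun t => flow ξ t x) atTop (𝓝 p)}

/-- `M_k(ξ)`, the union of the unstable manifolds of the critical points of index at most `k`. -/
def skeleton (f : M → ℝ) (ξ : (x : M) → TangentSpace (𝓡 m) x) (k : ℤ) : Set M :=
  {x | ∃ p, IsCrit (m := m) f p ∧ (morseIndex (m := m) f p : ℤ) ≤ k ∧ x ∈ Wminus ξ p}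

/-- The tangent space at `x` of a submanifold `S` of `M`, as a subspace of `T_x M`: it is spanned
by the velocities at `x` of the curves which lie in `S` and pass through `x`. -/
noncomputable def tangentAt (m : ℕ) {M : Type*} [TopologicalSpace M]
    [ChartedSpace (EuclideanSpace ℝ (Fin m)) M] (S : Set M) (x : M) :
    Submodule ℝ (TangentSpace (𝓡 m) x) :=
  Submodule.span ℝ {v | ∃ γ : ℝ → M, γ 0 = x ∧ (∀ t, γ t ∈ S) ∧
    MDifferentiableAt 𝓘(ℝ, ℝ) (𝓡 m) γ 0 ∧
    (mfderiv 𝓘(ℝ, ℝ) (𝓡 m) γ 0 (1 : ℝ) : EuclideanSpace ℝ (Fin m)) = v}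

/-- The Morse-Smale condition: if `f p > f q`, then `W⁻_p` and `W⁺_q` intersect transversally. -/
def IsMorseSmale (f : M → ℝ) (ξ : (x : M) → TangentSpace (𝓡 m) x) : Prop :=
  ∀ p q, IsCrit (m := m) f p → IsCrit (m := m) f q → f q < f p →
    ∀ x ∈ Wminus ξ p ∩ Wplus ξ q,
      tangentAt m (Wminus ξ p) x ⊔ tangentAt m (Wplus ξ q) x = ⊤

/-- The numbers `(γ_u(p) + γ_s(p)) / Γ_s(p)`, for `p` a hyperbolic critical point, that is, a
critical point with `0 < λ(p) < m`. (The ratio does not depend on the adapted chart at `p`,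
because the `μ_i` are, up to sign, the eigenvalues of the linearization of `ξ` at `p`.) -/
def spectralRatios (f : M → ℝ) (ξ : (x : M) → TangentSpace (𝓡 m) x) : Set ℝ :=
  {r | ∃ p, IsCrit (m := m) f p ∧ 0 < morseIndex (m := m) f p ∧ morseIndex (m := m) f p < m ∧
    ∃ Ψ : AdaptedChart f ξ p, r = (Ψ.gammaU + Ψ.gammaS) / Ψ.bigGammaS}

/-- The estimate `δ(T_x S, T_y T) ≤ C dist(x, y) ^ α` for all `x ∈ S` and `y ∈ T` near `z`, where
the gap and the distance are measured in the Euclidean space `E` by means of `φ : M → E` (local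
coordinates near `z`, or a local embedding). -/
def GapEstimateAt (m : ℕ) {M : Type*} [TopologicalSpace M]
    [ChartedSpace (EuclideanSpace ℝ (Fin m)) M] {N : ℕ}
    (φ : M → EuclideanSpace ℝ (Fin N)) (S T : Set M) (z : M) (α : ℝ) : Prop :=
  ∃ U : Set M, IsOpen U ∧ z ∈ U ∧ ∃ C : ℝ, 0 < C ∧ ∀ x ∈ U ∩ S, ∀ y ∈ U ∩ T,
    gap (E := EuclideanSpace ℝ (Fin N))
      ((tangentAt m S x).map
        (mfderiv (𝓡 m) 𝓘(ℝ, EuclideanSpace ℝ (Fin N)) φ x).toLinearMap)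
      ((tangentAt m T y).map
        (mfderiv (𝓡 m) 𝓘(ℝ, EuclideanSpace ℝ (Fin N)) φ y).toLinearMap)
      ≤ C * dist (φ x) (φ y) ^ α

/-- The gap estimate with exponent `α` holds near `z` for every realization of a neighbourhood of
`z` in a Euclidean space by a `C²` immersion; this includes all `C²` charts around `z` and all
`C²` embeddings of `M`. -/
def GapHolderAt (m : ℕ) {M : Type*} [TopologicalSpace M]
    [ChartedSpace (EuclideanSpace ℝ (Fin m)) M] (S T : Set M) (z : M) (α : ℝ) : Prop :=
  ∀ (N : ℕ) (φ : M → EuclideanSpace ℝ (Fin N)),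
    ContMDiffAt (𝓡 m) 𝓘(ℝ, EuclideanSpace ℝ (Fin N)) 2 φ z →
    Function.Injective (mfderiv (𝓡 m) 𝓘(ℝ, EuclideanSpace ℝ (Fin N)) φ z) →
    GapEstimateAt m φ S T z α

/-- Verdier's regularity condition at `z` for the pair `(S, T)` of submanifolds. -/
def VerdierRegularAt (m : ℕ) {M : Type*} [TopologicalSpace M]
    [ChartedSpace (EuclideanSpace ℝ (Fin m)) M] (S T : Set M) (z : M) : Prop :=
  GapHolderAt m S T z 1

end

end MorseFlow

/-!
Work in an adapted chart at a critical point `q`, where the flow is the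
linear flow `e^{tA}` and the unstable manifold of `q` is the unstable subspace of `A`.

The heart of the matter is a slope estimate, `AdaptedChart.exists_isNear`: for `y ∈ W⁻_p` close to
`q`, the tangent space of `W⁻_p` at `y` contains a graph over the unstable subspace whose slope is
at most a constant times `|y_s| ^ ν`, where `y_s` is the stable coordinate of `y`. Flow `y`
backwards for the time `T` after which the stable coordinate has norm `1/2`. If `W⁻_p` is uniformly
transversal there to the stable directions, its tangent space contains a graph of bounded slope;
flowing forward again multiplies the slope by at most `e^{-(γ_u + γ_s) T}`, while
`|y_s| ≥ e^{-Γ_s T} / 2`, and `ν ≤ (γ_u + γ_s) / Γ_s` compares the two exponentials.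

The uniform transversality comes from compactness of the exit sphere, which lies in the stable
manifold of `q`. A point of it lies in some `W⁻_{p'}` with `f p' > f q`; by the Morse–Smale
condition `W⁻_{p'}` is transversal to `W⁺_q` there, and by the gap estimate for
`(W⁻_{p'}, W⁻_p)` the tangent spaces of `W⁻_p` nearby are at least as inclined. Thus the gap
estimates are proved by induction along the decreasing values of `f`
(`IsMorsePair.exists_isNear`).

The slope estimate is carried along `W⁻_q` by the flow (`AdaptedChart.gapEstimateAt`), and a `C²`
change of coordinates adds an error linear in the distance, which is why the exponent becomes
`min ν 1` for general immersions (`GapEstimateAt.gapHolderAt`). It is essential here that the flow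
of a `C²` field is itself `C²`; this is proved by augmenting the field by its linearization.

The frontier property follows by counting dimensions: a gap less than `1` does not decrease the
dimension, so if the closure of `W⁻_p` meets `W⁻_q` then the index of `q` is at most that of `p`
(`IsMorsePair.morseIndex_le_of_mem_closure`). Since every orbit emanates from a critical point, each
skeleton is closed.
-/

namespace MorseFlow

/-! ### Differentiable dependence of local flows on the initial point -/

section LocalFlow

variable {E : Type*} [NormedAddCommGroup E] [NormedSpace ℝ E]

/-- Grönwall's inequality on an interval around the initial time. -/
theorem norm_le_of_norm_deriv_le {f f' : ℝ → E} {K ε δ T : ℝ} (hK : 0 < K) (hε : 0 ≤ ε)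
    (hf : ∀ t ∈ Ioo (-T) T, HasDerivAt f (f' t) t) (h0 : ‖f 0‖ ≤ δ)
    (bound : ∀ t ∈ Ioo (-T) T, ‖f' t‖ ≤ K * ‖f t‖ + ε) {t : ℝ} (ht : t ∈ Ioo (-T) T) :
    ‖f t‖ ≤ (δ + ε / K) * Real.exp (K * T) := by
  have hδ : 0 ≤ δ := (norm_nonneg _).trans h0
  have key : ∀ b : ℝ, 0 ≤ b → b ≤ T →
      gronwallBound δ K ε (b - 0) ≤ (δ + ε / K) * Real.exp (K * T) := by
    intro b hb hbT
    have h1 : Real.exp (K * b) ≤ Real.exp (K * T) := by gcongr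
    have h2 : 0 ≤ ε / K := by positivity
    rw [gronwallBound_of_K_ne_0 hK.ne', sub_zero]
    nlinarith [mul_le_mul_of_nonneg_left h1 hδ, mul_le_mul_of_nonneg_left h1 h2]
  rcases le_total 0 t with h | h
  · have hsub : Icc 0 t ⊆ Ioo (-T) T := fun s hs => ⟨by linarith [hs.1, ht.1, ht.2], hs.2.trans_lt ht.2⟩
    refine (norm_le_gronwallBound_of_norm_deriv_right_le (a := 0) (b := t)
      (HasDerivAt.continuousOn fun s hs => hf s (hsub hs))
      (fun s hs => (hf s (hsub (Ico_subset_Icc_self hs))).hasDerivWithinAt) h0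
      (fun s hs => bound s (hsub (Ico_subset_Icc_self hs))) t ⟨h, le_rfl⟩).trans
      (key t h ht.2.le)
  · have hsub : ∀ s ∈ Icc 0 (-t), -s ∈ Ioo (-T) T := fun s hs =>
      ⟨by linarith [hs.2, ht.1], by linarith [hs.1, ht.1, ht.2]⟩
    have hd : ∀ s ∈ Icc 0 (-t), HasDerivAt (fun s => f (-s)) (-f' (-s)) s := fun s hs => by
      simpa [Function.comp_def] using (hf (-s) (hsub s hs)).scomp s (hasDerivAt_neg s)
    have := norm_le_gronwallBound_of_norm_deriv_right_le (a := 0) (b := -t)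
      (HasDerivAt.continuousOn hd)
      (fun s hs => (hd s (Ico_subset_Icc_self hs)).hasDerivWithinAt)
      (by simpa using h0)
      (fun s hs => by simpa using bound (-s) (hsub s (Ico_subset_Icc_self hs))) (-t)
      ⟨by linarith, le_rfl⟩
    rw [neg_neg] at this
    exact this.trans (key (-t) (by linarith) (by linarith [ht.1]))

/-- `α` is a flow of the vector field `v`, defined for initial points in `s` and times in
`(-T, T)`, with values in `B`. -/
structure IsLocalFlow (v : E → E) (B s : Set E) (T : ℝ) (α : E → ℝ → E) : Prop where
  init : ∀ x ∈ s, α x 0 = x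
  mem : ∀ x ∈ s, ∀ t ∈ Ioo (-T) T, α x t ∈ B
  deriv : ∀ x ∈ s, ∀ t ∈ Ioo (-T) T, HasDerivAt (α x) (v (α x t)) t

/-- `A x` solves, for each `x ∈ s`, the linearized equation along the orbit of `x`. -/
structure IsLinearizedFlow (v' : E → E →L[ℝ] E) (s : Set E) (T : ℝ) (α : E → ℝ → E)
    (A : E → ℝ → E →L[ℝ] E) : Prop where
  init : ∀ x ∈ s, A x 0 = ContinuousLinearMap.id ℝ E
  deriv : ∀ x ∈ s, ∀ t ∈ Ioo (-T) T, HasDerivAt (A x) (v' (α x t) ∘L A x t) t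

variable {v : E → E} {v' : E → E →L[ℝ] E} {B s : Set E} {T K : ℝ} {α : E → ℝ → E}
  {A : E → ℝ → E →L[ℝ] E}

theorem IsLocalFlow.norm_sub_le (hα : IsLocalFlow v B s T α) (hB : Convex ℝ B) (hK : 0 < K)
    (hv : ∀ z ∈ B, HasFDerivAt v (v' z) z) (hvK : ∀ z ∈ B, ‖v' z‖ ≤ K)
    {x y : E} (hx : x ∈ s) (hy : y ∈ s) {t : ℝ} (ht : t ∈ Ioo (-T) T) :
    ‖α y t - α x t‖ ≤ ‖y - x‖ * Real.exp (K * T) := by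
  have := norm_le_of_norm_deriv_le (f := fun t => α y t - α x t)
    (f' := fun t => v (α y t) - v (α x t)) (δ := ‖y - x‖) (ε := 0) hK le_rfl
    (fun t ht => (hα.deriv y hy t ht).sub (hα.deriv x hx t ht))
    (by simp [hα.init x hx, hα.init y hy])
    (fun t ht => by
      rw [add_zero]
      exact hB.norm_image_sub_le_of_norm_hasFDerivWithin_le
        (fun z hz => (hv z hz).hasFDerivWithinAt) hvK (hα.mem x hx t ht) (hα.mem y hy t ht)) ht
  simpa using this

theorem IsLinearizedFlow.norm_le (hA : IsLinearizedFlow v' s T α A) (hα : IsLocalFlow v B s T α)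
    (hK : 0 < K) (hvK : ∀ z ∈ B, ‖v' z‖ ≤ K) {x : E} (hx : x ∈ s) {t : ℝ}
    (ht : t ∈ Ioo (-T) T) : ‖A x t‖ ≤ Real.exp (K * T) := by
  have := norm_le_of_norm_deriv_le (f := A x) (δ := 1) (ε := 0) hK le_rfl (hA.deriv x hx)
    (by rw [hA.init x hx]; exact ContinuousLinearMap.norm_id_le)
    (fun t ht => by
      rw [add_zero]
      refine (ContinuousLinearMap.opNorm_comp_le _ _).trans ?_
      gcongr
      exact hvK _ (hα.mem x hx t ht)) ht
  simpa using this

/-- The solution of the linearized equation is the derivative of the flow. -/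
theorem IsLinearizedFlow.hasFDerivAt (hA : IsLinearizedFlow v' s T α A)
    (hα : IsLocalFlow v B s T α) (hs : IsOpen s) (hB : Convex ℝ B) (hK : 0 < K)
    (hv : ∀ z ∈ B, HasFDerivAt v (v' z) z) (hvK : ∀ z ∈ B, ‖v' z‖ ≤ K)
    (hvc : UniformContinuousOn v' B) {x : E} (hx : x ∈ s) {t : ℝ} (ht : t ∈ Ioo (-T) T) :
    HasFDerivAt (fun y => α y t) (A x t) x := by
  rw [hasFDerivAt_iff_isLittleO, Asymptotics.isLittleO_iff]
  intro c hc
  set L := Real.exp (K * T)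
  have hL : 0 < L := Real.exp_pos _
  obtain ⟨η, hη, hηc⟩ : ∃ η > 0, η * L / K * L ≤ c :=
    ⟨c * K / (L * L), by positivity, by field_simp; rfl⟩
  obtain ⟨δ, hδ, hδc⟩ := Metric.uniformContinuousOn_iff.1 hvc η hη
  have hnear : Metric.ball x (δ / L) ∈ 𝓝 x := Metric.ball_mem_nhds _ (by positivity)
  filter_upwards [hs.mem_nhds hx, hnear] with y hy hyx
  rw [Metric.mem_ball, dist_eq_norm, lt_div_iff₀ hL] at hyx
  have hd : ∀ t ∈ Ioo (-T) T, ‖α y t - α x t‖ ≤ ‖y - x‖ * L := fun t ht =>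
    hα.norm_sub_le hB hK hv hvK hx hy ht
  have := norm_le_of_norm_deriv_le (f := fun t => α y t - α x t - A x t (y - x))
    (f' := fun t => v (α y t) - v (α x t) - v' (α x t) (A x t (y - x))) (δ := 0)
    (ε := η * (‖y - x‖ * L)) hK (by positivity)
    (fun t ht => ((hα.deriv y hy t ht).sub (hα.deriv x hx t ht)).sub
      (by simpa using (hA.deriv x hx t ht).clm_apply (hasDerivAt_const t (y - x))))
    (by simp [hα.init x hx, hα.init y hy, hA.init x hx])
    (fun t ht => by
      have hxB := hα.mem x hx t ht
      have hyB := hα.mem y hy t ht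
      have hconv : Convex ℝ (B ∩ Metric.ball (α x t) δ) := hB.inter (convex_ball _ _)
      have h1 : ‖v (α y t) - v (α x t) - v' (α x t) (α y t - α x t)‖ ≤ η * ‖α y t - α x t‖ :=
        hconv.norm_image_sub_le_of_norm_hasFDerivWithin_le'
          (fun z hz => (hv z hz.1).hasFDerivWithinAt)
          (fun z hz => by
            rw [← dist_eq_norm]
            exact (hδc z hz.1 _ hxB hz.2).le)
          ⟨hxB, Metric.mem_ball_self hδ⟩
          ⟨hyB, by rw [Metric.mem_ball, dist_eq_norm]; exact (hd t ht).trans_lt hyx⟩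
      have h2 : v (α y t) - v (α x t) - v' (α x t) (A x t (y - x)) =
          v' (α x t) (α y t - α x t - A x t (y - x)) +
            (v (α y t) - v (α x t) - v' (α x t) (α y t - α x t)) := by
        rw [map_sub (v' (α x t)) (α y t - α x t)]; abel
      rw [h2]
      refine (norm_add_le _ _).trans (add_le_add ?_ (h1.trans ?_))
      · exact (ContinuousLinearMap.le_opNorm _ _).trans
          (mul_le_mul_of_nonneg_right (hvK _ hxB) (norm_nonneg _))
      · exact mul_le_mul_of_nonneg_left (hd t ht) hη.le) ht
  refine this.trans ?_
  rw [zero_add]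
  calc η * (‖y - x‖ * L) / K * L = (η * L / K * L) * ‖y - x‖ := by ring
    _ ≤ c * ‖y - x‖ := by gcongr

theorem IsLinearizedFlow.continuousOn (hA : IsLinearizedFlow v' s T α A)
    (hα : IsLocalFlow v B s T α) (hs : IsOpen s) (hB : Convex ℝ B) (hK : 0 < K)
    (hv : ∀ z ∈ B, HasFDerivAt v (v' z) z) (hvK : ∀ z ∈ B, ‖v' z‖ ≤ K)
    (hvc : UniformContinuousOn v' B) {t : ℝ} (ht : t ∈ Ioo (-T) T) :
    ContinuousOn (fun y => A y t) s := by
  intro x hx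
  apply ContinuousAt.continuousWithinAt
  rw [Metric.continuousAt_iff']
  intro c hc
  set L := Real.exp (K * T)
  have hL : 0 < L := Real.exp_pos _
  obtain ⟨η, hη, hηc⟩ : ∃ η > 0, η * L / K * L < c :=
    ⟨c * K / (L * L) / 2, by positivity, by
      have : c * K / (L * L) / 2 * L / K * L = c / 2 := by field_simp
      rw [this]; linarith⟩
  obtain ⟨δ, hδ, hδc⟩ := Metric.uniformContinuousOn_iff.1 hvc η hη
  have hnear : Metric.ball x (δ / L) ∈ 𝓝 x := Metric.ball_mem_nhds _ (by positivity)
  filter_upwards [hs.mem_nhds hx, hnear] with y hy hyx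
  rw [Metric.mem_ball, dist_eq_norm, lt_div_iff₀ hL] at hyx
  rw [dist_eq_norm]
  have := norm_le_of_norm_deriv_le (f := fun t => A y t - A x t)
    (f' := fun t => v' (α y t) ∘L A y t - v' (α x t) ∘L A x t) (δ := 0)
    (ε := η * L) hK (by positivity)
    (fun t ht => (hA.deriv y hy t ht).sub (hA.deriv x hx t ht))
    (by simp [hA.init x hx, hA.init y hy])
    (fun t ht => by
      have hxB := hα.mem x hx t ht
      have hyB := hα.mem y hy t ht
      have h1 : ‖v' (α y t) - v' (α x t)‖ ≤ η := by
        rw [← dist_eq_norm]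
        refine (hδc _ hyB _ hxB ?_).le
        rw [dist_eq_norm]
        exact (hα.norm_sub_le hB hK hv hvK hx hy ht).trans_lt hyx
      have h2 : v' (α y t) ∘L A y t - v' (α x t) ∘L A x t =
          v' (α y t) ∘L (A y t - A x t) + (v' (α y t) - v' (α x t)) ∘L A x t := by
        ext w; simp
      rw [h2]
      refine (norm_add_le _ _).trans (add_le_add ?_ ?_)
      · exact (ContinuousLinearMap.opNorm_comp_le _ _).trans
          (mul_le_mul_of_nonneg_right (hvK _ hyB) (norm_nonneg _))
      · exact (ContinuousLinearMap.opNorm_comp_le _ _).trans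
          (mul_le_mul h1 (hA.norm_le hα hK hvK hx ht) (norm_nonneg _) hη.le)) ht
  refine this.trans_lt ?_
  rwa [zero_add]

/-- The Picard–Lindelöf theorem on an open time interval, with control of the values. -/
theorem exists_hasDerivAt_mem_closedBall [CompleteSpace E] {f : ℝ → E → E} {T : ℝ} (hT : 0 < T)
    {x₀ x : E} {a r L K : NNReal}
    (hf : IsPicardLindelof f (tmin := -T) (tmax := T) ⟨0, by constructor <;> linarith⟩ x₀ a r L K)
    (hx : x ∈ Metric.closedBall x₀ r) :
    ∃ β : ℝ → E, β 0 = x ∧ (∀ t, β t ∈ Metric.closedBall x₀ a) ∧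
      ∀ t ∈ Ioo (-T) T, HasDerivAt β (f t (β t)) t := by
  obtain ⟨β, hβ⟩ := ODE.FunSpace.exists_isFixedPt_next hf hx
  refine ⟨β.compProj, ?_, fun t => β.compProj_mem_closedBall hf.mul_max_le, fun t ht => ?_⟩
  · have : β.compProj ((⟨0, by constructor <;> linarith⟩ : Icc (-T) T) : ℝ) = x := by
      rw [ODE.FunSpace.compProj_val, ← hβ, ODE.FunSpace.next_apply₀]
    exact this
  · refine HasDerivWithinAt.hasDerivAt ?_ (Icc_mem_nhds ht.1 ht.2)
    refine (ODE.hasDerivWithinAt_picard_Icc (t₀ := 0) ⟨by linarith, hT.le⟩ hf.continuousOn_uncurry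
      β.continuous_compProj.continuousOn (fun _ _ => β.compProj_mem_closedBall hf.mul_max_le)
      x (Ioo_subset_Icc_self ht)).congr_of_mem ?_ (Ioo_subset_Icc_self ht)
    intro t' ht'
    nth_rw 1 [← hβ]
    rw [ODE.FunSpace.compProj_of_mem ht', ODE.FunSpace.next_apply]

/-- A `C¹` vector field has a local flow which is `C¹` in the initial point. -/
theorem exists_isLocalFlow_contDiffOn_one [FiniteDimensional ℝ E] {x₀ : E}
    (hv : ContDiffAt ℝ 1 v x₀) {u : Set E} (hu : u ∈ 𝓝 x₀) :
    ∃ s, IsOpen s ∧ x₀ ∈ s ∧ ∃ T > 0, ∃ α, IsLocalFlow v u s T α ∧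
      ∀ t ∈ Ioo (-T) T, ContDiffOn ℝ 1 (fun x => α x t) s := by
  have : CompleteSpace E := FiniteDimensional.complete ℝ E
  have : ProperSpace E := FiniteDimensional.proper_real E
  obtain ⟨a, ha, hau⟩ := Metric.nhds_basis_closedBall.mem_iff.1
    (inter_mem hu (hv.eventually (by simp)))
  have hva : ∀ z ∈ Metric.closedBall x₀ a, ContDiffAt ℝ 1 v z := fun z hz => by
    simpa using (hau hz).2
  set B := Metric.closedBall x₀ a
  have hBc : IsCompact B := isCompact_closedBall _ _
  have hB : Convex ℝ B := convex_closedBall _ _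
  have hd : ∀ z ∈ B, HasFDerivAt v (fderiv ℝ v z) z := fun z hz =>
    ((hva z hz).differentiableAt (by simp)).hasFDerivAt
  have hcont : ContinuousOn (fderiv ℝ v) B := fun z hz =>
    ((hva z hz).fderiv_right (m := 0) (by simp)).continuousAt.continuousWithinAt
  have hvc : UniformContinuousOn (fderiv ℝ v) B := hBc.uniformContinuousOn_of_continuous hcont
  obtain ⟨K₀, hK₀⟩ := hBc.exists_bound_of_continuousOn hcont
  obtain ⟨L₀, hL₀⟩ := hBc.exists_bound_of_continuousOn
    (fun z hz => (hd z hz).continuousAt.continuousWithinAt)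
  set K : NNReal := ⟨max K₀ 0 + 1, by positivity⟩
  set L : NNReal := ⟨max L₀ 0 + 1, by positivity⟩
  have hK : (0 : ℝ) < K := by change 0 < max K₀ 0 + 1; positivity
  have hL : (0 : ℝ) < L := by change 0 < max L₀ 0 + 1; positivity
  have hvK : ∀ z ∈ B, ‖fderiv ℝ v z‖ ≤ K := fun z hz => (hK₀ z hz).trans (by
    change K₀ ≤ max K₀ 0 + 1; linarith [le_max_left K₀ 0])
  have hvL : ∀ z ∈ B, ‖v z‖ ≤ L := fun z hz => (hL₀ z hz).trans (by
    change L₀ ≤ max L₀ 0 + 1; linarith [le_max_left L₀ 0])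
  -- short enough for the solutions to stay in the ball, and for the linearized solutions to stay
  -- within distance `1` of the identity
  obtain ⟨T, hT, hTL, hTK⟩ : ∃ T > 0, (L : ℝ) * T ≤ a / 2 ∧ (K : ℝ) * 2 * T ≤ 1 := by
    refine ⟨min (a / 2 / L) (1 / (K * 2)), by positivity, ?_, ?_⟩
    · calc (L : ℝ) * min (a / 2 / L) (1 / (K * 2)) ≤ L * (a / 2 / L) := by
            gcongr; exact min_le_left _ _
        _ = a / 2 := by field_simp
    · calc (K : ℝ) * 2 * min (a / 2 / L) (1 / (K * 2)) ≤ K * 2 * (1 / (K * 2)) := by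
            gcongr; exact min_le_right _ _
        _ = 1 := by field_simp
  have hmax : max (T - (0 : ℝ)) (0 - -T) = T := by simp
  have hpl : IsPicardLindelof (fun _ => v) (tmin := -T) (tmax := T)
      ⟨0, by constructor <;> linarith⟩ x₀ ⟨a, ha.le⟩ ⟨a / 2, by positivity⟩ L K := by
    refine .of_time_independent hvL ?_ ?_
    · exact hB.lipschitzOnWith_of_nnnorm_hasFDerivWithin_le
        (fun z hz => (hd z hz).hasFDerivWithinAt) hvK
    · change (L : ℝ) * max (T - (0 : ℝ)) (0 - -T) ≤ a - a / 2
      rw [hmax]; linarith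
  have hsol : ∀ x, ∃ β : ℝ → E, x ∈ Metric.ball x₀ (a / 2) → β 0 = x ∧ (∀ t, β t ∈ B) ∧
      ∀ t ∈ Ioo (-T) T, HasDerivAt β (v (β t)) t := by
    intro x
    by_cases hx : x ∈ Metric.ball x₀ (a / 2)
    · obtain ⟨β, hβ⟩ := exists_hasDerivAt_mem_closedBall hT hpl (Metric.ball_subset_closedBall hx)
      exact ⟨β, fun _ => hβ⟩
    · exact ⟨0, fun h => absurd h hx⟩
  choose α hα using hsol
  have hflow : IsLocalFlow v B (Metric.ball x₀ (a / 2)) T α :=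
    ⟨fun x hx => (hα x hx).1, fun x hx t _ => (hα x hx).2.1 t, fun x hx => (hα x hx).2.2⟩
  have hlin : ∀ x, ∃ A : ℝ → E →L[ℝ] E, x ∈ Metric.ball x₀ (a / 2) →
      A 0 = ContinuousLinearMap.id ℝ E ∧
      ∀ t ∈ Ioo (-(T / 2)) (T / 2), HasDerivAt A (fderiv ℝ v (α x t) ∘L A t) t := by
    intro x
    by_cases hx : x ∈ Metric.ball x₀ (a / 2)
    swap
    · exact ⟨0, fun h => absurd h hx⟩
    have hsub : Icc (-(T / 2)) (T / 2) ⊆ Ioo (-T) T := fun t ht =>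
      ⟨by linarith [ht.1], by linarith [ht.2]⟩
    have hpl' : IsPicardLindelof (fun t (A : E →L[ℝ] E) => fderiv ℝ v (α x t) ∘L A)
        (tmin := -(T / 2)) (tmax := T / 2) ⟨0, by constructor <;> linarith⟩
        (ContinuousLinearMap.id ℝ E) 1 0 (K * 2) K := by
      refine ⟨fun t ht => ?_, fun A _ => ?_, fun t ht A hA => ?_, ?_⟩
      · refine LipschitzOnWith.of_dist_le_mul fun A _ A' _ => ?_
        rw [dist_eq_norm, dist_eq_norm, ← ContinuousLinearMap.comp_sub]
        exact (ContinuousLinearMap.opNorm_comp_le _ _).trans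
          (mul_le_mul_of_nonneg_right (hvK _ (hflow.mem x hx t (hsub ht))) (norm_nonneg _))
      · refine ContinuousOn.clm_comp ?_ continuousOn_const
        exact hcont.comp (fun t ht =>
          (hflow.deriv x hx t (hsub ht)).continuousAt.continuousWithinAt)
          fun t ht => hflow.mem x hx t (hsub ht)
      · have h2 : ‖A‖ ≤ 2 := by
          rw [Metric.mem_closedBall, dist_eq_norm] at hA
          have h1 : ‖ContinuousLinearMap.id ℝ E‖ ≤ 1 := ContinuousLinearMap.norm_id_le
          have h3 : ‖A‖ ≤ ‖A - ContinuousLinearMap.id ℝ E‖ + ‖ContinuousLinearMap.id ℝ E‖ :=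
            norm_le_norm_sub_add _ _
          have h4 : ((1 : NNReal) : ℝ) = 1 := rfl
          linarith
        exact (ContinuousLinearMap.opNorm_comp_le _ _).trans
          (mul_le_mul (hvK _ (hflow.mem x hx t (hsub ht))) h2 (norm_nonneg _) hK.le)
      · change ((K * 2 : NNReal) : ℝ) * max (T / 2 - (0 : ℝ)) (0 - -(T / 2)) ≤ 1 - 0
        have hmax' : max (T / 2 - (0 : ℝ)) (0 - -(T / 2)) = T / 2 := by simp
        rw [hmax']; push_cast; nlinarith
    obtain ⟨A, hA0, -, hA⟩ := exists_hasDerivAt_mem_closedBall (by linarith) hpl'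
      (Metric.mem_closedBall_self (by simp))
    exact ⟨A, fun _ => ⟨hA0, hA⟩⟩
  choose A hA using hlin
  have hsub : Ioo (-(T / 2)) (T / 2) ⊆ Ioo (-T) T := Ioo_subset_Ioo (by linarith) (by linarith)
  have hflow' : IsLocalFlow v B (Metric.ball x₀ (a / 2)) (T / 2) α :=
    ⟨hflow.init, fun x hx t ht => hflow.mem x hx t (hsub ht),
      fun x hx t ht => hflow.deriv x hx t (hsub ht)⟩
  have hAflow : IsLinearizedFlow (fderiv ℝ v) (Metric.ball x₀ (a / 2)) (T / 2) α A :=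
    ⟨fun x hx => (hA x hx).1, fun x hx => (hA x hx).2⟩
  refine ⟨Metric.ball x₀ (a / 2), Metric.isOpen_ball, Metric.mem_ball_self (by positivity), T / 2,
    by positivity, α, ⟨hflow'.init, fun x hx t ht => (hau (hflow'.mem x hx t ht)).1,
      hflow'.deriv⟩, fun t ht => ?_⟩
  have hD : ∀ x ∈ Metric.ball x₀ (a / 2), HasFDerivAt (fun y => α y t) (A x t) x := fun x hx =>
    hAflow.hasFDerivAt hflow' Metric.isOpen_ball hB hK hd hvK hvc hx ht
  rw [show (1 : ℕ∞ω) = 0 + 1 by simp, contDiffOn_succ_iff_fderiv_of_isOpen Metric.isOpen_ball]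
  refine ⟨fun x hx => (hD x hx).differentiableAt.differentiableWithinAt, by simp, ?_⟩
  rw [contDiffOn_zero]
  exact (hAflow.continuousOn hflow' Metric.isOpen_ball hB hK hd hvK hvc ht).congr
    fun x hx => (hD x hx).fderiv

/-- A `C²` vector field has a local flow which is `C²` in the initial point: the flow together
with its derivative is the flow of the `C¹` field `(x, A) ↦ (v x, Dv x ∘ A)`. -/
theorem exists_isLocalFlow_contDiffOn_two [FiniteDimensional ℝ E] {x₀ : E}
    (hv : ContDiffAt ℝ 2 v x₀) {u : Set E} (hu : u ∈ 𝓝 x₀) :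
    ∃ s, IsOpen s ∧ x₀ ∈ s ∧ ∃ T > 0, ∃ α, IsLocalFlow v u s T α ∧
      ∀ t ∈ Ioo (-T) T, ContDiffOn ℝ 2 (fun x => α x t) s := by
  have : ProperSpace E := FiniteDimensional.proper_real E
  set w : E × (E →L[ℝ] E) → E × (E →L[ℝ] E) := fun p => (v p.1, fderiv ℝ v p.1 ∘L p.2)
  have hw : ContDiffAt ℝ 1 w (x₀, ContinuousLinearMap.id ℝ E) := by
    refine ContDiffAt.prodMk ?_ (ContDiffAt.clm_comp ?_ contDiffAt_snd)
    · exact ContDiffAt.comp (x₀, ContinuousLinearMap.id ℝ E) (hv.of_le (by norm_num))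
        contDiffAt_fst
    · exact ContDiffAt.comp (x₀, ContinuousLinearMap.id ℝ E)
        (hv.fderiv_right (m := 1) (by norm_num)) contDiffAt_fst
  have hv1 : ContDiffAt ℝ 1 v x₀ := hv.of_le (by norm_num)
  obtain ⟨a, ha, hau⟩ := Metric.nhds_basis_closedBall.mem_iff.1
    (inter_mem hu (hv1.eventually (by simp)))
  have hva : ∀ z ∈ Metric.closedBall x₀ a, ContDiffAt ℝ 1 v z := fun z hz => by
    simpa using (hau hz).2
  set B := Metric.closedBall x₀ a
  have hBc : IsCompact B := isCompact_closedBall _ _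
  have hB : Convex ℝ B := convex_closedBall _ _
  have hd : ∀ z ∈ B, HasFDerivAt v (fderiv ℝ v z) z := fun z hz =>
    ((hva z hz).differentiableAt (by simp)).hasFDerivAt
  have hcont : ContinuousOn (fderiv ℝ v) B := fun z hz =>
    ((hva z hz).fderiv_right (m := 0) (by simp)).continuousAt.continuousWithinAt
  have hvc : UniformContinuousOn (fderiv ℝ v) B := hBc.uniformContinuousOn_of_continuous hcont
  obtain ⟨K₀, hK₀⟩ := hBc.exists_bound_of_continuousOn hcont
  have hK : (0 : ℝ) < max K₀ 0 + 1 := by positivity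
  have hvK : ∀ z ∈ B, ‖fderiv ℝ v z‖ ≤ max K₀ 0 + 1 := fun z hz => (hK₀ z hz).trans (by
    linarith [le_max_left K₀ 0])
  obtain ⟨s', hs', hx₀, T, hT, β, hβ, hβ1⟩ := exists_isLocalFlow_contDiffOn_one hw
    (u := Prod.fst ⁻¹' B) (continuousAt_fst.preimage_mem_nhds (Metric.closedBall_mem_nhds _ ha))
  set ι : E → E × (E →L[ℝ] E) := fun x => (x, ContinuousLinearMap.id ℝ E)
  have hι : ContDiff ℝ 1 ι := contDiff_id.prodMk contDiff_const
  set s := ι ⁻¹' s'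
  have hs : IsOpen s := hs'.preimage hι.continuous
  have hflow : IsLocalFlow v B s T (fun x t => (β (ι x) t).1) :=
    ⟨fun x hx => by rw [hβ.init _ hx], fun x hx t ht => hβ.mem _ hx t ht,
      fun x hx t ht => (hβ.deriv _ hx t ht).fst⟩
  have hlin : IsLinearizedFlow (fderiv ℝ v) s T (fun x t => (β (ι x) t).1)
      (fun x t => (β (ι x) t).2) :=
    ⟨fun x hx => by rw [hβ.init _ hx], fun x hx t ht => (hβ.deriv _ hx t ht).snd⟩
  refine ⟨s, hs, hx₀, T, hT, _, ⟨hflow.init, fun x hx t ht => (hau (hflow.mem x hx t ht)).1,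
    hflow.deriv⟩, fun t ht => ?_⟩
  have hD := fun x (hx : x ∈ s) => hlin.hasFDerivAt hflow hs hB hK hd hvK hvc hx ht
  rw [show (2 : ℕ∞ω) = 1 + 1 by norm_num, contDiffOn_succ_iff_fderiv_of_isOpen hs]
  refine ⟨fun x hx => (hD x hx).differentiableAt.differentiableWithinAt, by simp, ?_⟩
  refine ContDiffOn.congr ?_ fun x hx => (hD x hx).fderiv
  exact ((hβ1 t ht).comp hι.contDiffOn (fun x hx => hx)).snd

end LocalFlow

/-! ### The flow of a vector field on a compact manifold -/

section Flow

variable {m : ℕ} {M : Type*} [TopologicalSpace M] [ChartedSpace (EuclideanSpace ℝ (Fin m)) M]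

/-- The coordinate representation of a vector field in a chart. -/
noncomputable def chartField (ξ : (x : M) → TangentSpace (𝓡 m) x)
    (Ψ : OpenPartialHomeomorph M (EuclideanSpace ℝ (Fin m))) (u : EuclideanSpace ℝ (Fin m)) :
    EuclideanSpace ℝ (Fin m) :=
  mfderiv (𝓡 m) 𝓘(ℝ, EuclideanSpace ℝ (Fin m)) Ψ (Ψ.symm u) (ξ (Ψ.symm u))

variable {ξ : (x : M) → TangentSpace (𝓡 m) x}
  {Ψ : OpenPartialHomeomorph M (EuclideanSpace ℝ (Fin m))}

theorem hasMFDerivAt_symm_comp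
    (hΨ : ContMDiffOn (𝓡 m) 𝓘(ℝ, EuclideanSpace ℝ (Fin m)) 1 Ψ Ψ.source)
    (hΨ' : ContMDiffOn 𝓘(ℝ, EuclideanSpace ℝ (Fin m)) (𝓡 m) 1 Ψ.symm Ψ.target)
    {u : ℝ → EuclideanSpace ℝ (Fin m)} {t : ℝ} (hu : HasDerivAt u (chartField ξ Ψ (u t)) t)
    (ht : u t ∈ Ψ.target) :
    HasMFDerivAt 𝓘(ℝ, ℝ) (𝓡 m) (fun t => Ψ.symm (u t)) t
      ((1 : ℝ →L[ℝ] ℝ).smulRight (ξ (Ψ.symm (u t)))) := by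
  have h1 : HasMFDerivAt 𝓘(ℝ, EuclideanSpace ℝ (Fin m)) (𝓡 m) Ψ.symm (u t)
      (mfderiv 𝓘(ℝ, EuclideanSpace ℝ (Fin m)) (𝓡 m) Ψ.symm (u t)) :=
    ((hΨ'.contMDiffAt (Ψ.open_target.mem_nhds ht)).mdifferentiableAt (by simp)).hasMFDerivAt
  have hs : Ψ.symm (u t) ∈ Ψ.source := Ψ.map_target ht
  have h2 : HasMFDerivAt (𝓡 m) 𝓘(ℝ, EuclideanSpace ℝ (Fin m)) Ψ (Ψ.symm (u t))
      (mfderiv (𝓡 m) 𝓘(ℝ, EuclideanSpace ℝ (Fin m)) Ψ (Ψ.symm (u t))) :=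
    ((hΨ.contMDiffAt (Ψ.open_source.mem_nhds hs)).mdifferentiableAt (by simp)).hasMFDerivAt
  have h3 := HasMFDerivAt.comp t h1 hu.hasFDerivAt.hasMFDerivAt
  refine h3.congr_mfderiv ?_
  have h4 : (mfderiv 𝓘(ℝ, EuclideanSpace ℝ (Fin m)) (𝓡 m) Ψ.symm (u t)).comp
      (mfderiv (𝓡 m) 𝓘(ℝ, EuclideanSpace ℝ (Fin m)) Ψ (Ψ.symm (u t))) =
      ContinuousLinearMap.id ℝ (TangentSpace (𝓡 m) (Ψ.symm (u t))) := by
    have h1' := h1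
    rw [← Ψ.right_inv ht] at h1'
    have h5 := HasMFDerivAt.comp (Ψ.symm (u t)) h1' h2
    have h6 : HasMFDerivAt (𝓡 m) (𝓡 m) (Ψ.symm ∘ Ψ) (Ψ.symm (u t))
        (ContinuousLinearMap.id ℝ (TangentSpace (𝓡 m) (Ψ.symm (u t)))) := by
      refine (hasMFDerivAt_id (Ψ.symm (u t))).congr_of_eventuallyEq ?_
      filter_upwards [Ψ.open_source.mem_nhds hs] with x hx using Ψ.left_inv hx
    have h7 := hasMFDerivAt_unique h5 h6
    rw [Ψ.right_inv ht] at h7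
    exact h7
  ext
  have h8 := DFunLike.congr_fun h4 (ξ (Ψ.symm (u t)))
  change mfderiv 𝓘(ℝ, EuclideanSpace ℝ (Fin m)) (𝓡 m) Ψ.symm (u t)
    ((1 : ℝ) • chartField ξ Ψ (u t)) = (1 : ℝ) • ξ (Ψ.symm (u t))
  rw [one_smul, one_smul]
  exact h8

theorem contDiffAt_chartField [IsManifold (𝓡 m) ω M]
    (hξ : ContMDiff (𝓡 m) (𝓡 m).tangent 2 (fun x => (⟨x, ξ x⟩ : TangentBundle (𝓡 m) M)))
    (x₀ : M) : ContDiffAt ℝ 2 (chartField ξ (chartAt (EuclideanSpace ℝ (Fin m)) x₀))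
      (chartAt (EuclideanSpace ℝ (Fin m)) x₀ x₀) := by
  have h := hξ x₀
  rw [contMDiffAt_iff] at h
  have h2 := (h.2.contDiffAt (by simp)).snd
  refine h2.congr_of_eventuallyEq ?_
  have : (chartAt (EuclideanSpace ℝ (Fin m)) x₀).target ∈
      𝓝 (extChartAt (𝓡 m) x₀ x₀) := by
    simpa using (chartAt (EuclideanSpace ℝ (Fin m)) x₀).open_target.mem_nhds
      (mem_chart_target (EuclideanSpace ℝ (Fin m)) x₀)
  filter_upwards [this] with u hu
  unfold chartField
  rw [mfderiv_chartAt_eq_tangentCoordChange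
    ((chartAt (EuclideanSpace ℝ (Fin m)) x₀).map_target hu)]
  rfl

/-- Short-time solutions through the points near `x₀`, depending twice differentiably on the
initial point. -/
theorem exists_local_flow [IsManifold (𝓡 m) ω M]
    (hξ : ContMDiff (𝓡 m) (𝓡 m).tangent 2 (fun x => (⟨x, ξ x⟩ : TangentBundle (𝓡 m) M)))
    (x₀ : M) : ∃ U : Set M, IsOpen U ∧ x₀ ∈ U ∧ ∃ T > 0, ∃ F : ℝ → M → M,
      (∀ x ∈ U, F 0 x = x ∧ IsMIntegralCurveOn (fun t => F t x) ξ (Ioo (-T) T)) ∧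
      ∀ t ∈ Ioo (-T) T, ContMDiffOn (𝓡 m) (𝓡 m) 2 (F t) U := by
  have hC : ContMDiffOn (𝓡 m) 𝓘(ℝ, EuclideanSpace ℝ (Fin m)) 2
    (chartAt (EuclideanSpace ℝ (Fin m)) x₀) (chartAt (EuclideanSpace ℝ (Fin m)) x₀).source :=
    contMDiffOn_chart
  have hC' : ContMDiffOn 𝓘(ℝ, EuclideanSpace ℝ (Fin m)) (𝓡 m) 2
    (chartAt (EuclideanSpace ℝ (Fin m)) x₀).symm
      (chartAt (EuclideanSpace ℝ (Fin m)) x₀).target :=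
    contMDiffOn_chart_symm
  have hv := contDiffAt_chartField hξ x₀
  have hx₀ := mem_chart_source (EuclideanSpace ℝ (Fin m)) x₀
  generalize chartAt (EuclideanSpace ℝ (Fin m)) x₀ = Ψ at *
  obtain ⟨s, hs, hxs, T, hT, α, hα, hα2⟩ := exists_isLocalFlow_contDiffOn_two hv
    (Ψ.open_target.mem_nhds (Ψ.map_source hx₀))
  refine ⟨Ψ.source ∩ Ψ ⁻¹' s, Ψ.isOpen_inter_preimage hs, ⟨hx₀, hxs⟩, T, hT,
    fun t x => Ψ.symm (α (Ψ x) t), fun x hx => ⟨?_, fun t ht => ?_⟩, fun t ht => ?_⟩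
  · change Ψ.symm (α (Ψ x) 0) = x
    rw [hα.init _ hx.2, Ψ.left_inv hx.1]
  · exact (hasMFDerivAt_symm_comp (hC.of_le (by norm_num)) (hC'.of_le (by norm_num))
      (hα.deriv _ hx.2 t ht) (hα.mem _ hx.2 t ht)).hasMFDerivWithinAt
  · exact hC'.comp ((hα2 t ht).contMDiffOn.comp (hC.mono inter_subset_left) fun x hx => hx.2)
      fun x hx => hα.mem _ hx.2 t ht

variable [IsManifold (𝓡 m) ω M] [CompactSpace M] [T2Space M]

theorem exists_isMIntegralCurve
    (hξ : ContMDiff (𝓡 m) (𝓡 m).tangent 2 (fun x => (⟨x, ξ x⟩ : TangentBundle (𝓡 m) M)))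
    (x : M) : ∃ γ : ℝ → M, γ 0 = x ∧ IsMIntegralCurve γ ξ := by
  have hξ1 : ContMDiff (𝓡 m) (𝓡 m).tangent 1 (fun x => (⟨x, ξ x⟩ : TangentBundle (𝓡 m) M)) :=
    hξ.of_le (by norm_num)
  choose U hU hxU T hT F hF _ using exists_local_flow hξ
  obtain ⟨S, -, hS⟩ := isCompact_univ.elim_nhds_subcover U
    fun x _ => (hU x).mem_nhds (hxU x)
  obtain ⟨ε, hε, hεS⟩ : ∃ ε > 0, ∀ y ∈ S, ε ≤ T y := by
    rcases S.eq_empty_or_nonempty with rfl | hne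
    · exact ⟨1, one_pos, by simp⟩
    · obtain ⟨y, hy, hmin⟩ := S.exists_min_image T hne
      exact ⟨T y, hT y, hmin⟩
  refine exists_isMIntegralCurve_of_isMIntegralCurveOn hξ1 hε (fun x => ?_) x
  obtain ⟨y, hy, hxy⟩ := mem_iUnion₂.1 (hS (mem_univ x))
  exact ⟨fun t => F y t x, (hF y x hxy).1, (hF y x hxy).2.mono
    (Ioo_subset_Ioo (neg_le_neg (hεS y hy)) (hεS y hy))⟩

theorem flow_spec
    (hξ : ContMDiff (𝓡 m) (𝓡 m).tangent 2 (fun x => (⟨x, ξ x⟩ : TangentBundle (𝓡 m) M)))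
    (x : M) : flow ξ 0 x = x ∧ IsMIntegralCurve (fun t => flow ξ t x) ξ := by
  have h := exists_isMIntegralCurve hξ x
  have : (fun t => flow ξ t x) = h.choose := by
    funext t
    rw [flow, dif_pos h]
  rw [this]
  exact ⟨(congrFun this 0).trans h.choose_spec.1, h.choose_spec.2⟩

theorem eq_flow_of_isMIntegralCurveOn
    (hξ : ContMDiff (𝓡 m) (𝓡 m).tangent 2 (fun x => (⟨x, ξ x⟩ : TangentBundle (𝓡 m) M)))
    {γ : ℝ → M} {a b : ℝ} (hab : (0 : ℝ) ∈ Ioo a b) (hγ : IsMIntegralCurveOn γ ξ (Ioo a b))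
    {t : ℝ} (ht : t ∈ Ioo a b) : γ t = flow ξ t (γ 0) :=
  isMIntegralCurveOn_Ioo_eqOn_of_contMDiff_boundaryless hab (hξ.of_le (by norm_num)) hγ
    ((flow_spec hξ (γ 0)).2.isMIntegralCurveOn _) (flow_spec hξ (γ 0)).1.symm ht

theorem flow_add
    (hξ : ContMDiff (𝓡 m) (𝓡 m).tangent 2 (fun x => (⟨x, ξ x⟩ : TangentBundle (𝓡 m) M)))
    (s t : ℝ) (x : M) : flow ξ (s + t) x = flow ξ s (flow ξ t x) := by
  have h := isMIntegralCurve_Ioo_eq_of_contMDiff_boundaryless (t₀ := 0) (hξ.of_le (by norm_num))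
    ((flow_spec hξ x).2.comp_add t) (flow_spec hξ (flow ξ t x)).2
    (by simp [(flow_spec hξ (flow ξ t x)).1])
  exact congrFun h s

theorem flow_neg_flow
    (hξ : ContMDiff (𝓡 m) (𝓡 m).tangent 2 (fun x => (⟨x, ξ x⟩ : TangentBundle (𝓡 m) M)))
    (t : ℝ) (x : M) : flow ξ (-t) (flow ξ t x) = x := by
  rw [← flow_add hξ, neg_add_cancel, (flow_spec hξ x).1]

theorem flow_flow_neg
    (hξ : ContMDiff (𝓡 m) (𝓡 m).tangent 2 (fun x => (⟨x, ξ x⟩ : TangentBundle (𝓡 m) M)))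
    (t : ℝ) (x : M) : flow ξ t (flow ξ (-t) x) = x := by
  rw [← flow_add hξ, add_neg_cancel, (flow_spec hξ x).1]

theorem contMDiff_flow
    (hξ : ContMDiff (𝓡 m) (𝓡 m).tangent 2 (fun x => (⟨x, ξ x⟩ : TangentBundle (𝓡 m) M)))
    (t : ℝ) : ContMDiff (𝓡 m) (𝓡 m) 2 (flow ξ t) := by
  choose U hU hxU T hT F hF hF2 using exists_local_flow hξ
  obtain ⟨S, -, hS⟩ := isCompact_univ.elim_nhds_subcover U
    fun x _ => (hU x).mem_nhds (hxU x)
  obtain ⟨ε, hε, hεS⟩ : ∃ ε > 0, ∀ y ∈ S, ε ≤ T y := by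
    rcases S.eq_empty_or_nonempty with rfl | hne
    · exact ⟨1, one_pos, by simp⟩
    · obtain ⟨y, hy, hmin⟩ := S.exists_min_image T hne
      exact ⟨T y, hT y, hmin⟩
  have hsmall : ∀ t ∈ Ioo (-ε) ε, ContMDiff (𝓡 m) (𝓡 m) 2 (flow ξ t) := by
    intro t ht x
    obtain ⟨y, hy, hxy⟩ := mem_iUnion₂.1 (hS (mem_univ x))
    have hty : t ∈ Ioo (-T y) (T y) :=
      Ioo_subset_Ioo (neg_le_neg (hεS y hy)) (hεS y hy) ht
    refine ((hF2 y t hty).contMDiffAt ((hU y).mem_nhds hxy)).congr_of_eventuallyEq ?_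
    filter_upwards [(hU y).mem_nhds hxy] with x' hx'
    have h := eq_flow_of_isMIntegralCurveOn hξ (γ := fun t => F y t x')
      (a := -T y) (b := T y) ⟨by linarith [hT y], hT y⟩ (hF y x' hx').2 hty
    rw [h, (hF y x' hx').1]
  obtain ⟨n, hn⟩ := exists_nat_gt (|t| / ε)
  have hn0 : (0 : ℝ) < n := lt_of_le_of_lt (by positivity) hn
  have hstep : t / n ∈ Ioo (-ε) ε := by
    rw [mem_Ioo, ← abs_lt, abs_div, Nat.abs_cast, div_lt_iff₀ hn0]
    rwa [div_lt_iff₀ hε, mul_comm] at hn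
  have hiter : ∀ k : ℕ, ContMDiff (𝓡 m) (𝓡 m) 2 (flow ξ (k * (t / n))) := by
    intro k
    induction k with
    | zero =>
      have : flow ξ ((0 : ℕ) * (t / n)) = id := by
        funext x; simp [(flow_spec hξ x).1]
      rw [this]; exact contMDiff_id
    | succ k ih =>
      have : flow ξ ((k + 1 : ℕ) * (t / n)) = flow ξ (t / n) ∘ flow ξ (k * (t / n)) := by
        funext x
        rw [Function.comp_apply, ← flow_add hξ]
        congr 1; push_cast; ring
      rw [this]
      exact (hsmall _ hstep).comp ih
  have := hiter n
  rwa [mul_div_cancel₀ _ hn0.ne'] at this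

end Flow

/-! ### The gap between subspaces -/

section Gap

variable {E F : Type*} [NormedAddCommGroup E] [InnerProductSpace ℝ E]
  [NormedAddCommGroup F] [InnerProductSpace ℝ F]

/-- Every vector of `U` is within `c` times its length of a vector of `V`. This is the form in
which bounds on `gap U V` are used. -/
def IsNear (U V : Submodule ℝ E) (c : ℝ) : Prop :=
  ∀ u ∈ U, ∃ v ∈ V, ‖u - v‖ ≤ c * ‖u‖

variable {U V : Submodule ℝ E} {c : ℝ}

theorem IsNear.gap_le (h : IsNear U V c) (hc : 0 ≤ c) : gap U V ≤ c := by
  refine Real.sSup_le ?_ hc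
  rintro r ⟨u, hu, hu1, rfl⟩
  obtain ⟨v, hv, huv⟩ := h u hu
  rw [hu1, mul_one, ← dist_eq_norm] at huv
  exact (Metric.infDist_le_dist_of_mem hv).trans huv

theorem isNear_of_gap_le [FiniteDimensional ℝ E] (h : gap U V ≤ c) : IsNear U V c := by
  have : ProperSpace E := FiniteDimensional.proper_real E
  intro u hu
  rcases eq_or_ne u 0 with rfl | hu0
  · exact ⟨0, V.zero_mem, by simp⟩
  have hpos : 0 < ‖u‖ := norm_pos_iff.2 hu0
  have hbdd : BddAbove {r : ℝ | ∃ u ∈ U, ‖u‖ = 1 ∧ r = Metric.infDist u (V : Set E)} := by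
    refine ⟨1, ?_⟩
    rintro r ⟨w, -, hw, rfl⟩
    have := Metric.infDist_le_dist_of_mem (x := w) V.zero_mem
    rwa [dist_zero_right, hw] at this
  obtain ⟨v, hv, hdist⟩ := V.closed_of_finiteDimensional.exists_infDist_eq_dist
    ⟨0, V.zero_mem⟩ (‖u‖⁻¹ • u)
  have h1 : dist (‖u‖⁻¹ • u) v ≤ c := by
    rw [← hdist]
    refine (le_csSup hbdd ⟨‖u‖⁻¹ • u, U.smul_mem _ hu, ?_, rfl⟩).trans h
    rw [norm_smul, norm_inv, norm_norm, inv_mul_cancel₀ hpos.ne']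
  refine ⟨‖u‖ • v, V.smul_mem _ hv, ?_⟩
  have h2 : u - ‖u‖ • v = ‖u‖ • (‖u‖⁻¹ • u - v) := by
    rw [smul_sub, smul_smul, mul_inv_cancel₀ hpos.ne', one_smul]
  rw [h2, norm_smul, norm_norm, mul_comm, ← dist_eq_norm]
  gcongr

theorem IsNear.mono {U' : Submodule ℝ E} {c' : ℝ} (h : IsNear U V c) (hU : U' ≤ U) (hc : c ≤ c') :
    IsNear U' V c' := fun u hu =>
  let ⟨v, hv, huv⟩ := h u (hU hu)
  ⟨v, hv, huv.trans (by gcongr)⟩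

theorem isNear_of_le (h : U ≤ V) (hc : 0 ≤ c) : IsNear U V c := fun u hu =>
  ⟨u, h hu, by rw [sub_self, norm_zero]; positivity⟩

/-- The orthogonal projection to `V` is injective on a subspace at gap less than `1` from `V`. -/
theorem IsNear.finrank_le [FiniteDimensional ℝ E] (h : IsNear U V c) (hc : c < 1) :
    Module.finrank ℝ U ≤ Module.finrank ℝ V := by
  let L : U →ₗ[ℝ] V := V.orthogonalProjectionOnto.toLinearMap ∘ₗ U.subtype
  refine LinearMap.finrank_le_finrank_of_injective (f := L) ?_
  rw [← LinearMap.ker_eq_bot, LinearMap.ker_eq_bot']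
  rintro ⟨u, hu⟩ hLu
  have hort : u ∈ Vᗮ := by
    have : V.orthogonalProjectionOnto u = 0 := hLu
    exact Submodule.orthogonalProjectionOnto_eq_zero_iff.1 this
  obtain ⟨v, hv, huv⟩ := h u hu
  have h0 : inner ℝ v u = 0 := (Submodule.mem_orthogonal _ _).1 hort v hv
  have h1 : ‖u - v‖ ^ 2 = ‖u‖ ^ 2 + ‖v‖ ^ 2 := by
    rw [norm_sub_sq_real, real_inner_comm, h0]; ring
  have h2 : ‖u‖ ≤ ‖u - v‖ := by
    refine le_of_sq_le_sq ?_ (norm_nonneg _)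
    rw [h1]; nlinarith [sq_nonneg ‖v‖]
  have h3 : ‖u‖ = 0 := by nlinarith [norm_nonneg u]
  exact Subtype.ext (norm_eq_zero.1 h3)

theorem IsNear.le_norm_starProjection [FiniteDimensional ℝ E] (h : IsNear U V c) (hc : 0 ≤ c)
    {b : ℝ} {n : E} (hn : b * ‖n‖ ≤ ‖U.starProjection n‖) :
    (b - c) * ‖n‖ ≤ ‖V.starProjection n‖ := by
  set u := U.starProjection n with hu
  rcases eq_or_ne u 0 with h0 | h0
  · rw [h0, norm_zero] at hn
    exact le_trans (by nlinarith [norm_nonneg n]) (norm_nonneg _)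
  have hpos : 0 < ‖u‖ := norm_pos_iff.2 h0
  have huU : u ∈ U := Submodule.starProjection_apply_mem U n
  obtain ⟨v, hv, huv⟩ := h u huU
  have h1 : inner ℝ n u = ‖u‖ ^ 2 := by
    have := Submodule.starProjection_inner_eq_zero (K := U) n u huU
    rw [inner_sub_left, ← hu, real_inner_self_eq_norm_sq] at this
    linarith
  -- `V.starProjection u` is at least as close to `u` as `v`
  have h2 : ‖u - V.starProjection u‖ ≤ c * ‖u‖ := by
    refine le_trans ?_ huv
    rw [Submodule.starProjection_minimal]
    exact ciInf_le ⟨0, by rintro _ ⟨w, rfl⟩; exact norm_nonneg _⟩ (⟨v, hv⟩ : V)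
  have h3 : inner ℝ (V.starProjection n) u =
      ‖u‖ ^ 2 - inner ℝ n (u - V.starProjection u) := by
    rw [Submodule.inner_starProjection_left_eq_right, inner_sub_right, h1]; ring
  have h4 : inner ℝ n (u - V.starProjection u) ≤ ‖n‖ * (c * ‖u‖) :=
    (real_inner_le_norm _ _).trans (by gcongr)
  have h5 : inner ℝ (V.starProjection n) u ≤ ‖V.starProjection n‖ * ‖u‖ := real_inner_le_norm _ _
  have h6 : (‖u‖ - c * ‖n‖) * ‖u‖ ≤ ‖V.starProjection n‖ * ‖u‖ := by nlinarith
  have h7 := le_of_mul_le_mul_right h6 hpos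
  linarith

/-- Let `π` be an orthogonal projection. If no vector of its range is nearly orthogonal to `V`,
then `π` maps `V` onto its range, with a bound on preimages. -/
theorem exists_mem_map_eq [FiniteDimensional ℝ E] {π : E →L[ℝ] E}
    (hsymm : ∀ x y, inner ℝ (π x) y = inner ℝ x (π y)) (hidem : ∀ x, π (π x) = π x) (hc : 0 < c)
    (hV : ∀ n, π n = n → c * ‖n‖ ≤ ‖V.starProjection n‖) {u : E} (hu : π u = u) :
    ∃ v ∈ V, π v = u ∧ ‖v‖ ≤ c⁻¹ * ‖u‖ := by
  have hform : ∀ n, π n = n → inner ℝ (π (V.starProjection n)) n = ‖V.starProjection n‖ ^ 2 := by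
    intro n hn
    rw [hsymm, hn, ← real_inner_self_eq_norm_sq, Submodule.inner_starProjection_left_eq_right,
      Submodule.inner_starProjection_left_eq_right,
      Submodule.starProjection_eq_self_iff.2 (Submodule.starProjection_apply_mem V n)]
  let B : π.range →ₗ[ℝ] π.range :=
    (π.toLinearMap.rangeRestrict ∘ₗ V.starProjection.toLinearMap) ∘ₗ π.range.subtype
  have hrange : ∀ n : π.range, π n = n := by
    rintro ⟨_, n, rfl⟩
    exact hidem n
  have hinj : Function.Injective B := by
    rw [← LinearMap.ker_eq_bot, LinearMap.ker_eq_bot']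
    intro n hn
    have h0 : π (V.starProjection n) = 0 := congrArg Subtype.val hn
    have h1 := hform n (hrange n)
    rw [h0, inner_zero_left] at h1
    have h2 := hV n (hrange n)
    have h3 : ‖V.starProjection (n : E)‖ = 0 := by
      rcases pow_eq_zero_iff (two_ne_zero) |>.1 h1.symm with h
      exact h
    have h4 : ‖(n : E)‖ = 0 := by nlinarith [norm_nonneg (n : E)]
    exact Subtype.ext (norm_eq_zero.1 h4)
  obtain ⟨n, hn⟩ := LinearMap.injective_iff_surjective.1 hinj ⟨u, u, hu⟩
  have hn' : π (V.starProjection n) = u := congrArg Subtype.val hn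
  refine ⟨V.starProjection n, Submodule.starProjection_apply_mem V _, hn', ?_⟩
  have h1 := hform n (hrange n)
  rw [hn'] at h1
  have h2 : inner ℝ u (n : E) ≤ ‖u‖ * ‖(n : E)‖ := real_inner_le_norm _ _
  have h3 := hV n (hrange n)
  rw [inv_mul_eq_div, le_div_iff₀ hc]
  rcases (norm_nonneg (V.starProjection (n : E))).eq_or_lt with h4 | h4
  · rw [← h4]; simp
  · have h5 : ‖V.starProjection (n : E)‖ * c * ‖V.starProjection (n : E)‖ ≤
        ‖u‖ * ‖V.starProjection (n : E)‖ := by nlinarith [norm_nonneg u]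
    exact le_of_mul_le_mul_right h5 h4

/-- A `C²` immersion distorts distances and gaps between subspaces by bounded factors, up to an
error of the size of the distance between the base points. -/
theorem exists_isNear_map_fderiv [FiniteDimensional ℝ E] {g : E → F} {w : E}
    (hg : ContDiffAt ℝ 2 g w) (hinj : Function.Injective (fderiv ℝ g w)) :
    ∃ C > 0, ∀ᶠ p in 𝓝 (w, w), ‖p.1 - p.2‖ ≤ C * ‖g p.1 - g p.2‖ ∧
      ∀ (U V : Submodule ℝ E) (c : ℝ), 0 ≤ c → IsNear U V c →
        IsNear (U.map (fderiv ℝ g p.1).toLinearMap) (V.map (fderiv ℝ g p.2).toLinearMap)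
          (C * (c + ‖p.1 - p.2‖)) := by
  obtain ⟨κ, hκ, hlow⟩ : ∃ κ : ℝ, 0 < κ ∧ ∀ u, ‖u‖ ≤ κ * ‖fderiv ℝ g w u‖ := by
    obtain ⟨κ, hκ, hanti⟩ := LinearMap.exists_antilipschitzWith (fderiv ℝ g w).toLinearMap
      (LinearMap.ker_eq_bot.2 hinj)
    exact ⟨κ, hκ, fun u => by simpa using hanti.le_mul_dist u 0⟩
  have hg1 : ContDiffAt ℝ 1 (fderiv ℝ g) w := hg.fderiv_right (by norm_num)
  obtain ⟨L, s, hs, hL⟩ := hg1.exists_lipschitzOnWith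
  have hclose : ∀ᶠ x in 𝓝 w, ‖fderiv ℝ g x - fderiv ℝ g w‖ ≤ (2 * κ)⁻¹ := by
    have := hg1.continuousAt.eventually (Metric.closedBall_mem_nhds _
      (show (0 : ℝ) < (2 * κ)⁻¹ by positivity))
    filter_upwards [this] with x hx
    rwa [dist_eq_norm] at hx
  have hstrict : ∀ᶠ p in 𝓝 (w, w),
      ‖g p.1 - g p.2 - fderiv ℝ g w (p.1 - p.2)‖ ≤ (2 * κ)⁻¹ * ‖p.1 - p.2‖ :=
    (hg.hasStrictFDerivAt (by simp)).isLittleO.def (by positivity)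
  set G := ‖fderiv ℝ g w‖ + (2 * κ)⁻¹
  have hG : 0 ≤ G := by positivity
  have hlow' : ∀ x, ‖fderiv ℝ g x - fderiv ℝ g w‖ ≤ (2 * κ)⁻¹ → ∀ u,
      ‖u‖ ≤ 2 * κ * ‖fderiv ℝ g x u‖ := fun x hx u => by
    have h1 : ‖fderiv ℝ g w u‖ ≤ ‖fderiv ℝ g x u‖ + (2 * κ)⁻¹ * ‖u‖ := by
      have h2 : ‖(fderiv ℝ g x - fderiv ℝ g w) u‖ ≤ (2 * κ)⁻¹ * ‖u‖ :=
        (ContinuousLinearMap.le_opNorm _ _).trans (by gcongr)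
      rw [sub_apply] at h2
      have h3 := norm_sub_norm_le (fderiv ℝ g w u) (fderiv ℝ g x u)
      rw [norm_sub_rev] at h3
      linarith
    have h3 := hlow u
    have h4 : κ * ‖fderiv ℝ g w u‖ ≤
        κ * ‖fderiv ℝ g x u‖ + κ * (2 * κ)⁻¹ * ‖u‖ := by nlinarith
    have h5 : κ * (2 * κ)⁻¹ = 1 / 2 := by field_simp
    rw [h5] at h4
    linarith
  refine ⟨2 * κ * (G + L + 1), by positivity, ?_⟩
  filter_upwards [hstrict, prod_mem_nhds hs hs, prod_mem_nhds hclose hclose] with p hp hps hpc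
  have hbig : 2 * κ ≤ 2 * κ * (G + L + 1) := by
    have : (0 : ℝ) ≤ L := L.2
    have : 0 ≤ κ * (G + L) := by positivity
    nlinarith
  refine ⟨?_, fun U V c hc hUV => ?_⟩
  · have h1 := hlow (p.1 - p.2)
    have h2 := norm_sub_norm_le (fderiv ℝ g w (p.1 - p.2)) (g p.1 - g p.2)
    rw [norm_sub_rev (fderiv ℝ g w (p.1 - p.2))] at h2
    have h4 : κ * ‖fderiv ℝ g w (p.1 - p.2)‖ ≤
        κ * ‖g p.1 - g p.2‖ + κ * (2 * κ)⁻¹ * ‖p.1 - p.2‖ := by nlinarith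
    have h5 : κ * (2 * κ)⁻¹ = 1 / 2 := by field_simp
    rw [h5] at h4
    have h6 : ‖p.1 - p.2‖ ≤ 2 * κ * ‖g p.1 - g p.2‖ := by linarith
    exact h6.trans (by gcongr)
  · rintro _ ⟨u, hu, rfl⟩
    obtain ⟨v, hv, huv⟩ := hUV u hu
    refine ⟨_, ⟨v, hv, rfl⟩, ?_⟩
    change ‖fderiv ℝ g p.1 u - fderiv ℝ g p.2 v‖ ≤ _ * ‖fderiv ℝ g p.1 u‖
    have h1 : ‖fderiv ℝ g p.1 - fderiv ℝ g p.2‖ ≤ L * ‖p.1 - p.2‖ := by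
      have := hL.dist_le_mul _ hps.1 _ hps.2
      rwa [dist_eq_norm, dist_eq_norm] at this
    have h2 : ‖fderiv ℝ g p.2‖ ≤ G := by
      have := norm_le_norm_sub_add (fderiv ℝ g p.2) (fderiv ℝ g w)
      have hp2 : ‖fderiv ℝ g p.2 - fderiv ℝ g w‖ ≤ (2 * κ)⁻¹ := hpc.2
      change _ ≤ ‖fderiv ℝ g w‖ + (2 * κ)⁻¹
      linarith
    have h3 : fderiv ℝ g p.1 u - fderiv ℝ g p.2 v =
        (fderiv ℝ g p.1 - fderiv ℝ g p.2) u + fderiv ℝ g p.2 (u - v) := by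
      rw [sub_apply, map_sub]; abel
    have h4 := hlow' p.1 hpc.1 u
    have h5 : ‖fderiv ℝ g p.1 u - fderiv ℝ g p.2 v‖ ≤ (L * ‖p.1 - p.2‖ + G * c) * ‖u‖ := by
      rw [h3]
      refine (norm_add_le _ _).trans ?_
      have h6 := ((fderiv ℝ g p.1 - fderiv ℝ g p.2).le_opNorm u).trans
        (mul_le_mul_of_nonneg_right h1 (norm_nonneg u))
      have h7 := ((fderiv ℝ g p.2).le_opNorm (u - v)).trans
        (mul_le_mul h2 huv (norm_nonneg _) hG)
      nlinarith
    have hLnn : (0 : ℝ) ≤ L := L.2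
    have h6 : L * ‖p.1 - p.2‖ + G * c ≤ (G + L + 1) * (c + ‖p.1 - p.2‖) := by
      nlinarith [norm_nonneg (p.1 - p.2), mul_nonneg hG (norm_nonneg (p.1 - p.2)),
        mul_nonneg hLnn hc]
    calc _ ≤ (L * ‖p.1 - p.2‖ + G * c) * ‖u‖ := h5
      _ ≤ ((G + L + 1) * (c + ‖p.1 - p.2‖)) * (2 * κ * ‖fderiv ℝ g p.1 u‖) := by gcongr
      _ = _ := by ring

end Gap

/-! ### Tangent spaces read in a Euclidean space -/

section ImageTangent

variable {m N : ℕ} {M : Type*} [TopologicalSpace M] [ChartedSpace (EuclideanSpace ℝ (Fin m)) M]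

/-- The image of the tangent space of `S` at `x` under the differential of `φ`. -/
noncomputable def imageTangent (m : ℕ) {M : Type*} [TopologicalSpace M]
    [ChartedSpace (EuclideanSpace ℝ (Fin m)) M] {N : ℕ} (φ : M → EuclideanSpace ℝ (Fin N))
    (S : Set M) (x : M) : Submodule ℝ (EuclideanSpace ℝ (Fin N)) :=
  (tangentAt m S x).map (mfderiv (𝓡 m) 𝓘(ℝ, EuclideanSpace ℝ (Fin N)) φ x).toLinearMap

variable {φ : M → EuclideanSpace ℝ (Fin N)} {S : Set M} {x : M}

theorem hasDerivAt_comp_curve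
    (hφ : MDifferentiableAt (𝓡 m) 𝓘(ℝ, EuclideanSpace ℝ (Fin N)) φ x) {γ : ℝ → M} (hγ0 : γ 0 = x)
    (hγ : MDifferentiableAt 𝓘(ℝ, ℝ) (𝓡 m) γ 0) :
    HasDerivAt (fun t => φ (γ t)) (mfderiv (𝓡 m) 𝓘(ℝ, EuclideanSpace ℝ (Fin N)) φ x
      (mfderiv 𝓘(ℝ, ℝ) (𝓡 m) γ 0 (1 : ℝ) : EuclideanSpace ℝ (Fin m))) 0 := by
  subst hγ0
  have h := HasMFDerivAt.comp (0 : ℝ) hφ.hasMFDerivAt hγ.hasMFDerivAt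
  have h' : HasFDerivAt (φ ∘ γ) (show ℝ →L[ℝ] EuclideanSpace ℝ (Fin N) from
      (mfderiv (𝓡 m) 𝓘(ℝ, EuclideanSpace ℝ (Fin N)) φ (γ 0)).comp
        (mfderiv 𝓘(ℝ, ℝ) (𝓡 m) γ 0)) 0 := hasMFDerivAt_iff_hasFDerivAt.1 h
  exact h'.hasDerivAt

theorem imageTangent_le {V : Submodule ℝ (EuclideanSpace ℝ (Fin N))}
    (hφ : MDifferentiableAt (𝓡 m) 𝓘(ℝ, EuclideanSpace ℝ (Fin N)) φ x)
    (h : ∀ (γ : ℝ → M) (w : EuclideanSpace ℝ (Fin N)), γ 0 = x → (∀ t, γ t ∈ S) →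
      ContinuousAt γ 0 → HasDerivAt (fun t => φ (γ t)) w 0 → w ∈ V) :
    imageTangent m φ S x ≤ V := by
  unfold imageTangent tangentAt
  refine (Submodule.map_span_le _ _ _).2 ?_
  rintro _ ⟨γ, hγ0, hγS, hγ, rfl⟩
  exact h γ _ hγ0 hγS hγ.continuousAt (hasDerivAt_comp_curve hφ hγ0 hγ)

theorem mem_imageTangent (hφ : MDifferentiableAt (𝓡 m) 𝓘(ℝ, EuclideanSpace ℝ (Fin N)) φ x)
    {γ : ℝ → M} (hγ0 : γ 0 = x) (hγS : ∀ t, γ t ∈ S)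
    (hγ : MDifferentiableAt 𝓘(ℝ, ℝ) (𝓡 m) γ 0) {w : EuclideanSpace ℝ (Fin N)}
    (hw : HasDerivAt (fun t => φ (γ t)) w 0) : w ∈ imageTangent m φ S x := by
  rw [← (hasDerivAt_comp_curve hφ hγ0 hγ).unique hw]
  exact Submodule.mem_map_of_mem (Submodule.subset_span ⟨γ, hγ0, hγS, hγ, rfl⟩)

/-- If a linear function of `φ` vanishes on `S` near `x`, then it vanishes on the tangent space. -/
theorem imageTangent_le_ker {F : Type*} [NormedAddCommGroup F] [NormedSpace ℝ F]
    {L : EuclideanSpace ℝ (Fin N) →L[ℝ] F}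
    (hφ : MDifferentiableAt (𝓡 m) 𝓘(ℝ, EuclideanSpace ℝ (Fin N)) φ x)
    (h : ∀ᶠ y in 𝓝 x, y ∈ S → L (φ y) = 0) {w : EuclideanSpace ℝ (Fin N)}
    (hw : w ∈ imageTangent m φ S x) : L w = 0 := by
  have hle : imageTangent m φ S x ≤ LinearMap.ker L.toLinearMap := by
    refine imageTangent_le hφ fun γ w hγ0 hγS hγ hw => ?_
    have h1 : HasDerivAt (fun t => L (φ (γ t))) (L w) 0 := L.hasFDerivAt.comp_hasDerivAt 0 hw
    have h2 : (fun t => L (φ (γ t))) =ᶠ[𝓝 0] fun _ => 0 := by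
      rw [ContinuousAt, hγ0] at hγ
      filter_upwards [hγ.eventually h] with t ht using ht (hγS t)
    exact h1.unique ((hasDerivAt_const 0 (0 : F)).congr_of_eventuallyEq h2)
  exact hle hw

theorem imageTangent_comp {k : ℕ} {ψ : M → EuclideanSpace ℝ (Fin k)}
    {g : EuclideanSpace ℝ (Fin k) → EuclideanSpace ℝ (Fin N)}
    (hψ : MDifferentiableAt (𝓡 m) 𝓘(ℝ, EuclideanSpace ℝ (Fin k)) ψ x)
    (hg : DifferentiableAt ℝ g (ψ x)) (h : φ =ᶠ[𝓝 x] fun y => g (ψ y)) :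
    imageTangent m φ S x =
      (imageTangent m ψ S x).map (fderiv ℝ g (ψ x)).toLinearMap := by
  have h1 : HasMFDerivAt (𝓡 m) 𝓘(ℝ, EuclideanSpace ℝ (Fin N)) φ x
      ((fderiv ℝ g (ψ x)).comp (mfderiv (𝓡 m) 𝓘(ℝ, EuclideanSpace ℝ (Fin k)) ψ x)) :=
    (HasMFDerivAt.comp x hg.hasFDerivAt.hasMFDerivAt hψ.hasMFDerivAt).congr_of_eventuallyEq h
  unfold imageTangent
  rw [h1.mfderiv]
  exact Submodule.map_comp _ _ _

theorem imageTangent_comp_continuousLinearMap {k : ℕ} {ψ : M → EuclideanSpace ℝ (Fin k)}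
    {L : EuclideanSpace ℝ (Fin k) →L[ℝ] EuclideanSpace ℝ (Fin N)}
    (hψ : MDifferentiableAt (𝓡 m) 𝓘(ℝ, EuclideanSpace ℝ (Fin k)) ψ x)
    (h : φ =ᶠ[𝓝 x] fun y => L (ψ y)) :
    imageTangent m φ S x = (imageTangent m ψ S x).map L.toLinearMap := by
  rw [imageTangent_comp hψ L.differentiableAt h, L.fderiv]

theorem map_tangentAt_le {F : M → M} (hF : MDifferentiableAt (𝓡 m) (𝓡 m) F x) {S' : Set M}
    (hS : ∀ y ∈ S, F y ∈ S') :
    (tangentAt m S x).map (mfderiv (𝓡 m) (𝓡 m) F x).toLinearMap ≤ tangentAt m S' (F x) := by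
  refine (Submodule.map_span_le _ _ _).2 ?_
  rintro _ ⟨γ, hγ0, hγS, hγ, rfl⟩
  subst hγ0
  have h := HasMFDerivAt.comp (0 : ℝ) hF.hasMFDerivAt hγ.hasMFDerivAt
  refine Submodule.subset_span ⟨F ∘ γ, rfl, fun t => hS _ (hγS t), h.mdifferentiableAt, ?_⟩
  rw [h.mfderiv]
  rfl

theorem imageTangent_comp_le {F : M → M} (hF : MDifferentiableAt (𝓡 m) (𝓡 m) F x) {S' : Set M}
    (hS : ∀ y ∈ S, F y ∈ S')
    (hφ : MDifferentiableAt (𝓡 m) 𝓘(ℝ, EuclideanSpace ℝ (Fin N)) φ (F x)) :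
    imageTangent m (fun y => φ (F y)) S x ≤ imageTangent m φ S' (F x) := by
  have h1 := HasMFDerivAt.comp x hφ.hasMFDerivAt hF.hasMFDerivAt
  have h2 : mfderiv (𝓡 m) 𝓘(ℝ, EuclideanSpace ℝ (Fin N)) (fun y => φ (F y)) x =
    (mfderiv (𝓡 m) 𝓘(ℝ, EuclideanSpace ℝ (Fin N)) φ (F x)).comp (mfderiv (𝓡 m) (𝓡 m) F x) :=
    h1.mfderiv
  unfold imageTangent
  rw [h2]
  refine (Submodule.map_comp _ _ _).le.trans ?_
  exact Submodule.map_mono (map_tangentAt_le hF hS)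

section Flow

variable [IsManifold (𝓡 m) ω M] [CompactSpace M] [T2Space M] {ξ : (x : M) → TangentSpace (𝓡 m) x}

theorem mdifferentiable_flow
    (hξ : ContMDiff (𝓡 m) (𝓡 m).tangent 2 (fun x => (⟨x, ξ x⟩ : TangentBundle (𝓡 m) M)))
    (t : ℝ) (x : M) : MDifferentiableAt (𝓡 m) (𝓡 m) (flow ξ t) x :=
  (contMDiff_flow hξ t x).mdifferentiableAt (by simp)

/-- The flow carries the tangent spaces of an invariant set to each other. -/
theorem imageTangent_comp_flow
    (hξ : ContMDiff (𝓡 m) (𝓡 m).tangent 2 (fun x => (⟨x, ξ x⟩ : TangentBundle (𝓡 m) M)))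
    (hS : ∀ t, ∀ y ∈ S, flow ξ t y ∈ S) (t : ℝ)
    (hφ : MDifferentiableAt (𝓡 m) 𝓘(ℝ, EuclideanSpace ℝ (Fin N)) φ (flow ξ t x)) :
    imageTangent m (fun y => φ (flow ξ t y)) S x = imageTangent m φ S (flow ξ t x) := by
  refine le_antisymm (imageTangent_comp_le (mdifferentiable_flow hξ t x) (hS t) hφ) ?_
  have h : φ = fun y => (fun y => φ (flow ξ t y)) (flow ξ (-t) y) := by
    funext y
    simp only [flow_flow_neg hξ]
  have hx := flow_neg_flow hξ t x
  have hφ' : MDifferentiableAt (𝓡 m) 𝓘(ℝ, EuclideanSpace ℝ (Fin N)) (fun y => φ (flow ξ t y))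
      (flow ξ (-t) (flow ξ t x)) := by
    rw [hx]
    exact MDifferentiableAt.comp x hφ (mdifferentiable_flow hξ t x)
  have := imageTangent_comp_le (S := S) (mdifferentiable_flow hξ (-t) (flow ξ t x)) (hS (-t)) hφ'
  rw [hx] at this
  rwa [← h] at this

end Flow

/-- A gap estimate in one `C²` chart gives a gap estimate, with exponent at most `1`, for all `C²`
immersions. -/
theorem GapEstimateAt.gapHolderAt {S T : Set M} {z : M} {ν : ℝ} (hν : 0 < ν)
    {ψ : OpenPartialHomeomorph M (EuclideanSpace ℝ (Fin m))} (hz : z ∈ ψ.source)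
    (hψ : ContMDiffOn (𝓡 m) 𝓘(ℝ, EuclideanSpace ℝ (Fin m)) 2 ψ ψ.source)
    (hψ' : ContMDiffOn 𝓘(ℝ, EuclideanSpace ℝ (Fin m)) (𝓡 m) 2 ψ.symm ψ.target)
    (h : GapEstimateAt m ψ S T z ν) : GapHolderAt m S T z (min ν 1) := by
  intro N φ hφ hinj
  obtain ⟨U, hU, hzU, C, hC, hest⟩ := h
  have hψd : ∀ x ∈ ψ.source,
      MDifferentiableAt (𝓡 m) 𝓘(ℝ, EuclideanSpace ℝ (Fin m)) ψ x := fun x hx =>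
    (hψ.contMDiffAt (ψ.open_source.mem_nhds hx)).mdifferentiableAt (by simp)
  set g := fun u => φ (ψ.symm u) with hgdef
  have hzt : ψ z ∈ ψ.target := ψ.map_source hz
  have hg : ContDiffAt ℝ 2 g (ψ z) := by
    rw [← contMDiffAt_iff_contDiffAt]
    refine ContMDiffAt.comp (ψ z) ?_ (hψ'.contMDiffAt (ψ.open_target.mem_nhds hzt))
    rwa [ψ.left_inv hz]
  have hφg : ∀ x ∈ ψ.source, φ =ᶠ[𝓝 x] fun y => g (ψ y) := fun x hx => by
    filter_upwards [ψ.open_source.mem_nhds hx] with y hy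
    rw [hgdef]
    simp only [ψ.left_inv hy]
  have hginj : Function.Injective (fderiv ℝ g (ψ z)) := by
    have hsymm : MDifferentiableAt 𝓘(ℝ, EuclideanSpace ℝ (Fin m)) (𝓡 m) ψ.symm (ψ z) :=
      (hψ'.contMDiffAt (ψ.open_target.mem_nhds hzt)).mdifferentiableAt (by simp)
    have hφd : MDifferentiableAt (𝓡 m) 𝓘(ℝ, EuclideanSpace ℝ (Fin N)) φ (ψ.symm (ψ z)) := by
      rw [ψ.left_inv hz]
      exact hφ.mdifferentiableAt (by simp)
    have h1 := HasMFDerivAt.comp (ψ z) hφd.hasMFDerivAt hsymm.hasMFDerivAt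
    have h2 : HasFDerivAt g (show EuclideanSpace ℝ (Fin m) →L[ℝ] EuclideanSpace ℝ (Fin N) from
        (mfderiv (𝓡 m) 𝓘(ℝ, EuclideanSpace ℝ (Fin N)) φ (ψ.symm (ψ z))).comp
          (mfderiv 𝓘(ℝ, EuclideanSpace ℝ (Fin m)) (𝓡 m) ψ.symm (ψ z))) (ψ z) :=
      hasMFDerivAt_iff_hasFDerivAt.1 h1
    have h3 : Function.Injective (mfderiv 𝓘(ℝ, EuclideanSpace ℝ (Fin m)) (𝓡 m) ψ.symm (ψ z)) := by
      have h4 := HasMFDerivAt.comp (ψ z) (by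
        rw [ψ.left_inv hz]; exact (hψd z hz).hasMFDerivAt) hsymm.hasMFDerivAt
      have h5 : HasMFDerivAt 𝓘(ℝ, EuclideanSpace ℝ (Fin m)) 𝓘(ℝ, EuclideanSpace ℝ (Fin m))
          (ψ ∘ ψ.symm) (ψ z) (ContinuousLinearMap.id ℝ _) := by
        refine (hasMFDerivAt_id (ψ z)).congr_of_eventuallyEq ?_
        filter_upwards [ψ.open_target.mem_nhds hzt] with u hu using ψ.right_inv hu
      have h6 := hasMFDerivAt_unique h4 h5
      intro a b hab
      have h7 := DFunLike.congr_fun h6 a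
      have h8 := DFunLike.congr_fun h6 b
      refine (h7.symm.trans ?_).trans h8
      exact congrArg (mfderiv (𝓡 m) 𝓘(ℝ, EuclideanSpace ℝ (Fin m)) ψ z) hab
    rw [← ψ.left_inv hz] at hinj
    rw [h2.fderiv]
    exact hinj.comp h3
  obtain ⟨C', hC', hev⟩ := exists_isNear_map_fderiv hg hginj
  have hcont : ContinuousAt ψ z := (hψd z hz).continuousAt
  have hgd : ∀ᶠ u in 𝓝 (ψ z), DifferentiableAt ℝ g u :=
    (hg.eventually (by simp)).mono fun u hu => hu.differentiableAt (by simp)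
  have hsmall : ∀ᶠ p in 𝓝 (ψ z, ψ z), ‖p.1 - p.2‖ ≤ 1 := by
    filter_upwards [prod_mem_nhds (Metric.ball_mem_nhds (ψ z) (show (0 : ℝ) < 1 / 2 by norm_num))
      (Metric.ball_mem_nhds (ψ z) (show (0 : ℝ) < 1 / 2 by norm_num))] with p hp
    have h1 := Metric.mem_ball.1 hp.1
    have h2 := Metric.mem_ball'.1 hp.2
    have h3 := dist_triangle p.1 (ψ z) p.2
    rw [dist_eq_norm p.1 p.2] at h3
    linarith
  have hev2 := hev.and hsmall
  rw [nhds_prod_eq, eventually_prod_self_iff'] at hev2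
  obtain ⟨P, hP, hP'⟩ := hev2
  obtain ⟨O, hO, hOo, hzO⟩ := eventually_nhds_iff.1
    ((hcont.eventually_mem hP).and ((hcont.eventually hgd).and (ψ.open_source.mem_nhds hz)))
  refine ⟨U ∩ O, hU.inter hOo, ⟨hzU, hzO⟩, C' * (C + 1) * C' ^ min ν 1, by positivity, ?_⟩
  rintro x ⟨⟨hxU, hxO⟩, hxS⟩ y ⟨⟨hyU, hyO⟩, hyT⟩
  obtain ⟨hPx, hgx, hxs⟩ := hO x hxO
  obtain ⟨hPy, hgy, hys⟩ := hO y hyO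
  obtain ⟨⟨hdist, hnear⟩, hle1⟩ := hP' _ hPx _ hPy
  have hα : 0 < min ν 1 := lt_min hν one_pos
  set d := ‖ψ x - ψ y‖ with hd
  have hd0 : 0 ≤ d := norm_nonneg _
  have h1 : IsNear (imageTangent m ψ S x) (imageTangent m ψ T y) (C * d ^ ν) := by
    have := hest x ⟨hxU, hxS⟩ y ⟨hyU, hyT⟩
    rw [dist_eq_norm] at this
    exact isNear_of_gap_le this
  have h2 := (hnear _ _ _ (by positivity) h1)
  have hx' := imageTangent_comp (S := S) (hψd x hxs) hgx (hφg x hxs)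
  have hy' := imageTangent_comp (S := T) (hψd y hys) hgy (hφg y hys)
  change gap (imageTangent m φ S x) (imageTangent m φ T y) ≤ _
  rw [hx', hy']
  refine (h2.gap_le (by positivity)).trans ?_
  have hφx : g (ψ x) = φ x := (hφg x hxs).eq_of_nhds.symm
  have hφy : g (ψ y) = φ y := (hφg y hys).eq_of_nhds.symm
  have h3 : d ≤ C' * dist (φ x) (φ y) := by
    rw [dist_eq_norm, ← hφx, ← hφy]
    exact hdist
  have h4 : d ^ ν ≤ d ^ min ν 1 := by
    rcases hd0.eq_or_lt with h | h
    · rw [← h, Real.zero_rpow hν.ne', Real.zero_rpow hα.ne']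
    · exact Real.rpow_le_rpow_of_exponent_ge h hle1 (min_le_left _ _)
  have h5 : d ≤ d ^ min ν 1 := by
    rcases hd0.eq_or_lt with h | h
    · rw [← h, Real.zero_rpow hα.ne']
    · calc d = d ^ (1 : ℝ) := (Real.rpow_one d).symm
        _ ≤ _ := Real.rpow_le_rpow_of_exponent_ge h hle1 (min_le_right _ _)
  have h6 : d ^ min ν 1 ≤ C' ^ min ν 1 * dist (φ x) (φ y) ^ min ν 1 := by
    rw [← Real.mul_rpow hC'.le dist_nonneg]
    exact Real.rpow_le_rpow hd0 h3 hα.le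
  calc C' * (C * d ^ ν + d) ≤ C' * (C * d ^ min ν 1 + d ^ min ν 1) := by gcongr
    _ = C' * (C + 1) * d ^ min ν 1 := by ring
    _ ≤ C' * (C + 1) * (C' ^ min ν 1 * dist (φ x) (φ y) ^ min ν 1) := by gcongr
    _ = _ := by ring

end ImageTangent

/-! ### Diagonal linear flows -/

section Diagonal

variable {m : ℕ}

/-- The diagonal linear map with entries `c`. -/
noncomputable def diag (c : Fin m → ℝ) :
    EuclideanSpace ℝ (Fin m) →L[ℝ] EuclideanSpace ℝ (Fin m) :=
  LinearMap.toContinuousLinearMap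
    { toFun := fun u => WithLp.toLp 2 fun i => c i * u i
      map_add' := fun u v => by ext i; simp [mul_add]
      map_smul' := fun r u => by ext i; simp [mul_left_comm] }

@[simp]
theorem diag_apply (c : Fin m → ℝ) (u : EuclideanSpace ℝ (Fin m)) (i : Fin m) :
    diag c u i = c i * u i := rfl

theorem diag_comm (c d : Fin m → ℝ) (u : EuclideanSpace ℝ (Fin m)) :
    diag c (diag d u) = diag d (diag c u) := by
  ext i; simp [mul_left_comm]

theorem inner_diag (c : Fin m → ℝ) (u v : EuclideanSpace ℝ (Fin m)) :
    inner ℝ (diag c u) v = inner ℝ u (diag c v) := by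
  simp only [PiLp.inner_apply, diag_apply]
  refine Finset.sum_congr rfl fun i _ => ?_
  simp [mul_assoc, mul_comm, mul_left_comm]

theorem norm_diag_le {c : Fin m → ℝ} {u : EuclideanSpace ℝ (Fin m)} {K : ℝ} (hK : 0 ≤ K)
    (h : ∀ i, u i ≠ 0 → |c i| ≤ K) : ‖diag c u‖ ≤ K * ‖u‖ := by
  refine le_of_sq_le_sq ?_ (by positivity)
  rw [mul_pow, EuclideanSpace.real_norm_sq_eq, EuclideanSpace.real_norm_sq_eq, Finset.mul_sum]
  refine Finset.sum_le_sum fun i _ => ?_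
  rw [diag_apply, mul_pow]
  rcases eq_or_ne (u i) 0 with h0 | h0
  · simp [h0]
  · have := sq_le_sq' (by linarith [neg_abs_le (c i), h i h0]) ((le_abs_self (c i)).trans (h i h0))
    gcongr

theorem le_norm_diag {c : Fin m → ℝ} {u : EuclideanSpace ℝ (Fin m)} {K : ℝ} (hK : 0 ≤ K)
    (h : ∀ i, u i ≠ 0 → K ≤ |c i|) : K * ‖u‖ ≤ ‖diag c u‖ := by
  refine le_of_sq_le_sq ?_ (norm_nonneg _)
  rw [mul_pow, EuclideanSpace.real_norm_sq_eq, EuclideanSpace.real_norm_sq_eq, Finset.mul_sum]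
  refine Finset.sum_le_sum fun i _ => ?_
  rw [diag_apply, mul_pow]
  rcases eq_or_ne (u i) 0 with h0 | h0
  · simp [h0]
  · have : K ^ 2 ≤ c i ^ 2 := by
      rw [← sq_abs (c i)]
      exact pow_le_pow_left₀ hK (h i h0) 2
    gcongr

/-- The flow `e^{tA}` of the diagonal linear vector field with eigenvalues `a`. -/
noncomputable def expFlow (a : Fin m → ℝ) (t : ℝ) :
    EuclideanSpace ℝ (Fin m) →L[ℝ] EuclideanSpace ℝ (Fin m) :=
  diag fun i => Real.exp (a i * t)

/-- The projection to the coordinates along which the flow with eigenvalues `σ a` expands. For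
`σ = 1` this is the projection to the unstable subspace of `a`, for `σ = -1` to the stable one. -/
noncomputable def expProj (a : Fin m → ℝ) (σ : ℝ) :
    EuclideanSpace ℝ (Fin m) →L[ℝ] EuclideanSpace ℝ (Fin m) :=
  diag fun i => if 0 < σ * a i then 1 else 0

variable {a : Fin m → ℝ} {σ : ℝ} {u : EuclideanSpace ℝ (Fin m)}

@[simp]
theorem expFlow_apply (t : ℝ) (i : Fin m) : expFlow a t u i = Real.exp (a i * t) * u i := rfl

@[simp]
theorem expProj_apply (i : Fin m) :
    expProj a σ u i = (if 0 < σ * a i then 1 else 0) * u i := rfl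

@[simp]
theorem expFlow_zero : expFlow a 0 u = u := by
  ext i; simp

theorem expFlow_add (s t : ℝ) : expFlow a (s + t) u = expFlow a s (expFlow a t u) := by
  ext i
  simp only [expFlow_apply, mul_add, Real.exp_add, mul_assoc]

theorem expFlow_neg_expFlow (t : ℝ) : expFlow a (-t) (expFlow a t u) = u := by
  rw [← expFlow_add, neg_add_cancel, expFlow_zero]

theorem expProj_expFlow (t : ℝ) :
    expProj a σ (expFlow a t u) = expFlow a t (expProj a σ u) := diag_comm _ _ _

theorem expProj_expProj : expProj a σ (expProj a σ u) = expProj a σ u := by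
  ext i
  simp only [expProj_apply]
  split_ifs <;> simp

theorem expProj_neg_expProj : expProj a (-σ) (expProj a σ u) = 0 := by
  ext i
  simp only [expProj_apply]
  split_ifs <;> simp
  linarith

theorem inner_expProj (u v : EuclideanSpace ℝ (Fin m)) :
    inner ℝ (expProj a σ u) v = inner ℝ u (expProj a σ v) := inner_diag _ _ _

theorem expProj_add_expProj_neg (ha : ∀ i, a i ≠ 0) (hσ : σ ≠ 0) :
    expProj a σ u + expProj a (-σ) u = u := by
  ext i
  have h : σ * a i ≠ 0 := mul_ne_zero hσ (ha i)
  rcases h.lt_or_gt with h | h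
  · simp [h.not_gt, h]
  · simp [h.not_gt, h]

theorem norm_sq_eq_expProj (ha : ∀ i, a i ≠ 0) (hσ : σ ≠ 0) :
    ‖u‖ ^ 2 = ‖expProj a σ u‖ ^ 2 + ‖expProj a (-σ) u‖ ^ 2 := by
  have h : inner ℝ (expProj a σ u) (expProj a (-σ) u) = 0 := by
    rw [inner_expProj]
    have := expProj_neg_expProj (a := a) (σ := -σ) (u := u)
    rw [neg_neg] at this
    rw [this, inner_zero_right]
  conv_lhs => rw [← expProj_add_expProj_neg (u := u) ha hσ]
  rw [norm_add_sq_real, h]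
  ring

theorem norm_expProj_le : ‖expProj a σ u‖ ≤ ‖u‖ := by
  have := norm_diag_le (c := fun i => if 0 < σ * a i then 1 else 0) (u := u) (K := 1) zero_le_one
    fun i _ => by split_ifs <;> simp
  rwa [one_mul] at this

theorem expProj_apply_ne_zero {i : Fin m} (h : expProj a σ u i ≠ 0) : 0 < σ * a i := by
  by_contra hi
  simp [hi] at h

theorem hasDerivAt_expFlow (t : ℝ) :
    HasDerivAt (fun t => expFlow a t u) (diag a (expFlow a t u)) t := by
  rw [← hasDerivWithinAt_univ, hasDerivWithinAt_iff_hasFDerivWithinAt, hasFDerivWithinAt_euclidean]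
  intro i
  have h := ((((hasDerivAt_id t).const_mul (a i)).exp).mul_const (u i)).hasFDerivAt
  rw [hasFDerivWithinAt_univ]
  refine h.congr_fderiv ?_
  ext
  simp [mul_assoc, mul_comm, mul_left_comm]

theorem continuous_expFlow : Continuous fun t => expFlow a t u :=
  continuous_iff_continuousAt.2 fun t => (hasDerivAt_expFlow t).continuousAt

theorem norm_expFlow_contract_le {t : ℝ} (ht : 0 ≤ t) (h : expProj a σ u = 0)
    (ha : ∀ i, a i ≠ 0) (hσ : σ ≠ 0) {γ : ℝ} (hγ : ∀ i, σ * a i < 0 → γ ≤ -(σ * a i)) :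
    ‖expFlow a (σ * t) u‖ ≤ Real.exp (-(γ * t)) * ‖u‖ := by
  refine norm_diag_le (Real.exp_pos _).le fun i hi => ?_
  have h1 : σ * a i < 0 := by
    have h2 : ¬ 0 < σ * a i := fun h2 => hi (by simpa [h2] using congrArg (fun w => w i) h)
    exact lt_of_le_of_ne (not_lt.1 h2) (mul_ne_zero hσ (ha i))
  rw [abs_of_pos (Real.exp_pos _), Real.exp_le_exp]
  nlinarith [hγ i h1]

theorem exists_pos_le_abs (ha : ∀ i, a i ≠ 0) (hσ : σ ≠ 0) : ∃ γ > 0, ∀ i, γ ≤ |σ * a i| := by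
  rcases isEmpty_or_nonempty (Fin m) with h | h
  · exact ⟨1, one_pos, fun i => h.elim i⟩
  · obtain ⟨i, hi⟩ := Finite.exists_min fun i => |σ * a i|
    exact ⟨_, abs_pos.2 (mul_ne_zero hσ (ha i)), hi⟩

theorem norm_expFlow_le_of_expProj_eq_zero {t : ℝ} (ht : 0 ≤ t) (h : expProj a σ u = 0)
    (ha : ∀ i, a i ≠ 0) (hσ : σ ≠ 0) : ‖expFlow a (σ * t) u‖ ≤ ‖u‖ := by
  simpa using norm_expFlow_contract_le ht h ha hσ (γ := 0) fun i hi => by linarith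

theorem tendsto_expFlow (h : expProj a σ u = 0) (ha : ∀ i, a i ≠ 0) (hσ : σ ≠ 0) :
    Tendsto (fun t => expFlow a (σ * t) u) atTop (𝓝 0) := by
  obtain ⟨γ, hγ, hγa⟩ := exists_pos_le_abs ha hσ
  refine squeeze_zero_norm' (a := fun t => Real.exp (-(γ * t)) * ‖u‖) ?_ ?_
  · filter_upwards [eventually_ge_atTop 0] with t ht
    refine norm_expFlow_contract_le ht h ha hσ fun i hi => ?_
    have := hγa i
    rwa [abs_of_neg hi] at this
  · have h1 : Tendsto (fun t : ℝ => Real.exp (-(γ * t))) atTop (𝓝 0) :=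
      Real.tendsto_exp_neg_atTop_nhds_zero.comp (tendsto_id.const_mul_atTop hγ)
    simpa using h1.mul_const ‖u‖

/-- `t ↦ ‖e^{tA} u‖²` is convex, so an orbit of the linear flow stays in the ball between two times
at which it is in the ball. -/
theorem norm_expFlow_lt_one {T θ : ℝ} (h0 : ‖u‖ < 1) (hT : ‖expFlow a T u‖ < 1) (hθ : 0 ≤ θ)
    (hθ1 : θ ≤ 1) : ‖expFlow a (θ * T) u‖ < 1 := by
  have h1 : ‖expFlow a (θ * T) u‖ ^ 2 ≤ (1 - θ) * ‖u‖ ^ 2 + θ * ‖expFlow a T u‖ ^ 2 := by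
    simp only [EuclideanSpace.real_norm_sq_eq, Finset.mul_sum, ← Finset.sum_add_distrib]
    refine Finset.sum_le_sum fun i _ => ?_
    simp only [expFlow_apply, mul_pow, ← Real.exp_nat_mul]
    have h2 := convexOn_exp.2 (mem_univ 0) (mem_univ (((2 : ℕ) : ℝ) * (a i * T)))
      (sub_nonneg.2 hθ1) hθ (by ring)
    simp only [smul_eq_mul, mul_zero, zero_add, Real.exp_zero, mul_one] at h2
    have h3 : ((2 : ℕ) : ℝ) * (a i * (θ * T)) = θ * (((2 : ℕ) : ℝ) * (a i * T)) := by ring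
    rw [h3]
    nlinarith [mul_le_mul_of_nonneg_right h2 (sq_nonneg (u i))]
  have h2 : ‖u‖ ^ 2 < 1 := by nlinarith [norm_nonneg u]
  have h3 : ‖expFlow a T u‖ ^ 2 < 1 := by nlinarith [norm_nonneg (expFlow a T u)]
  have h4 : ‖expFlow a (θ * T) u‖ ^ 2 < 1 := by
    rcases hθ.eq_or_lt with h | h
    · subst h; nlinarith
    · nlinarith
  nlinarith [norm_nonneg (expFlow a (θ * T) u)]

/-- An orbit starting near the origin and off the contracted subspace reaches the boundary of a
neighbourhood of that subspace, at a point close to the expanded subspace. -/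
theorem exists_exit_time (ha : ∀ i, a i ≠ 0) (hσ : σ ≠ 0) (hu : ‖u‖ < 1 / 2)
    (h : expProj a σ u ≠ 0) : ∃ T, 0 ≤ T ∧ ‖expProj a σ (expFlow a (σ * T) u)‖ = 1 / 2 ∧
      ‖expProj a (-σ) (expFlow a (σ * T) u)‖ ≤ ‖u‖ ∧ ‖expFlow a (σ * T) u‖ < 1 := by
  obtain ⟨γ, hγ, hγa⟩ := exists_pos_le_abs ha hσ
  have hpos : 0 < ‖expProj a σ u‖ := norm_pos_iff.2 h
  have hgrow : ∀ t, 0 ≤ t → Real.exp (γ * t) * ‖expProj a σ u‖ ≤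
      ‖expProj a σ (expFlow a (σ * t) u)‖ := by
    intro t ht
    rw [expProj_expFlow]
    refine le_norm_diag (Real.exp_pos _).le fun i hi => ?_
    have h1 := expProj_apply_ne_zero hi
    have h2 := hγa i
    rw [abs_of_pos h1] at h2
    rw [abs_of_pos (Real.exp_pos _), Real.exp_le_exp]
    nlinarith
  have hcont : Continuous fun t => ‖expProj a σ (expFlow a (σ * t) u)‖ :=
    ((expProj a σ).continuous.comp (continuous_expFlow.comp (continuous_const.mul continuous_id))).norm
  obtain ⟨S, hS0, hS⟩ : ∃ S, 0 ≤ S ∧ 1 / 2 ≤ ‖expProj a σ (expFlow a (σ * S) u)‖ := by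
    have h1 : Tendsto (fun t : ℝ => Real.exp (γ * t) * ‖expProj a σ u‖) atTop atTop :=
      (Real.tendsto_exp_atTop.comp (tendsto_id.const_mul_atTop hγ)).atTop_mul_const hpos
    obtain ⟨S, hS0, hS⟩ := ((eventually_ge_atTop 0).and (h1.eventually_ge_atTop (1 / 2))).exists
    exact ⟨S, hS0, hS.trans (hgrow S hS0)⟩
  obtain ⟨T, hT, hTeq⟩ := intermediate_value_Icc hS0 hcont.continuousOn
    (show (1 / 2 : ℝ) ∈ Icc _ _ from ⟨by
      simpa using norm_expProj_le.trans hu.le, hS⟩)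
  have hneg : ‖expProj a (-σ) (expFlow a (σ * T) u)‖ ≤ ‖u‖ := by
    rw [expProj_expFlow]
    refine (norm_expFlow_le_of_expProj_eq_zero hT.1 ?_ ha hσ).trans norm_expProj_le
    have := expProj_neg_expProj (a := a) (σ := -σ) (u := u)
    rwa [neg_neg] at this
  refine ⟨T, hT.1, hTeq, hneg, ?_⟩
  have h1 := norm_sq_eq_expProj (u := expFlow a (σ * T) u) ha hσ
  have h2 : ‖expProj a σ (expFlow a (σ * T) u)‖ = 1 / 2 := hTeq
  rw [h2] at h1
  nlinarith [norm_nonneg (expFlow a (σ * T) u),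
    norm_nonneg (expProj a (-σ) (expFlow a (σ * T) u))]

end Diagonal

/-! ### Dynamics of a Morse pair -/

section Dynamics

variable {m : ℕ} {M : Type*} [TopologicalSpace M] [ChartedSpace (EuclideanSpace ℝ (Fin m)) M]
  {f : M → ℝ} {ξ : (x : M) → TangentSpace (𝓡 m) x} {p q x : M}

namespace AdaptedChart

variable (Ψ : AdaptedChart f ξ p)

/-- The eigenvalues of the linear vector field in an adapted chart. -/
noncomputable def rate (i : Fin m) : ℝ :=
  if (i : ℕ) < morseIndex (m := m) f p then Ψ.μ i else -Ψ.μ i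

theorem rate_ne_zero (i : Fin m) : Ψ.rate i ≠ 0 := by
  have := Ψ.μ_pos i
  unfold rate
  split_ifs
  · exact this.ne'
  · linarith

theorem rate_pos_iff (i : Fin m) : 0 < Ψ.rate i ↔ (i : ℕ) < morseIndex (m := m) f p := by
  have := Ψ.μ_pos i
  unfold rate
  split_ifs with h
  · simpa [h] using this
  · simpa [h] using this.le

theorem mfderiv_field (hx : x ∈ Ψ.chart.source) :
    (mfderiv (𝓡 m) 𝓘(ℝ, EuclideanSpace ℝ (Fin m)) Ψ.chart x (ξ x) : EuclideanSpace ℝ (Fin m)) =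
      diag Ψ.rate (Ψ.chart x) := by
  refine (Ψ.map_field x hx).trans (PiLp.ext fun i => ?_)
  change (if (i : ℕ) < morseIndex (m := m) f p then Ψ.μ i * Ψ.chart x i
    else -(Ψ.μ i * Ψ.chart x i)) = Ψ.rate i * Ψ.chart x i
  unfold rate
  split_ifs <;> ring

theorem mem_target_iff {u : EuclideanSpace ℝ (Fin m)} : u ∈ Ψ.chart.target ↔ ‖u‖ < 1 := by
  rw [Ψ.target_eq, mem_ball_zero_iff]

theorem norm_chart_lt (hx : x ∈ Ψ.chart.source) : ‖Ψ.chart x‖ < 1 :=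
  Ψ.mem_target_iff.1 (Ψ.chart.map_source hx)

theorem symm_mem {u : EuclideanSpace ℝ (Fin m)} (hu : ‖u‖ < 1) : Ψ.chart.symm u ∈ Ψ.chart.source :=
  Ψ.chart.map_target (Ψ.mem_target_iff.2 hu)

theorem chart_symm {u : EuclideanSpace ℝ (Fin m)} (hu : ‖u‖ < 1) :
    Ψ.chart (Ψ.chart.symm u) = u :=
  Ψ.chart.right_inv (Ψ.mem_target_iff.2 hu)

theorem symm_zero : Ψ.chart.symm 0 = p := by
  rw [← Ψ.map_center, Ψ.chart.left_inv Ψ.mem_source]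

theorem contMDiffAt (hx : x ∈ Ψ.chart.source) :
    ContMDiffAt (𝓡 m) 𝓘(ℝ, EuclideanSpace ℝ (Fin m)) 2 Ψ.chart x :=
  Ψ.contMDiffOn.contMDiffAt (Ψ.chart.open_source.mem_nhds hx)

theorem mdifferentiableAt (hx : x ∈ Ψ.chart.source) :
    MDifferentiableAt (𝓡 m) 𝓘(ℝ, EuclideanSpace ℝ (Fin m)) Ψ.chart x :=
  (Ψ.contMDiffAt hx).mdifferentiableAt (by simp)

theorem mdifferentiableAt_symm {u : EuclideanSpace ℝ (Fin m)} (hu : ‖u‖ < 1) :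
    MDifferentiableAt 𝓘(ℝ, EuclideanSpace ℝ (Fin m)) (𝓡 m) Ψ.chart.symm u :=
  (Ψ.contMDiffOn_symm.contMDiffAt
    (Ψ.chart.open_target.mem_nhds (Ψ.mem_target_iff.2 hu))).mdifferentiableAt (by simp)

theorem hasMFDerivAt_expFlow {u : EuclideanSpace ℝ (Fin m)} {t : ℝ}
    (ht : ‖expFlow Ψ.rate t u‖ < 1) :
    HasMFDerivAt 𝓘(ℝ, ℝ) (𝓡 m) (fun t => Ψ.chart.symm (expFlow Ψ.rate t u)) t
      ((1 : ℝ →L[ℝ] ℝ).smulRight (ξ (Ψ.chart.symm (expFlow Ψ.rate t u)))) := by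
  refine hasMFDerivAt_symm_comp (Ψ.contMDiffOn.of_le (by norm_num))
    (Ψ.contMDiffOn_symm.of_le (by norm_num)) ?_ (Ψ.mem_target_iff.2 ht)
  refine (hasDerivAt_expFlow t).congr_deriv ?_
  unfold chartField
  rw [Ψ.mfderiv_field (Ψ.symm_mem ht), Ψ.chart_symm ht]

theorem field_eq_zero (Ψ : AdaptedChart f ξ p) : ξ p = 0 := by
  have h := Ψ.hasMFDerivAt_expFlow (u := 0) (t := 0) (by simp)
  have h2 := hasMFDerivAt_unique h
    ((hasMFDerivAt_const (Ψ.chart.symm 0) (0 : ℝ)).congr_of_eventuallyEq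
      (Eventually.of_forall fun t => congrArg Ψ.chart.symm (map_zero (expFlow Ψ.rate t))))
  have h3 := DFunLike.congr_fun h2 (1 : ℝ)
  have h4 : (1 : ℝ) • ξ (Ψ.chart.symm (expFlow Ψ.rate 0 0)) = 0 := h3
  rwa [one_smul, map_zero, Ψ.symm_zero] at h4

theorem eq_of_field_eq_zero (hx : x ∈ Ψ.chart.source) (h : ξ x = 0) : x = p := by
  have h1 := Ψ.mfderiv_field hx
  rw [h, map_zero] at h1
  have h2 : Ψ.chart x = 0 := by
    ext i
    have h3 := congrArg (fun w : EuclideanSpace ℝ (Fin m) => w i) h1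
    have h4 : (0 : ℝ) = Ψ.rate i * Ψ.chart x i := h3
    simpa [Ψ.rate_ne_zero i] using h4.symm
  rw [← Ψ.chart.left_inv hx, h2, Ψ.symm_zero]

end AdaptedChart

theorem IsMorsePair.isCrit_iff [IsManifold (𝓡 m) ω M] (h : IsMorsePair f ξ) :
    IsCrit (m := m) f x ↔ ξ x = 0 := by
  refine ⟨fun hx => ?_, fun hx => ?_⟩
  · obtain ⟨Ψ⟩ := h.adapted x hx
    exact Ψ.field_eq_zero
  · by_contra hcon
    have := h.decreasing x hcon
    rw [derivAlong, hx, map_zero] at this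
    exact lt_irrefl _ this

/-- The points whose orbit under the time-changed flow `Φ_{σ t}` converges to `q`: the stable
manifold for `σ = 1`, the unstable one for `σ = -1`. -/
def limitSet (ξ : (x : M) → TangentSpace (𝓡 m) x) (σ : ℝ) (q : M) : Set M :=
  {x | Tendsto (fun t => flow ξ (σ * t) x) atTop (𝓝 q)}

theorem limitSet_one : limitSet ξ 1 q = Wplus ξ q := by
  simp [limitSet, Wplus]

theorem limitSet_neg_one : limitSet ξ (-1) q = Wminus ξ q := by
  ext x
  simp only [limitSet, Wminus, mem_ofPred_eq, neg_one_mul]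
  refine ⟨fun h => ?_, fun h => h.comp tendsto_neg_atTop_atBot⟩
  have := h.comp tendsto_neg_atBot_atTop
  simpa [Function.comp_def] using this

variable [IsManifold (𝓡 m) ω M] [CompactSpace M] [T2Space M]

/-- In an adapted chart the flow is the linear flow `e^{tA}`, as long as it stays in the chart. -/
theorem AdaptedChart.flow_symm (Ψ : AdaptedChart f ξ p)
    (hξ : ContMDiff (𝓡 m) (𝓡 m).tangent 2 (fun x => (⟨x, ξ x⟩ : TangentBundle (𝓡 m) M)))
    {u : EuclideanSpace ℝ (Fin m)} {T : ℝ} (hu : ‖u‖ < 1) (hT : ‖expFlow Ψ.rate T u‖ < 1) :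
    flow ξ T (Ψ.chart.symm u) = Ψ.chart.symm (expFlow Ψ.rate T u) := by
  have key : ∀ {u : EuclideanSpace ℝ (Fin m)} {T : ℝ}, 0 ≤ T → ‖u‖ < 1 →
      ‖expFlow Ψ.rate T u‖ < 1 →
      flow ξ T (Ψ.chart.symm u) = Ψ.chart.symm (expFlow Ψ.rate T u) := by
    intro u T hT0 hu hT
    obtain ⟨δ, hδ, hδ1, hδ2⟩ : ∃ δ > 0, ‖expFlow Ψ.rate (-δ) u‖ < 1 ∧
        ‖expFlow Ψ.rate (T + δ) u‖ < 1 := by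
      have h1 : ∀ᶠ δ in 𝓝 (0 : ℝ), ‖expFlow Ψ.rate (-δ) u‖ < 1 := by
        have : Continuous fun δ => ‖expFlow Ψ.rate (-δ) u‖ :=
          (continuous_expFlow.comp continuous_neg).norm
        exact this.continuousAt.eventually_lt_const (by simpa using hu)
      have h2 : ∀ᶠ δ in 𝓝 (0 : ℝ), ‖expFlow Ψ.rate (T + δ) u‖ < 1 := by
        have : Continuous fun δ => ‖expFlow Ψ.rate (T + δ) u‖ :=
          (continuous_expFlow.comp (continuous_const.add continuous_id)).norm
        exact this.continuousAt.eventually_lt_const (by simpa using hT)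
      have h3 := (h1.and h2).filter_mono (nhdsWithin_le_nhds (s := Ioi 0))
      obtain ⟨δ, ⟨h4, h5⟩, h6⟩ := (h3.and self_mem_nhdsWithin).exists
      exact ⟨δ, h6, h4, h5⟩
    have hin : ∀ t ∈ Ioo (-δ) (T + δ), ‖expFlow Ψ.rate t u‖ < 1 := by
      intro t ht
      have hpos : 0 < T + 2 * δ := by linarith
      have h1 := norm_expFlow_lt_one (a := Ψ.rate) (u := expFlow Ψ.rate (-δ) u) (T := T + 2 * δ)
        (θ := (t + δ) / (T + 2 * δ)) hδ1
        (by rwa [← expFlow_add, show T + 2 * δ + -δ = T + δ by ring])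
        (div_nonneg (by linarith [ht.1]) hpos.le)
        ((div_le_one hpos).2 (by linarith [ht.2]))
      rwa [← expFlow_add, div_mul_cancel₀ _ hpos.ne', show t + δ + -δ = t by ring] at h1
    have h0 : (0 : ℝ) ∈ Ioo (-δ) (T + δ) := ⟨by linarith, by linarith⟩
    have h := eq_flow_of_isMIntegralCurveOn hξ
      (γ := fun t => Ψ.chart.symm (expFlow Ψ.rate t u)) h0
      (fun t ht => (Ψ.hasMFDerivAt_expFlow (hin t ht)).hasMFDerivWithinAt)
      (t := T) ⟨by linarith, by linarith⟩
    simpa using h.symm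
  rcases le_total 0 T with h | h
  · exact key h hu hT
  · have h1 := key (u := expFlow Ψ.rate T u) (T := -T) (by linarith) hT
      (by rwa [expFlow_neg_expFlow])
    rw [expFlow_neg_expFlow] at h1
    rw [← h1, flow_flow_neg hξ]

theorem AdaptedChart.flow_eq (Ψ : AdaptedChart f ξ p)
    (hξ : ContMDiff (𝓡 m) (𝓡 m).tangent 2 (fun x => (⟨x, ξ x⟩ : TangentBundle (𝓡 m) M)))
    (hx : x ∈ Ψ.chart.source) {T : ℝ} (hT : ‖expFlow Ψ.rate T (Ψ.chart x)‖ < 1) :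
    flow ξ T x = Ψ.chart.symm (expFlow Ψ.rate T (Ψ.chart x)) := by
  have := Ψ.flow_symm hξ (Ψ.norm_chart_lt hx) hT
  rwa [Ψ.chart.left_inv hx] at this

theorem AdaptedChart.flow_mem (Ψ : AdaptedChart f ξ p)
    (hξ : ContMDiff (𝓡 m) (𝓡 m).tangent 2 (fun x => (⟨x, ξ x⟩ : TangentBundle (𝓡 m) M)))
    (hx : x ∈ Ψ.chart.source) {T : ℝ} (hT : ‖expFlow Ψ.rate T (Ψ.chart x)‖ < 1) :
    flow ξ T x ∈ Ψ.chart.source := by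
  rw [Ψ.flow_eq hξ hx hT]
  exact Ψ.symm_mem hT

theorem AdaptedChart.chart_flow (Ψ : AdaptedChart f ξ p)
    (hξ : ContMDiff (𝓡 m) (𝓡 m).tangent 2 (fun x => (⟨x, ξ x⟩ : TangentBundle (𝓡 m) M)))
    (hx : x ∈ Ψ.chart.source) {T : ℝ} (hT : ‖expFlow Ψ.rate T (Ψ.chart x)‖ < 1) :
    Ψ.chart (flow ξ T x) = expFlow Ψ.rate T (Ψ.chart x) := by
  rw [Ψ.flow_eq hξ hx hT, Ψ.chart_symm hT]

/-- An orbit segment inside an adapted chart is an orbit segment of the linear flow. -/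
theorem AdaptedChart.chart_flow_of_forall_mem (Ψ : AdaptedChart f ξ p)
    (hξ : ContMDiff (𝓡 m) (𝓡 m).tangent 2 (fun x => (⟨x, ξ x⟩ : TangentBundle (𝓡 m) M)))
    {T : ℝ} (hT : 0 ≤ T) (hx : ∀ t ∈ Icc 0 T, flow ξ t x ∈ Ψ.chart.source) :
    Ψ.chart (flow ξ T x) = expFlow Ψ.rate T (Ψ.chart x) := by
  have hd : ∀ t ∈ Icc 0 T, HasDerivAt (fun t => Ψ.chart (flow ξ t x))
      (diag Ψ.rate (Ψ.chart (flow ξ t x))) t := by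
    intro t ht
    have h1 := HasMFDerivAt.comp t (Ψ.mdifferentiableAt (hx t ht)).hasMFDerivAt
      ((flow_spec hξ x).2 t)
    have h2 : HasFDerivAt (fun t => Ψ.chart (flow ξ t x))
        (show ℝ →L[ℝ] EuclideanSpace ℝ (Fin m) from
          (mfderiv (𝓡 m) 𝓘(ℝ, EuclideanSpace ℝ (Fin m)) Ψ.chart (flow ξ t x)).comp
            ((1 : ℝ →L[ℝ] ℝ).smulRight (ξ (flow ξ t x)))) t :=
      hasMFDerivAt_iff_hasFDerivAt.1 h1
    refine h2.hasDerivAt.congr_deriv ?_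
    change mfderiv (𝓡 m) 𝓘(ℝ, EuclideanSpace ℝ (Fin m)) Ψ.chart (flow ξ t x)
      ((1 : ℝ) • ξ (flow ξ t x)) = _
    rw [one_smul]
    exact Ψ.mfderiv_field (hx t ht)
  refine ODE_solution_unique (v := fun _ => diag Ψ.rate) (K := ‖diag Ψ.rate‖₊)
    (fun _ => (diag Ψ.rate).lipschitz) (HasDerivAt.continuousOn hd)
    (fun t ht => (hd t (Ico_subset_Icc_self ht)).hasDerivWithinAt)
    continuous_expFlow.continuousOn
    (fun t _ => (hasDerivAt_expFlow t).hasDerivWithinAt) ?_ ⟨hT, le_rfl⟩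
  rw [(flow_spec hξ x).1, expFlow_zero]

theorem IsMorsePair.flow_eq_self (h : IsMorsePair f ξ) (hx : IsCrit (m := m) f x) (t : ℝ) :
    flow ξ t x = x := by
  have h1 := isMIntegralCurve_Ioo_eq_of_contMDiff_boundaryless (t₀ := 0)
    (h.contMDiff_field.of_le (by norm_num)) (flow_spec h.contMDiff_field x).2
    (isMIntegralCurve_const (h.isCrit_iff.1 hx)) (flow_spec h.contMDiff_field x).1
  exact congrFun h1 t

theorem IsMorsePair.isCrit_of_forall_flow_eq (h : IsMorsePair f ξ) (hx : ∀ t, flow ξ t x = x) :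
    IsCrit (m := m) f x := by
  rw [h.isCrit_iff]
  have h1 := (flow_spec h.contMDiff_field x).2 0
  have h2 := hasMFDerivAt_unique h1
    ((hasMFDerivAt_const x (0 : ℝ)).congr_of_eventuallyEq (Eventually.of_forall hx))
  have h3 := DFunLike.congr_fun h2 (1 : ℝ)
  have h4 : (1 : ℝ) • ξ (flow ξ 0 x) = 0 := h3
  rwa [one_smul, hx] at h4

theorem IsMorsePair.not_isCrit_flow (h : IsMorsePair f ξ) (hx : ¬ IsCrit (m := m) f x) (t : ℝ) :
    ¬ IsCrit (m := m) f (flow ξ t x) := fun hcon => hx <| by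
  have h1 := h.flow_eq_self hcon (-t)
  rw [flow_neg_flow h.contMDiff_field] at h1
  rwa [h1]

theorem IsMorsePair.finite_crit (h : IsMorsePair f ξ) : {p | IsCrit (m := m) f p}.Finite := by
  have hclosed : IsClosed {p | IsCrit (m := m) f p} := by
    have : {p | IsCrit (m := m) f p} = ⋂ t : ℝ, {x | flow ξ t x = x} := by
      ext x
      simp only [mem_ofPred_eq, mem_iInter]
      exact ⟨fun hx t => h.flow_eq_self hx t, h.isCrit_of_forall_flow_eq⟩
    rw [this]
    exact isClosed_iInter fun t =>
      isClosed_eq (contMDiff_flow h.contMDiff_field t).continuous continuous_id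
  have hΨ : ∀ p : M, ∃ U ∈ 𝓝 p, IsCrit (m := m) f p → ∀ x ∈ U, IsCrit (m := m) f x → x = p := by
    intro p
    by_cases hp : IsCrit (m := m) f p
    · obtain ⟨Ψ⟩ := h.adapted p hp
      exact ⟨Ψ.chart.source, Ψ.chart.open_source.mem_nhds Ψ.mem_source,
        fun _ x hx hxc => Ψ.eq_of_field_eq_zero hx (h.isCrit_iff.1 hxc)⟩
    · exact ⟨univ, univ_mem, fun h => absurd h hp⟩
  choose U hU hUeq using hΨ
  obtain ⟨S, hS, hcov⟩ := hclosed.isCompact.elim_nhds_subcover U fun p _ => hU p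
  refine S.finite_toSet.subset fun x hx => ?_
  obtain ⟨p, hp, hxp⟩ := mem_iUnion₂.1 (hcov hx)
  rw [hUeq p (hS p hp) x hxp hx]
  exact hp

theorem IsMorsePair.hasDerivAt_comp_flow (h : IsMorsePair f ξ) (σ t : ℝ) :
    HasDerivAt (fun t => σ * f (flow ξ (σ * t) x))
      (σ * (σ * derivAlong f ξ (flow ξ (σ * t) x))) t := by
  have hf : MDifferentiableAt (𝓡 m) 𝓘(ℝ, ℝ) f (flow ξ (σ * t) x) :=
    (h.contMDiff_fun _).mdifferentiableAt (by simp)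
  have h1 := HasMFDerivAt.comp (σ * t) hf.hasMFDerivAt
    ((flow_spec h.contMDiff_field x).2 (σ * t))
  have h2 : HasFDerivAt (fun t => f (flow ξ t x)) (show ℝ →L[ℝ] ℝ from
      (mfderiv (𝓡 m) 𝓘(ℝ, ℝ) f (flow ξ (σ * t) x)).comp
        ((1 : ℝ →L[ℝ] ℝ).smulRight (ξ (flow ξ (σ * t) x)))) (σ * t) :=
    hasMFDerivAt_iff_hasFDerivAt.1 h1
  have h3 : HasDerivAt (fun t => f (flow ξ t x)) (derivAlong f ξ (flow ξ (σ * t) x)) (σ * t) := by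
    refine h2.hasDerivAt.congr_deriv ?_
    change mfderiv (𝓡 m) 𝓘(ℝ, ℝ) f (flow ξ (σ * t) x) ((1 : ℝ) • ξ (flow ξ (σ * t) x)) = _
    rw [one_smul]
    rfl
  have h4 := (h3.comp t ((hasDerivAt_id t).const_mul σ)).const_mul σ
  simpa [Function.comp_def, mul_comm, mul_left_comm] using h4

theorem IsMorsePair.strictAnti (h : IsMorsePair f ξ) (hx : ¬ IsCrit (m := m) f x) {σ : ℝ}
    (hσ : σ ≠ 0) : StrictAnti fun t => σ * f (flow ξ (σ * t) x) := by
  refine strictAnti_of_hasDerivAt_neg (fun t => h.hasDerivAt_comp_flow σ t) fun t => ?_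
  have := h.decreasing _ (h.not_isCrit_flow hx (σ * t))
  have h2 : 0 < σ * σ := mul_self_pos.2 hσ
  nlinarith

theorem IsMorsePair.antitone (h : IsMorsePair f ξ) {σ : ℝ} (hσ : σ ≠ 0) (x : M) :
    Antitone fun t => σ * f (flow ξ (σ * t) x) := by
  by_cases hx : IsCrit (m := m) f x
  · simp only [h.flow_eq_self hx]
    exact antitone_const
  · exact (h.strictAnti hx hσ).antitone

theorem flow_mem_limitSet
    (hξ : ContMDiff (𝓡 m) (𝓡 m).tangent 2 (fun x => (⟨x, ξ x⟩ : TangentBundle (𝓡 m) M)))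
    {σ : ℝ} (hσ : σ ≠ 0) (s : ℝ) (hx : x ∈ limitSet ξ σ q) : flow ξ s x ∈ limitSet ξ σ q := by
  have h1 : Tendsto (fun t : ℝ => t + s / σ) atTop atTop := tendsto_atTop_add_const_right _ _ tendsto_id
  have h2 := (show Tendsto (fun t => flow ξ (σ * t) x) atTop (𝓝 q) from hx).comp h1
  change Tendsto (fun t => flow ξ (σ * t) (flow ξ s x)) atTop (𝓝 q)
  refine h2.congr fun t => ?_
  rw [Function.comp_apply, ← flow_add hξ]
  congr 1
  field_simp

theorem flow_mem_Wminus
    (hξ : ContMDiff (𝓡 m) (𝓡 m).tangent 2 (fun x => (⟨x, ξ x⟩ : TangentBundle (𝓡 m) M)))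
    (s : ℝ) (hx : x ∈ Wminus ξ q) : flow ξ s x ∈ Wminus ξ q := by
  rw [← limitSet_neg_one] at hx ⊢
  exact flow_mem_limitSet hξ (by norm_num) s hx

theorem IsMorsePair.le_of_mem_limitSet (h : IsMorsePair f ξ) {σ : ℝ} (hσ : σ ≠ 0)
    (hx : x ∈ limitSet ξ σ q) : σ * f q ≤ σ * f x := by
  have h1 : Tendsto (fun t => σ * f (flow ξ (σ * t) x)) atTop (𝓝 (σ * f q)) :=
    ((h.contMDiff_fun.continuous.tendsto q).comp hx).const_mul σ
  have h2 := (h.antitone hσ x).le_of_tendsto h1 0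
  simpa [(flow_spec h.contMDiff_field x).1] using h2

theorem IsMorsePair.lt_of_mem_limitSet (h : IsMorsePair f ξ) {σ : ℝ} (hσ : σ ≠ 0)
    (hx : x ∈ limitSet ξ σ q) (hxc : ¬ IsCrit (m := m) f x) : σ * f q < σ * f x := by
  have h1 := h.le_of_mem_limitSet hσ (flow_mem_limitSet h.contMDiff_field hσ (σ * 1) hx)
  have h2 := h.strictAnti hxc hσ zero_lt_one
  simp only [mul_zero, (flow_spec h.contMDiff_field x).1] at h2
  exact h1.trans_lt h2

/-- Every orbit emanates from a critical point. -/
theorem IsMorsePair.exists_mem_Wminus (h : IsMorsePair f ξ) (x : M) :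
    ∃ p, IsCrit (m := m) f p ∧ x ∈ Wminus ξ p := by
  have hξ := h.contMDiff_field
  have hfc : Continuous f := h.contMDiff_fun.continuous
  set γ : ℝ → M := fun t => flow ξ (-1 * t) x with hγ
  have hγc : Continuous γ :=
    (flow_spec hξ x).2.continuous.comp (continuous_const.mul continuous_id)
  -- `f` converges along the orbit, since it is monotone and bounded
  obtain ⟨c, hc⟩ : ∃ c, Tendsto (fun t => -1 * f (γ t)) atTop (𝓝 c) := by
    refine ⟨_, tendsto_atTop_ciInf (h.antitone (by norm_num) x) ?_⟩
    obtain ⟨b, hb⟩ := isCompact_univ.bddAbove_image hfc.continuousOn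
    refine ⟨-1 * b, ?_⟩
    rintro _ ⟨t, rfl⟩
    have := hb (mem_image_of_mem f (mem_univ (γ t)))
    linarith
  -- hence `f` is constant along the orbit of each limit point, which is therefore critical
  have hlim : ∀ w, MapClusterPt w atTop γ → IsCrit (m := m) f w := by
    intro w hw
    by_contra hwc
    have hval : ∀ s : ℝ, -1 * f (flow ξ (-1 * s) w) = c := by
      intro s
      have hcs : Continuous fun y => -1 * f (flow ξ (-1 * s) y) :=
        continuous_const.mul (hfc.comp (contMDiff_flow hξ (-1 * s)).continuous)
      have h1 : MapClusterPt (-1 * f (flow ξ (-1 * s) w)) atTop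
          ((fun y => -1 * f (flow ξ (-1 * s) y)) ∘ γ) :=
        MapClusterPt.continuousAt_comp (f := fun y => -1 * f (flow ξ (-1 * s) y))
          hcs.continuousAt hw
      have h2 : Tendsto ((fun y => -1 * f (flow ξ (-1 * s) y)) ∘ γ) atTop (𝓝 c) := by
        refine (hc.comp (tendsto_atTop_add_const_right _ s tendsto_id)).congr fun t => ?_
        simp only [Function.comp_apply, id, hγ]
        rw [← flow_add hξ]
        congr 3
        ring
      have : NeBot (𝓝 (-1 * f (flow ξ (-1 * s) w)) ⊓ 𝓝 c) :=
        h1.neBot.mono (inf_le_inf_left _ h2)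
      exact eq_of_nhds_neBot this
    have h1 := h.strictAnti hwc (σ := -1) (by norm_num) zero_lt_one
    simp only [hval] at h1
    exact lt_irrefl _ h1
  obtain ⟨p, -, hp⟩ := isCompact_univ.exists_mapClusterPt (f := atTop) (u := γ) (by simp)
  refine ⟨p, hlim p hp, ?_⟩
  rw [← limitSet_neg_one]
  -- the orbit is eventually near the critical set, and cannot jump between critical points
  obtain ⟨U, hU, hdisj⟩ := h.finite_crit.t2_separation
  intro N hN
  obtain ⟨N', hN'N, hN'o, hpN'⟩ := mem_nhds_iff.1 hN
  set O := N' ∩ U p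
  set O' := ⋃ r ∈ {r | IsCrit (m := m) f r} \ {p}, U r
  have hO : IsOpen O := hN'o.inter (hU p).2
  have hO' : IsOpen O' := isOpen_biUnion fun r _ => (hU r).2
  have hOO' : Disjoint O O' := by
    rw [disjoint_iUnion₂_right]
    rintro r ⟨hr, hrp⟩
    exact (hdisj (hlim p hp) hr (fun h => hrp h.symm)).mono_left inter_subset_right
  have hev : ∀ᶠ t in atTop, γ t ∈ O ∪ O' := by
    by_contra hcon
    rw [not_eventually] at hcon
    have hK : IsCompact (O ∪ O')ᶜ := (hO.union hO').isClosed_compl.isCompact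
    obtain ⟨w, hw, hwγ⟩ := hK.exists_mapClusterPt_of_frequently hcon
    refine hw ?_
    have hwc := hlim w hwγ
    by_cases hwp : w = p
    · rw [hwp]; exact Or.inl ⟨hpN', (hU p).1⟩
    · exact Or.inr (mem_iUnion₂.2 ⟨w, ⟨hwc, hwp⟩, (hU w).1⟩)
  obtain ⟨T, hT⟩ := eventually_atTop.1 hev
  have hpre : IsPreconnected (γ '' Ici T) := isPreconnected_Ici.image _ hγc.continuousOn
  have hsub : γ '' Ici T ⊆ O ∪ O' := by
    rintro _ ⟨t, ht, rfl⟩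
    exact hT t ht
  obtain ⟨t, htO, ht⟩ : ∃ t, γ t ∈ O ∧ T ≤ t :=
    ((hp.frequently (hO.mem_nhds ⟨hpN', (hU p).1⟩)).and_eventually (eventually_ge_atTop T)).exists
  have hin : γ '' Ici T ⊆ O := hpre.subset_left_of_subset_union hO hO' hOO' hsub
    ⟨γ t, mem_image_of_mem γ ht, htO⟩
  refine mem_map.2 ?_
  filter_upwards [eventually_ge_atTop T] with t ht
  exact hN'N (hin (mem_image_of_mem γ ht)).1

end Dynamics

/-! ### Invariant manifolds in an adapted chart -/

section ExitSphere

variable {m : ℕ} {a : Fin m → ℝ} {σ : ℝ} {u : EuclideanSpace ℝ (Fin m)}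

/-- The points of the expanded subspace of `e^{σ t A}` at distance `1/2` from the origin: every
orbit leaving a neighbourhood of the origin passes near them. -/
def exitSphere (a : Fin m → ℝ) (σ : ℝ) : Set (EuclideanSpace ℝ (Fin m)) :=
  {u | expProj a (-σ) u = 0 ∧ ‖u‖ = 1 / 2}

theorem isCompact_exitSphere : IsCompact (exitSphere a σ) := by
  refine (isCompact_sphere (0 : EuclideanSpace ℝ (Fin m)) (1 / 2)).of_isClosed_subset ?_ fun u hu =>
    mem_sphere_zero_iff_norm.2 hu.2
  exact (isClosed_eq (expProj a (-σ)).continuous continuous_const).inter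
    (isClosed_eq continuous_norm continuous_const)

/-- An orbit which starts close to the origin, off the contracted subspace, passes as close to the
exit sphere as its starting point is to the origin. -/
theorem exists_exitSphere_dist_le (ha : ∀ i, a i ≠ 0) (hσ : σ ≠ 0) (hu : ‖u‖ < 1 / 2)
    (h : expProj a σ u ≠ 0) : ∃ T, 0 ≤ T ∧ ‖expFlow a (σ * T) u‖ < 1 ∧
      ‖expProj a σ (expFlow a (σ * T) u)‖ = 1 / 2 ∧
      ∃ w ∈ exitSphere a σ, dist (expFlow a (σ * T) u) w ≤ ‖u‖ := by
  obtain ⟨T, hT, h1, h2, h3⟩ := exists_exit_time ha hσ hu h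
  refine ⟨T, hT, h3, h1, expProj a σ (expFlow a (σ * T) u), ⟨expProj_neg_expProj, h1⟩, ?_⟩
  refine le_of_eq_of_le ?_ h2
  rw [dist_eq_norm]
  congr 1
  exact sub_eq_of_eq_add' (expProj_add_expProj_neg ha hσ).symm

end ExitSphere

section LocalStructure

variable {m : ℕ} {M : Type*} [TopologicalSpace M] [ChartedSpace (EuclideanSpace ℝ (Fin m)) M]
  {f : M → ℝ} {ξ : (x : M) → TangentSpace (𝓡 m) x} {p q x : M}

theorem AdaptedChart.continuousAt (Ψ : AdaptedChart f ξ q) (hx : x ∈ Ψ.chart.source) :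
    ContinuousAt Ψ.chart x :=
  Ψ.chart.continuousAt hx

theorem AdaptedChart.continuousAt_symm (Ψ : AdaptedChart f ξ q) {u : EuclideanSpace ℝ (Fin m)}
    (hu : ‖u‖ < 1) : ContinuousAt Ψ.chart.symm u :=
  Ψ.chart.continuousAt_symm (Ψ.mem_target_iff.2 hu)

theorem AdaptedChart.mfderiv_injective (Ψ : AdaptedChart f ξ q) (hx : x ∈ Ψ.chart.source) :
    Function.Injective (mfderiv (𝓡 m) 𝓘(ℝ, EuclideanSpace ℝ (Fin m)) Ψ.chart x) := by
  have h1 : MDifferentiableAt 𝓘(ℝ, EuclideanSpace ℝ (Fin m)) (𝓡 m) Ψ.chart.symm (Ψ.chart x) :=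
    Ψ.mdifferentiableAt_symm (Ψ.norm_chart_lt hx)
  have h2 := HasMFDerivAt.comp x h1.hasMFDerivAt (Ψ.mdifferentiableAt hx).hasMFDerivAt
  have h3 : HasMFDerivAt (𝓡 m) (𝓡 m) (Ψ.chart.symm ∘ Ψ.chart) x
      (ContinuousLinearMap.id ℝ (TangentSpace (𝓡 m) x)) := by
    refine (hasMFDerivAt_id x).congr_of_eventuallyEq ?_
    filter_upwards [Ψ.chart.open_source.mem_nhds hx] with y hy using Ψ.chart.left_inv hy
  have h4 := hasMFDerivAt_unique h2 h3
  exact Function.LeftInverse.injective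
    (g := mfderiv 𝓘(ℝ, EuclideanSpace ℝ (Fin m)) (𝓡 m) Ψ.chart.symm (Ψ.chart x))
    fun v => DFunLike.congr_fun h4 v

theorem AdaptedChart.not_isCrit_symm [IsManifold (𝓡 m) ω M] (h : IsMorsePair f ξ)
    (Ψ : AdaptedChart f ξ q) {u : EuclideanSpace ℝ (Fin m)} (hu : ‖u‖ < 1) (hu0 : u ≠ 0) :
    ¬ IsCrit (m := m) f (Ψ.chart.symm u) := by
  intro hc
  have h1 := Ψ.eq_of_field_eq_zero (Ψ.symm_mem hu) (h.isCrit_iff.1 hc)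
  have h2 := Ψ.chart_symm hu
  rw [h1, Ψ.map_center] at h2
  exact hu0 h2.symm

theorem AdaptedChart.isCrit [IsManifold (𝓡 m) ω M] (h : IsMorsePair f ξ) (Ψ : AdaptedChart f ξ q) :
    IsCrit (m := m) f q :=
  h.isCrit_iff.2 Ψ.field_eq_zero

variable [IsManifold (𝓡 m) ω M] [CompactSpace M] [T2Space M]

/-- The subspace contracted by `e^{σ t A}` lies, in an adapted chart, in the corresponding
invariant manifold. -/
theorem AdaptedChart.symm_mem_limitSet (Ψ : AdaptedChart f ξ q)
    (hξ : ContMDiff (𝓡 m) (𝓡 m).tangent 2 (fun x => (⟨x, ξ x⟩ : TangentBundle (𝓡 m) M)))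
    {σ : ℝ} (hσ : σ ≠ 0) {u : EuclideanSpace ℝ (Fin m)} (hu : ‖u‖ < 1)
    (h : expProj Ψ.rate σ u = 0) : Ψ.chart.symm u ∈ limitSet ξ σ q := by
  have h1 : Tendsto (fun t => Ψ.chart.symm (expFlow Ψ.rate (σ * t) u)) atTop (𝓝 q) := by
    have h2 := (Ψ.continuousAt_symm (u := 0) (by simp)).tendsto
    rw [Ψ.symm_zero] at h2
    exact h2.comp (tendsto_expFlow h Ψ.rate_ne_zero hσ)
  change Tendsto (fun t => flow ξ (σ * t) (Ψ.chart.symm u)) atTop (𝓝 q)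
  refine h1.congr' ?_
  filter_upwards [eventually_ge_atTop 0] with t ht
  rw [Ψ.flow_symm hξ hu]
  exact (norm_expFlow_le_of_expProj_eq_zero ht h Ψ.rate_ne_zero hσ).trans_lt hu

/-- Near a critical point the invariant manifolds are linear in an adapted chart. A point off the
contracted subspace leaves the chart near the exit sphere, which lies in the opposite invariant
manifold; there `σ f` is already below its value at the critical point, so the orbit cannot
return. -/
theorem AdaptedChart.exists_expProj_eq_zero (h : IsMorsePair f ξ) (Ψ : AdaptedChart f ξ q)
    {σ : ℝ} (hσ : σ ≠ 0) : ∃ r > 0, ∀ y ∈ Ψ.chart.source, ‖Ψ.chart y‖ < r →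
      y ∈ limitSet ξ σ q → expProj Ψ.rate σ (Ψ.chart y) = 0 := by
  have hξ := h.contMDiff_field
  set O : Set (EuclideanSpace ℝ (Fin m)) :=
    Ψ.chart.target ∩ Ψ.chart.symm ⁻¹' {x | σ * f x < σ * f q} with hO
  have hOo : IsOpen O := Ψ.chart.isOpen_inter_preimage_symm
    (isOpen_lt (continuous_const.mul h.contMDiff_fun.continuous) continuous_const)
  have hKO : exitSphere Ψ.rate σ ⊆ O := by
    intro u hu
    have hu1 : ‖u‖ < 1 := by rw [hu.2]; norm_num
    have hu0 : u ≠ 0 := by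
      rintro rfl
      have := hu.2
      norm_num at this
    refine ⟨Ψ.mem_target_iff.2 hu1, ?_⟩
    have h1 := h.lt_of_mem_limitSet (neg_ne_zero.2 hσ)
      (Ψ.symm_mem_limitSet hξ (neg_ne_zero.2 hσ) hu1 hu.1) (Ψ.not_isCrit_symm h hu1 hu0)
    change σ * f (Ψ.chart.symm u) < σ * f q
    linarith
  obtain ⟨δ, hδ, hδO⟩ := isCompact_exitSphere.exists_thickening_subset_open hOo hKO
  refine ⟨min δ (1 / 2), lt_min hδ (by norm_num), fun y hy hyr hyq => ?_⟩
  by_contra hne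
  obtain ⟨T, -, hT1, -, w, hw, hdist⟩ := exists_exitSphere_dist_le Ψ.rate_ne_zero hσ
    (hyr.trans_le (min_le_right _ _)) hne
  have h1 : expFlow Ψ.rate (σ * T) (Ψ.chart y) ∈ O :=
    hδO (Metric.mem_thickening_iff.2 ⟨w, hw, hdist.trans_lt (hyr.trans_le (min_le_left _ _))⟩)
  have h2 : σ * f (Ψ.chart.symm (expFlow Ψ.rate (σ * T) (Ψ.chart y))) < σ * f q := h1.2
  rw [← Ψ.flow_eq hξ hy hT1] at h2
  exact absurd (h.le_of_mem_limitSet hσ (flow_mem_limitSet hξ hσ (σ * T) hyq)) h2.not_ge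

theorem AdaptedChart.eventually_expProj_eq_zero (h : IsMorsePair f ξ) (Ψ : AdaptedChart f ξ q)
    {σ : ℝ} (hσ : σ ≠ 0) (hx : x ∈ Ψ.chart.source) (hx0 : expProj Ψ.rate σ (Ψ.chart x) = 0) :
    ∀ᶠ y in 𝓝 x, y ∈ limitSet ξ σ q → expProj Ψ.rate σ (Ψ.chart y) = 0 := by
  have hξ := h.contMDiff_field
  obtain ⟨r, hr, hflat⟩ := Ψ.exists_expProj_eq_zero h hσ
  obtain ⟨T, hT⟩ := ((tendsto_expFlow hx0 Ψ.rate_ne_zero hσ).norm.eventually_lt_const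
    (show ‖(0 : EuclideanSpace ℝ (Fin m))‖ < min r 1 by simpa using hr)).exists
  have hc : ContinuousAt (fun y => ‖expFlow Ψ.rate (σ * T) (Ψ.chart y)‖) x :=
    ((expFlow Ψ.rate (σ * T)).continuous.continuousAt.comp (Ψ.continuousAt hx)).norm
  filter_upwards [Ψ.chart.open_source.mem_nhds hx, hc.eventually_lt_const hT] with y hy hyT hyq
  have hy1 := hyT.trans_le (min_le_right r 1)
  have h1 := hflat _ (Ψ.flow_mem hξ hy hy1)
    (by rw [Ψ.chart_flow hξ hy hy1]; exact hyT.trans_le (min_le_left r 1))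
    (flow_mem_limitSet hξ hσ (σ * T) hyq)
  rw [Ψ.chart_flow hξ hy hy1, expProj_expFlow] at h1
  rw [← expFlow_neg_expFlow (a := Ψ.rate) (u := expProj Ψ.rate σ (Ψ.chart y)) (σ * T), h1, map_zero]

theorem AdaptedChart.expProj_eq_zero_of_mem_imageTangent (h : IsMorsePair f ξ)
    (Ψ : AdaptedChart f ξ q) {σ : ℝ} (hσ : σ ≠ 0) (hx : x ∈ Ψ.chart.source)
    (hx0 : expProj Ψ.rate σ (Ψ.chart x) = 0) {w : EuclideanSpace ℝ (Fin m)}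
    (hw : w ∈ imageTangent m Ψ.chart (limitSet ξ σ q) x) : expProj Ψ.rate σ w = 0 :=
  imageTangent_le_ker (Ψ.mdifferentiableAt hx) (Ψ.eventually_expProj_eq_zero h hσ hx hx0) hw

theorem AdaptedChart.mem_imageTangent_of_expProj_eq_zero (Ψ : AdaptedChart f ξ q)
    (hξ : ContMDiff (𝓡 m) (𝓡 m).tangent 2 (fun x => (⟨x, ξ x⟩ : TangentBundle (𝓡 m) M)))
    {σ : ℝ} (hσ : σ ≠ 0) (hx : x ∈ Ψ.chart.source) (hx0 : expProj Ψ.rate σ (Ψ.chart x) = 0)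
    {w : EuclideanSpace ℝ (Fin m)} (hw : expProj Ψ.rate σ w = 0) :
    w ∈ imageTangent m Ψ.chart (limitSet ξ σ q) x := by
  classical
  have hline : HasDerivAt (fun t : ℝ => Ψ.chart x + t • w) w 0 := by
    simpa using ((hasDerivAt_id (0 : ℝ)).smul_const w).const_add (Ψ.chart x)
  have hin : ∀ᶠ t : ℝ in 𝓝 0, ‖Ψ.chart x + t • w‖ < 1 :=
    hline.continuousAt.norm.eventually_lt_const (by simpa using Ψ.norm_chart_lt hx)
  set γ : ℝ → M := fun t =>
    if ‖Ψ.chart x + t • w‖ < 1 then Ψ.chart.symm (Ψ.chart x + t • w) else x with hγ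
  have hγeq : γ =ᶠ[𝓝 0] fun t => Ψ.chart.symm (Ψ.chart x + t • w) := by
    filter_upwards [hin] with t ht
    simp only [hγ, if_pos ht]
  refine mem_imageTangent (γ := γ) (Ψ.mdifferentiableAt hx) ?_ (fun t => ?_) ?_ ?_
  · simpa [Ψ.chart.left_inv hx] using hγeq.self_of_nhds
  · simp only [hγ]
    split_ifs with ht
    · refine Ψ.symm_mem_limitSet hξ hσ ht ?_
      rw [map_add, map_smul, hx0, hw, smul_zero, add_zero]
    · rw [← Ψ.chart.left_inv hx]
      exact Ψ.symm_mem_limitSet hξ hσ (Ψ.norm_chart_lt hx) hx0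
  · refine MDifferentiableAt.congr_of_eventuallyEq ?_ hγeq
    have h1 : MDifferentiableAt 𝓘(ℝ, EuclideanSpace ℝ (Fin m)) (𝓡 m) Ψ.chart.symm
        (Ψ.chart x + (0 : ℝ) • w) :=
      Ψ.mdifferentiableAt_symm (by simpa using Ψ.norm_chart_lt hx)
    exact h1.comp (0 : ℝ) hline.differentiableAt.mdifferentiableAt
  · refine hline.congr_of_eventuallyEq ?_
    filter_upwards [hin, hγeq] with t ht hte
    rw [hte, Ψ.chart_symm ht]

/-- In an adapted chart the flow acts on tangent spaces of invariant sets by `e^{tA}`. -/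
theorem AdaptedChart.imageTangent_flow (Ψ : AdaptedChart f ξ q)
    (hξ : ContMDiff (𝓡 m) (𝓡 m).tangent 2 (fun x => (⟨x, ξ x⟩ : TangentBundle (𝓡 m) M)))
    {S : Set M} (hS : ∀ t, ∀ y ∈ S, flow ξ t y ∈ S) (hx : x ∈ Ψ.chart.source) {t : ℝ}
    (ht : ‖expFlow Ψ.rate t (Ψ.chart x)‖ < 1) :
    imageTangent m Ψ.chart S (flow ξ t x) =
      (imageTangent m Ψ.chart S x).map (expFlow Ψ.rate t).toLinearMap := by
  rw [← imageTangent_comp_flow hξ hS t (Ψ.mdifferentiableAt (Ψ.flow_mem hξ hx ht))]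
  refine imageTangent_comp_continuousLinearMap (Ψ.mdifferentiableAt hx) ?_
  have hc : ContinuousAt (fun y => ‖expFlow Ψ.rate t (Ψ.chart y)‖) x :=
    ((expFlow Ψ.rate t).continuous.continuousAt.comp (Ψ.continuousAt hx)).norm
  filter_upwards [Ψ.chart.open_source.mem_nhds hx, hc.eventually_lt_const ht] with y hy hyt
  exact Ψ.chart_flow hξ hy hyt

/-- If `W⁻_p` meets the local unstable manifold of `q`, then `p = q`. -/
theorem AdaptedChart.eq_of_mem_Wminus (Ψ : AdaptedChart f ξ q)
    (hξ : ContMDiff (𝓡 m) (𝓡 m).tangent 2 (fun x => (⟨x, ξ x⟩ : TangentBundle (𝓡 m) M)))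
    (hx : x ∈ Ψ.chart.source) (hx0 : expProj Ψ.rate (-1) (Ψ.chart x) = 0) (hxp : x ∈ Wminus ξ p) :
    p = q := by
  have h1 := Ψ.symm_mem_limitSet hξ (by norm_num) (Ψ.norm_chart_lt hx) hx0
  rw [Ψ.chart.left_inv hx, limitSet_neg_one] at h1
  exact tendsto_nhds_unique hxp h1

end LocalStructure

/-! ### Tangent spaces of unstable manifolds near a critical point -/

section Transversality

variable {E : Type*} [NormedAddCommGroup E] [InnerProductSpace ℝ E]

/-- Quantitative transversality: if `V` is transversal to a subspace of the kernel of the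
orthogonal projection `π`, then the projection to `V` is bounded below on the range of `π`. -/
theorem exists_pos_le_norm_starProjection [FiniteDimensional ℝ E] {π : E →L[ℝ] E}
    (hsymm : ∀ x y, inner ℝ (π x) y = inner ℝ x (π y)) {V W : Submodule ℝ E}
    (hW : ∀ w ∈ W, π w = 0) (hVW : V ⊔ W = ⊤) :
    ∃ b > 0, ∀ n, π n = n → b * ‖n‖ ≤ ‖V.starProjection n‖ := by
  let R : Submodule ℝ E := LinearMap.eqLocus π.toLinearMap LinearMap.id
  let L : R →ₗ[ℝ] E := V.starProjection.toLinearMap ∘ₗ R.subtype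
  have hL : LinearMap.ker L = ⊥ := by
    rw [LinearMap.ker_eq_bot']
    rintro ⟨n, hn⟩ hLn
    have hn' : π n = n := hn
    have h1 : V.starProjection n = 0 := hLn
    have h2 : n ∈ (V ⊔ W)ᗮ := by
      rw [← Submodule.inf_orthogonal]
      refine ⟨V.starProjection_apply_eq_zero_iff.1 h1, fun w hw => ?_⟩
      rw [← hn', ← hsymm, hW w hw, inner_zero_left]
    rw [hVW, Submodule.top_orthogonal_eq_bot, Submodule.mem_bot] at h2
    exact Subtype.ext h2
  obtain ⟨K, hK, hanti⟩ := L.exists_antilipschitzWith hL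
  refine ⟨(K : ℝ)⁻¹, by positivity, fun n hn => ?_⟩
  have h1 := hanti.le_mul_norm (map_zero L) ⟨n, hn⟩
  rw [inv_mul_le_iff₀ (by exact_mod_cast hK)]
  exact h1

end Transversality

section LocalEstimate

variable {m : ℕ} {M : Type*} [TopologicalSpace M] [ChartedSpace (EuclideanSpace ℝ (Fin m)) M]
  {f : M → ℝ} {ξ : (x : M) → TangentSpace (𝓡 m) x} {p q x : M}
  [IsManifold (𝓡 m) ω M] [CompactSpace M] [T2Space M]

/-- At a point of the local stable manifold of `q` the Morse–Smale condition, for the unstable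
manifold `W⁻_{p'}` through that point, and the gap estimate for `(W⁻_{p'}, W⁻_p)` show that `W⁻_p`
is uniformly transversal to the stable directions nearby. -/
theorem AdaptedChart.exists_eventually_le_norm_starProjection (h : IsMorsePair f ξ)
    (hMS : IsMorseSmale f ξ) (Ψ : AdaptedChart f ξ q) {α : ℝ} (hα : 0 < α)
    (hgap : ∀ p', IsCrit (m := m) f p' → f q < f p' → ∀ z ∈ Wminus ξ p',
      GapHolderAt m (Wminus ξ p') (Wminus ξ p) z α)
    {w : EuclideanSpace ℝ (Fin m)} (hw : w ∈ exitSphere Ψ.rate (-1)) :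
    ∃ c > 0, ∀ᶠ u in 𝓝 w, Ψ.chart.symm u ∈ Wminus ξ p →
      ∀ n, expProj Ψ.rate 1 n = n →
        c * ‖n‖ ≤ ‖(imageTangent m Ψ.chart (Wminus ξ p) (Ψ.chart.symm u)).starProjection n‖ := by
  have hξ := h.contMDiff_field
  have hw1 : ‖w‖ < 1 := by rw [hw.2]; norm_num
  have hw0 : w ≠ 0 := by
    rintro rfl
    have := hw.2
    norm_num at this
  have hwu : expProj Ψ.rate 1 w = 0 := by
    have := hw.1
    rwa [neg_neg] at this
  set y := Ψ.chart.symm w with hy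
  have hys : y ∈ Ψ.chart.source := Ψ.symm_mem hw1
  have hyw : Ψ.chart y = w := Ψ.chart_symm hw1
  have hyc : ¬ IsCrit (m := m) f y := Ψ.not_isCrit_symm h hw1 hw0
  have hyq : y ∈ limitSet ξ 1 q := Ψ.symm_mem_limitSet hξ one_ne_zero hw1 hwu
  obtain ⟨p', hp', hyp'⟩ := h.exists_mem_Wminus y
  have hlt : f q < f p' := by
    have h1 := h.lt_of_mem_limitSet one_ne_zero hyq hyc
    have h2 := h.le_of_mem_limitSet (σ := -1) (by norm_num) (limitSet_neg_one (ξ := ξ) ▸ hyp')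
    linarith
  have htop : imageTangent m Ψ.chart (Wminus ξ p') y ⊔
      imageTangent m Ψ.chart (limitSet ξ 1 q) y = ⊤ := by
    have htop' := hMS p' q hp' (Ψ.isCrit h) hlt y ⟨hyp', limitSet_one (ξ := ξ) ▸ hyq⟩
    rw [← limitSet_one] at htop'
    let L : EuclideanSpace ℝ (Fin m) →ₗ[ℝ] EuclideanSpace ℝ (Fin m) :=
      (mfderiv (𝓡 m) 𝓘(ℝ, EuclideanSpace ℝ (Fin m)) Ψ.chart y).toLinearMap
    have hsurj : Function.Surjective L :=
      LinearMap.injective_iff_surjective.1 (Ψ.mfderiv_injective hys)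
    refine (Submodule.map_sup _ _ _).symm.trans ((congrArg (Submodule.map L) htop').trans ?_)
    exact (Submodule.map_top L).trans (LinearMap.range_eq_top.2 hsurj)
  obtain ⟨b, hb, hbn⟩ := exists_pos_le_norm_starProjection (π := expProj Ψ.rate 1)
    inner_expProj
    (fun v hv => Ψ.expProj_eq_zero_of_mem_imageTangent h one_ne_zero hys (by rw [hyw, hwu]) hv) htop
  obtain ⟨U, hU, hyU, C, hC, hest⟩ := hgap p' hp' hlt y hyp' m Ψ.chart (Ψ.contMDiffAt hys)
    (Ψ.mfderiv_injective hys)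
  refine ⟨b / 2, by positivity, ?_⟩
  have hsmall : ∀ᶠ u in 𝓝 w, C * dist w u ^ α < b / 2 := by
    have h1 : ContinuousAt (fun u => C * dist w u ^ α) w :=
      continuousAt_const.mul ((continuousAt_const.dist continuousAt_id).rpow_const (Or.inr hα.le))
    exact h1.eventually_lt_const (by simp [Real.zero_rpow hα.ne', hb])
  filter_upwards [hsmall, (Ψ.continuousAt_symm hw1).eventually_mem (hU.mem_nhds hyU),
    Ψ.chart.open_target.mem_nhds (Ψ.mem_target_iff.2 hw1)] with u hu huU hut hup n hn
  have hu1 : ‖u‖ < 1 := Ψ.mem_target_iff.1 hut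
  have h1 := hest y ⟨hyU, hyp'⟩ _ ⟨huU, hup⟩
  rw [hyw, Ψ.chart_symm hu1] at h1
  have h2 : IsNear (imageTangent m Ψ.chart (Wminus ξ p') y)
    (imageTangent m Ψ.chart (Wminus ξ p) (Ψ.chart.symm u)) (C * dist w u ^ α) :=
    isNear_of_gap_le h1
  refine le_trans ?_ (h2.le_norm_starProjection (by positivity) (hbn n hn))
  gcongr
  linarith

/-- Transversality to the stable directions, uniformly near the exit sphere. -/
theorem AdaptedChart.exists_le_norm_starProjection (h : IsMorsePair f ξ)
    (hMS : IsMorseSmale f ξ) (Ψ : AdaptedChart f ξ q) {α : ℝ} (hα : 0 < α)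
    (hgap : ∀ p', IsCrit (m := m) f p' → f q < f p' → ∀ z ∈ Wminus ξ p',
      GapHolderAt m (Wminus ξ p') (Wminus ξ p) z α) :
    ∃ ρ > 0, ∃ c > 0, ∀ u, ∀ w ∈ exitSphere Ψ.rate (-1), dist u w < ρ →
      Ψ.chart.symm u ∈ Wminus ξ p → ∀ n, expProj Ψ.rate 1 n = n →
        c * ‖n‖ ≤ ‖(imageTangent m Ψ.chart (Wminus ξ p) (Ψ.chart.symm u)).starProjection n‖ := by
  have key : ∃ c > 0, ∀ᶠ u in 𝓝ˢ (exitSphere Ψ.rate (-1)), Ψ.chart.symm u ∈ Wminus ξ p →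
      ∀ n, expProj Ψ.rate 1 n = n →
        c * ‖n‖ ≤ ‖(imageTangent m Ψ.chart (Wminus ξ p) (Ψ.chart.symm u)).starProjection n‖ := by
    refine isCompact_exitSphere.induction_on (p := fun s => ∃ c > 0, ∀ᶠ u in 𝓝ˢ s,
      Ψ.chart.symm u ∈ Wminus ξ p → ∀ n, expProj Ψ.rate 1 n = n →
        c * ‖n‖ ≤ ‖(imageTangent m Ψ.chart (Wminus ξ p) (Ψ.chart.symm u)).starProjection n‖)
      ⟨1, one_pos, by simp⟩ ?_ ?_ ?_
    · rintro s t hst ⟨c, hc, hev⟩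
      exact ⟨c, hc, hev.filter_mono (nhdsSet_mono hst)⟩
    · rintro s t ⟨c, hc, hev⟩ ⟨c', hc', hev'⟩
      refine ⟨min c c', lt_min hc hc', ?_⟩
      rw [nhdsSet_union, eventually_sup]
      constructor
      · filter_upwards [hev] with u hu hup n hn
        exact le_trans (by gcongr; exact min_le_left _ _) (hu hup n hn)
      · filter_upwards [hev'] with u hu hup n hn
        exact le_trans (by gcongr; exact min_le_right _ _) (hu hup n hn)
    · intro w hw
      obtain ⟨c, hc, hev⟩ := Ψ.exists_eventually_le_norm_starProjection h hMS hα hgap hw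
      obtain ⟨t, ht, hto, hwt⟩ := eventually_nhds_iff.1 hev
      exact ⟨t, mem_nhdsWithin_of_mem_nhds (hto.mem_nhds hwt), c, hc,
        eventually_nhdsSet_iff_forall.2 fun x hx => mem_of_superset (hto.mem_nhds hx) ht⟩
  obtain ⟨c, hc, hev⟩ := key
  obtain ⟨O, hO, hKO, hOsub⟩ := mem_nhdsSet_iff_exists.1 hev
  obtain ⟨ρ, hρ, hρO⟩ := isCompact_exitSphere.exists_thickening_subset_open hO hKO
  exact ⟨ρ, hρ, c, hc, fun u w hw huw =>
    hOsub (hρO (Metric.mem_thickening_iff.2 ⟨w, hw, huw⟩))⟩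

end LocalEstimate

section NearUnstable

variable {m : ℕ} {M : Type*} [TopologicalSpace M] [ChartedSpace (EuclideanSpace ℝ (Fin m)) M]
  {f : M → ℝ} {ξ : (x : M) → TangentSpace (𝓡 m) x} {p q x : M}

namespace AdaptedChart

variable (Ψ : AdaptedChart f ξ q)

theorem rate_neg_iff (i : Fin m) : Ψ.rate i < 0 ↔ morseIndex (m := m) f q ≤ (i : ℕ) := by
  rw [← not_lt, ← Ψ.rate_pos_iff, not_lt]
  exact ⟨le_of_lt, fun h => lt_of_le_of_ne h (Ψ.rate_ne_zero i)⟩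

theorem gammaU_le {i : Fin m} (hi : 0 < Ψ.rate i) : Ψ.gammaU ≤ Ψ.rate i := by
  have hi' := (Ψ.rate_pos_iff i).1 hi
  rw [show Ψ.rate i = Ψ.μ i from if_pos hi']
  exact csInf_le (Set.toFinite _).bddBelow (mem_image_of_mem _ hi')

theorem gammaS_le {i : Fin m} (hi : Ψ.rate i < 0) : Ψ.gammaS ≤ -Ψ.rate i := by
  have hi' := (Ψ.rate_neg_iff i).1 hi
  rw [show Ψ.rate i = -Ψ.μ i from if_neg hi'.not_gt, neg_neg]
  exact csInf_le (Set.toFinite _).bddBelow (mem_image_of_mem _ hi')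

theorem le_bigGammaS {i : Fin m} (hi : Ψ.rate i < 0) : -Ψ.rate i ≤ Ψ.bigGammaS := by
  have hi' := (Ψ.rate_neg_iff i).1 hi
  rw [show Ψ.rate i = -Ψ.μ i from if_neg hi'.not_gt, neg_neg]
  exact le_csSup (Set.toFinite _).bddAbove (mem_image_of_mem _ hi')

/-- The unstable subspace of the linear vector field in an adapted chart. -/
noncomputable def unstableSpace : Submodule ℝ (EuclideanSpace ℝ (Fin m)) :=
  LinearMap.ker (expProj Ψ.rate (-1)).toLinearMap

variable {Ψ} in
theorem mem_unstableSpace {u : EuclideanSpace ℝ (Fin m)} :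
    u ∈ Ψ.unstableSpace ↔ expProj Ψ.rate (-1) u = 0 := Iff.rfl

theorem mem_unstableSpace_iff_apply {u : EuclideanSpace ℝ (Fin m)} :
    u ∈ Ψ.unstableSpace ↔ ∀ i : Fin m, morseIndex (m := m) f q ≤ (i : ℕ) → u i = 0 := by
  rw [mem_unstableSpace]
  constructor
  · intro h i hi
    have h1 := congrArg (fun w : EuclideanSpace ℝ (Fin m) => w i) h
    simpa [(Ψ.rate_neg_iff i).2 hi] using h1
  · intro h
    ext i
    rcases lt_or_ge (i : ℕ) (morseIndex (m := m) f q) with hi | hi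
    · simp [((Ψ.rate_pos_iff i).2 hi).not_gt]
    · simp [h i hi]

variable [IsManifold (𝓡 m) ω M] [CompactSpace M] [T2Space M]

/-- Near `q` the tangent space of `W⁻_p` at `y` contains an almost horizontal copy of the unstable
space. Flow `y` backwards during a time `T` to the exit sphere, where `W⁻_p` is uniformly
transversal to the stable directions, and flow back: the slope is contracted by
`e^{-(γ_u + γ_s) T}`, while the stable coordinate of `y` is at least `e^{-Γ_s T} / 2`. -/
theorem exists_isNear (h : IsMorsePair f ξ) (hMS : IsMorseSmale f ξ) (Ψ : AdaptedChart f ξ q)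
    {α : ℝ} (hα : 0 < α)
    (hgap : ∀ p', IsCrit (m := m) f p' → f q < f p' → ∀ z ∈ Wminus ξ p',
      GapHolderAt m (Wminus ξ p') (Wminus ξ p) z α)
    {ν : ℝ} (hν : 0 < ν)
    (hratio : 0 < morseIndex (m := m) f q → morseIndex (m := m) f q < m →
      ν ≤ (Ψ.gammaU + Ψ.gammaS) / Ψ.bigGammaS) :
    ∃ r > 0, ∃ C ≥ 0, ∀ y ∈ Ψ.chart.source, ‖Ψ.chart y‖ < r → y ∈ Wminus ξ p →
      IsNear Ψ.unstableSpace (imageTangent m Ψ.chart (Wminus ξ p) y)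
        (C * ‖expProj Ψ.rate (-1) (Ψ.chart y)‖ ^ ν) := by
  have hξ := h.contMDiff_field
  obtain ⟨ρ, hρ, c, hc, htrans⟩ := Ψ.exists_le_norm_starProjection (p := p) h hMS hα hgap
  refine ⟨min ρ (1 / 2), lt_min hρ (by norm_num), c⁻¹ * 2 ^ ν, by positivity,
    fun y hy hyr hyp => ?_⟩
  have ha := Ψ.rate_ne_zero
  by_cases hys : expProj Ψ.rate (-1) (Ψ.chart y) = 0
  -- a point without stable coordinate lies in `W⁻_q`, whose tangent space is the unstable space
  · obtain rfl := Ψ.eq_of_mem_Wminus hξ hy hys hyp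
    refine isNear_of_le (fun u hu => ?_) (by positivity)
    have h1 := Ψ.mem_imageTangent_of_expProj_eq_zero hξ (by norm_num) hy hys hu
    rwa [limitSet_neg_one] at h1
  obtain ⟨T, hT, hT1, hThalf, w, hw, hdist⟩ := exists_exitSphere_dist_le ha (by norm_num)
    (hyr.trans_le (min_le_right _ _)) hys
  rw [neg_one_mul] at hT1 hThalf hdist
  have hy' : flow ξ (-T) y ∈ Ψ.chart.source := Ψ.flow_mem hξ hy hT1
  have hy'p : flow ξ (-T) y ∈ Wminus ξ p := flow_mem_Wminus hξ (-T) hyp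
  have htr := htrans _ w hw (hdist.trans_lt (hyr.trans_le (min_le_left _ _)))
  rw [← Ψ.flow_eq hξ hy hT1] at htr
  have htr := htr hy'p
  have hEy : expFlow Ψ.rate T (Ψ.chart (flow ξ (-T) y)) = Ψ.chart y := by
    rw [Ψ.chart_flow hξ hy hT1, ← expFlow_add, add_neg_cancel, expFlow_zero]
  have hback : imageTangent m Ψ.chart (Wminus ξ p) y =
      (imageTangent m Ψ.chart (Wminus ξ p) (flow ξ (-T) y)).map
        (expFlow Ψ.rate T).toLinearMap := by
    rw [← Ψ.imageTangent_flow hξ (fun t y hy => flow_mem_Wminus hξ t hy) hy'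
      (by rw [hEy]; exact Ψ.norm_chart_lt hy), flow_flow_neg hξ]
  intro u hu
  have hu0 : expProj Ψ.rate (-1) u = 0 := hu
  -- the exponents can be compared only if there are stable and unstable directions
  by_cases hsaddle : 0 < morseIndex (m := m) f q ∧ morseIndex (m := m) f q < m
  swap
  · have hu' : u = 0 := by
      ext i
      refine Ψ.mem_unstableSpace_iff_apply.1 hu i ?_
      by_contra hi
      refine hsaddle ⟨by omega, ?_⟩
      by_contra hm
      refine hys ?_
      ext j
      have hj : ¬ Ψ.rate j < 0 := by
        rw [Ψ.rate_neg_iff]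
        have := j.2
        omega
      simp [hj]
    exact ⟨0, Submodule.zero_mem _, by simp [hu']⟩
  have hΓ : 0 < Ψ.bigGammaS := by
    have hneg : Ψ.rate ⟨_, hsaddle.2⟩ < 0 := (Ψ.rate_neg_iff ⟨_, hsaddle.2⟩).2 le_rfl
    linarith [Ψ.le_bigGammaS hneg]
  have hνΓ : ν * Ψ.bigGammaS ≤ Ψ.gammaU + Ψ.gammaS :=
    (le_div_iff₀ hΓ).1 (hratio hsaddle.1 hsaddle.2)
  have hproj : ∀ v, expProj Ψ.rate (-1) v = 0 → expProj Ψ.rate 1 v = v := fun v hv => by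
    have := expProj_add_expProj_neg (u := v) ha one_ne_zero
    rwa [hv, add_zero] at this
  set v := expFlow Ψ.rate (-T) u with hv
  have hv0 : expProj Ψ.rate (-1) v = 0 := by rw [hv, expProj_expFlow, hu0, map_zero]
  have hvnorm : ‖v‖ ≤ Real.exp (-(Ψ.gammaU * T)) * ‖u‖ := by
    have h1 := norm_expFlow_contract_le hT hu0 ha (by norm_num) (γ := Ψ.gammaU) fun i hi => by
      have := Ψ.gammaU_le (i := i) (by linarith)
      linarith
    rwa [neg_one_mul] at h1
  obtain ⟨v', hv', hπv', hv'norm⟩ := exists_mem_map_eq (π := expProj Ψ.rate 1) inner_expProj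
    (fun _ => expProj_expProj) hc htr (hproj v hv0)
  refine ⟨expFlow Ψ.rate T v', hback ▸ Submodule.mem_map_of_mem hv', ?_⟩
  have hdiff : u - expFlow Ψ.rate T v' = -expFlow Ψ.rate T (expProj Ψ.rate (-1) v') := by
    have h1 := expProj_add_expProj_neg (u := v') ha one_ne_zero
    rw [hπv'] at h1
    have h2 : expFlow Ψ.rate T v = u := by
      rw [hv, ← expFlow_add, add_neg_cancel, expFlow_zero]
    have h3 := congrArg (expFlow Ψ.rate T) h1
    rw [map_add, h2] at h3
    rw [← h3]
    abel
  have hs : ‖expFlow Ψ.rate T (expProj Ψ.rate (-1) v')‖ ≤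
      Real.exp (-(Ψ.gammaS * T)) * ‖expProj Ψ.rate (-1) v'‖ := by
    have h1 := norm_expFlow_contract_le hT (expProj_neg_expProj (a := Ψ.rate) (σ := -1) (u := v'))
      ha (by norm_num) (γ := Ψ.gammaS) fun i hi => by
        have := Ψ.gammaS_le (i := i) (by linarith)
        linarith
    rwa [neg_neg, one_mul] at h1
  have hlow : Real.exp (-(Ψ.bigGammaS * T)) ≤ 2 * ‖expProj Ψ.rate (-1) (Ψ.chart y)‖ := by
    have h1 : ‖expProj Ψ.rate (-1) (expFlow Ψ.rate (-T) (Ψ.chart y))‖ ≤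
        Real.exp (Ψ.bigGammaS * T) * ‖expProj Ψ.rate (-1) (Ψ.chart y)‖ := by
      rw [expProj_expFlow]
      refine norm_diag_le (Real.exp_pos _).le fun i hi => ?_
      have h2 := expProj_apply_ne_zero hi
      rw [abs_of_pos (Real.exp_pos _), Real.exp_le_exp]
      nlinarith [Ψ.le_bigGammaS (i := i) (by linarith)]
    rw [hThalf] at h1
    rw [Real.exp_neg, inv_le_iff_one_le_mul₀ (Real.exp_pos _)]
    linarith
  have hexp : Real.exp (-((Ψ.gammaU + Ψ.gammaS) * T)) ≤
      2 ^ ν * ‖expProj Ψ.rate (-1) (Ψ.chart y)‖ ^ ν := by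
    rw [← Real.mul_rpow zero_le_two (norm_nonneg _)]
    refine le_trans ?_ (Real.rpow_le_rpow (Real.exp_pos _).le hlow hν.le)
    rw [← Real.exp_mul, Real.exp_le_exp]
    nlinarith
  calc ‖u - expFlow Ψ.rate T v'‖
      = ‖expFlow Ψ.rate T (expProj Ψ.rate (-1) v')‖ := by rw [hdiff, norm_neg]
    _ ≤ Real.exp (-(Ψ.gammaS * T)) * (c⁻¹ * (Real.exp (-(Ψ.gammaU * T)) * ‖u‖)) := by
        refine hs.trans ?_
        gcongr
        exact norm_expProj_le.trans (hv'norm.trans (by gcongr))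
    _ = c⁻¹ * Real.exp (-((Ψ.gammaU + Ψ.gammaS) * T)) * ‖u‖ := by
        rw [show -((Ψ.gammaU + Ψ.gammaS) * T) = -(Ψ.gammaS * T) + -(Ψ.gammaU * T) by ring,
          Real.exp_add]
        ring
    _ ≤ c⁻¹ * 2 ^ ν * ‖expProj Ψ.rate (-1) (Ψ.chart y)‖ ^ ν * ‖u‖ := by
        rw [mul_assoc c⁻¹ (2 ^ ν)]
        gcongr

end AdaptedChart

end NearUnstable

/-! ### The gap estimates -/

theorem IsNear.map {E F : Type*} [NormedAddCommGroup E] [InnerProductSpace ℝ E]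
    [NormedAddCommGroup F] [InnerProductSpace ℝ F] {U V : Submodule ℝ E} {c : ℝ}
    (h : IsNear U V c) (hc : 0 ≤ c) {A : E →L[ℝ] F} {B : F →L[ℝ] E} (hBA : ∀ u, B (A u) = u) :
    IsNear (U.map A.toLinearMap) (V.map A.toLinearMap) (‖A‖ * c * ‖B‖) := by
  rintro _ ⟨u, hu, rfl⟩
  obtain ⟨v, hv, huv⟩ := h u hu
  refine ⟨A v, Submodule.mem_map_of_mem hv, ?_⟩
  change ‖A u - A v‖ ≤ _ * ‖A u‖
  calc ‖A u - A v‖ ≤ ‖A‖ * (c * ‖u‖) := by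
        rw [← map_sub]
        exact (A.le_opNorm _).trans (by gcongr)
    _ ≤ ‖A‖ * (c * (‖B‖ * ‖A u‖)) := by
        gcongr
        simpa only [hBA] using B.le_opNorm (A u)
    _ = ‖A‖ * c * ‖B‖ * ‖A u‖ := by ring

section Estimate

variable {m : ℕ} {M : Type*} [TopologicalSpace M] [ChartedSpace (EuclideanSpace ℝ (Fin m)) M]
  {f : M → ℝ} {ξ : (x : M) → TangentSpace (𝓡 m) x} {p q z : M}

theorem tendsto_flow_neg_of_mem_Wminus (hz : z ∈ Wminus ξ q) :
    Tendsto (fun t => flow ξ (-t) z) atTop (𝓝 q) :=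
  Tendsto.comp (g := fun t => flow ξ t z) hz tendsto_neg_atTop_atBot

theorem AdaptedChart.eventually_flow_neg_mem (Ψ : AdaptedChart f ξ q) (hz : z ∈ Wminus ξ q) :
    ∀ᶠ t in atTop, flow ξ (-t) z ∈ Ψ.chart.source :=
  (tendsto_flow_neg_of_mem_Wminus hz).eventually_mem (Ψ.chart.open_source.mem_nhds Ψ.mem_source)

theorem AdaptedChart.eventually_norm_chart_flow_neg_lt (Ψ : AdaptedChart f ξ q)
    (hz : z ∈ Wminus ξ q) {r : ℝ} (hr : 0 < r) :
    ∀ᶠ t in atTop, ‖Ψ.chart (flow ξ (-t) z)‖ < r := by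
  have h1 := ((Ψ.continuousAt Ψ.mem_source).tendsto.comp (tendsto_flow_neg_of_mem_Wminus hz)).norm
  rw [Ψ.map_center, norm_zero] at h1
  exact h1.eventually_lt_const hr

variable [IsManifold (𝓡 m) ω M] [CompactSpace M] [T2Space M]

/-- The points which are carried by `Φ_{-s}` into a small ball around the critical point, and stay
in the adapted chart when they flow on for the time `τ`, form an open set. -/
theorem AdaptedChart.isOpen_flow_preimage (Ψ : AdaptedChart f ξ q)
    (hξ : ContMDiff (𝓡 m) (𝓡 m).tangent 2 (fun x => (⟨x, ξ x⟩ : TangentBundle (𝓡 m) M)))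
    (s τ r : ℝ) : IsOpen {x | flow ξ (-s) x ∈ Ψ.chart.source ∧ ‖Ψ.chart (flow ξ (-s) x)‖ < r ∧
      ‖expFlow Ψ.rate τ (Ψ.chart (flow ξ (-s) x))‖ < 1} := by
  have h1 : IsOpen (Ψ.chart.source ∩ Ψ.chart ⁻¹' {u | ‖u‖ < r ∧ ‖expFlow Ψ.rate τ u‖ < 1}) :=
    Ψ.chart.isOpen_inter_preimage ((isOpen_lt continuous_norm continuous_const).inter
      (isOpen_lt (expFlow Ψ.rate τ).continuous.norm continuous_const))
  exact h1.preimage (contMDiff_flow hξ (-s)).continuous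

/-- The gap estimate in adapted coordinates carried along by the flow, granted the slope estimate
near the critical point. -/
theorem AdaptedChart.gapEstimateAt (h : IsMorsePair f ξ) (Ψ : AdaptedChart f ξ q) {ν : ℝ}
    (hν : 0 < ν)
    (hnear : ∃ r > 0, ∃ C ≥ 0, ∀ y ∈ Ψ.chart.source, ‖Ψ.chart y‖ < r → y ∈ Wminus ξ p →
      IsNear Ψ.unstableSpace (imageTangent m Ψ.chart (Wminus ξ p) y)
        (C * ‖expProj Ψ.rate (-1) (Ψ.chart y)‖ ^ ν))
    (hz : z ∈ Wminus ξ q) {t : ℝ} (ht : ∀ s, t ≤ s → flow ξ (-s) z ∈ Ψ.chart.source) :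
    GapEstimateAt m (fun x => Ψ.chart (flow ξ (-t) x)) (Wminus ξ q) (Wminus ξ p) z ν := by
  have hξ := h.contMDiff_field
  obtain ⟨r₁, hr₁, C, hC, hnear⟩ := hnear
  obtain ⟨r₂, hr₂, hflat⟩ := Ψ.exists_expProj_eq_zero h (σ := -1) (by norm_num)
  obtain ⟨s, hst, hs⟩ := ((eventually_ge_atTop t).and
    (Ψ.eventually_norm_chart_flow_neg_lt hz (lt_min hr₁ hr₂))).exists
  set τ := s - t with hτ
  set A := expFlow Ψ.rate τ with hA
  set B := expFlow Ψ.rate (-τ) with hB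
  have hBA : ∀ u, B (A u) = u := fun u => expFlow_neg_expFlow τ
  have hsplit : ∀ x, flow ξ (-t) x = flow ξ τ (flow ξ (-s) x) := fun x => by
    rw [← flow_add hξ]
    congr 1
    rw [hτ]
    ring
  have hzU : ‖A (Ψ.chart (flow ξ (-s) z))‖ < 1 := by
    have h1 := Ψ.chart_flow_of_forall_mem hξ (x := flow ξ (-s) z) (sub_nonneg.2 hst)
      fun τ' hτ' => by
        rw [← flow_add hξ, show τ' + -s = -(s - τ') by ring]
        exact ht _ (by linarith [hτ'.2])
    rw [hA, hτ, ← h1, ← hτ, ← hsplit]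
    exact Ψ.norm_chart_lt (ht t le_rfl)
  refine ⟨_, Ψ.isOpen_flow_preimage hξ s τ (min r₁ r₂), ⟨ht s hst, hs, hzU⟩,
    ‖A‖ * (C * ‖B‖ ^ ν) * ‖B‖ + 1, by positivity, ?_⟩
  rintro x ⟨⟨hx, hxr, hxA⟩, hxq⟩ y ⟨⟨hy, hyr, hyA⟩, hyp⟩
  change gap (imageTangent m (fun x => Ψ.chart (flow ξ (-t) x)) (Wminus ξ q) x)
    (imageTangent m (fun x => Ψ.chart (flow ξ (-t) x)) (Wminus ξ p) y) ≤ _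
  have htan : ∀ {w p' : M}, flow ξ (-s) w ∈ Ψ.chart.source →
      ‖A (Ψ.chart (flow ξ (-s) w))‖ < 1 →
      imageTangent m (fun x => Ψ.chart (flow ξ (-t) x)) (Wminus ξ p') w =
        (imageTangent m Ψ.chart (Wminus ξ p') (flow ξ (-s) w)).map A.toLinearMap ∧
      Ψ.chart (flow ξ (-t) w) = A (Ψ.chart (flow ξ (-s) w)) := by
    intro w p' hw hwA
    have hinv : ∀ t, ∀ y ∈ Wminus ξ p', flow ξ t y ∈ Wminus ξ p' := fun t y hy =>
      flow_mem_Wminus hξ t hy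
    have h1 : MDifferentiableAt (𝓡 m) 𝓘(ℝ, EuclideanSpace ℝ (Fin m)) Ψ.chart
        (flow ξ (-t) w) := by
      rw [hsplit]
      exact Ψ.mdifferentiableAt (Ψ.flow_mem hξ hw hwA)
    rw [imageTangent_comp_flow hξ hinv (-t) h1, hsplit, Ψ.imageTangent_flow hξ hinv hw hwA,
      Ψ.chart_flow hξ hw hwA]
    exact ⟨rfl, rfl⟩
  obtain ⟨htx, hcx⟩ := htan (p' := q) hx hxA
  obtain ⟨hty, hcy⟩ := htan (p' := p) hy hyA
  rw [htx, hty]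
  set x' := flow ξ (-s) x
  set y' := flow ξ (-s) y
  have hx' : x' ∈ limitSet ξ (-1) q := by
    rw [limitSet_neg_one]
    exact flow_mem_Wminus hξ (-s) hxq
  have hx'0 := hflat x' hx (hxr.trans_le (min_le_right _ _)) hx'
  have hle : imageTangent m Ψ.chart (Wminus ξ q) x' ≤ Ψ.unstableSpace := fun w hw =>
    Ψ.expProj_eq_zero_of_mem_imageTangent h (by norm_num) hx hx'0 (by rwa [limitSet_neg_one])
  have hN := (((hnear y' hy (hyr.trans_le (min_le_left _ _))
    (flow_mem_Wminus hξ (-s) hyp)).mono hle le_rfl).map (by positivity) hBA)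
  refine (hN.gap_le (by positivity)).trans ?_
  -- the stable coordinate of `y'` is bounded by the distance in the carried coordinates
  have hdist : ‖expProj Ψ.rate (-1) (Ψ.chart y')‖ ≤
      ‖B‖ * dist (Ψ.chart (flow ξ (-t) x)) (Ψ.chart (flow ξ (-t) y)) := by
    have h1 : expProj Ψ.rate (-1) (Ψ.chart y') =
        B (expProj Ψ.rate (-1) (A (Ψ.chart y') - A (Ψ.chart x'))) := by
      rw [← map_sub, hA, expProj_expFlow, ← hA, hBA, map_sub, hx'0, sub_zero]
    rw [h1, hcx, hcy, dist_comm, dist_eq_norm]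
    exact (B.le_opNorm _).trans (by gcongr; exact norm_expProj_le)
  calc ‖A‖ * (C * ‖expProj Ψ.rate (-1) (Ψ.chart y')‖ ^ ν) * ‖B‖
      ≤ ‖A‖ * (C * (‖B‖ ^ ν * dist (Ψ.chart (flow ξ (-t) x)) (Ψ.chart (flow ξ (-t) y)) ^ ν)) *
          ‖B‖ := by
        rw [← Real.mul_rpow (norm_nonneg _) dist_nonneg]
        gcongr
    _ ≤ (‖A‖ * (C * ‖B‖ ^ ν) * ‖B‖ + 1) *
          dist (Ψ.chart (flow ξ (-t) x)) (Ψ.chart (flow ξ (-t) y)) ^ ν := by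
        have : 0 ≤ dist (Ψ.chart (flow ξ (-t) x)) (Ψ.chart (flow ξ (-t) y)) ^ ν := by positivity
        nlinarith

/-- The flow as a homeomorphism. -/
noncomputable def flowHomeomorph
    (hξ : ContMDiff (𝓡 m) (𝓡 m).tangent 2 (fun x => (⟨x, ξ x⟩ : TangentBundle (𝓡 m) M)))
    (t : ℝ) : M ≃ₜ M where
  toFun := flow ξ t
  invFun := flow ξ (-t)
  left_inv := flow_neg_flow hξ t
  right_inv := flow_flow_neg hξ t
  continuous_toFun := (contMDiff_flow hξ t).continuous
  continuous_invFun := (contMDiff_flow hξ (-t)).continuous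

theorem AdaptedChart.gapHolderAt (h : IsMorsePair f ξ) (Ψ : AdaptedChart f ξ q) {ν : ℝ}
    (hν : 0 < ν)
    (hnear : ∃ r > 0, ∃ C ≥ 0, ∀ y ∈ Ψ.chart.source, ‖Ψ.chart y‖ < r → y ∈ Wminus ξ p →
      IsNear Ψ.unstableSpace (imageTangent m Ψ.chart (Wminus ξ p) y)
        (C * ‖expProj Ψ.rate (-1) (Ψ.chart y)‖ ^ ν))
    (hz : z ∈ Wminus ξ q) : GapHolderAt m (Wminus ξ q) (Wminus ξ p) z (min ν 1) := by
  have hξ := h.contMDiff_field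
  obtain ⟨t, ht⟩ := eventually_atTop.1 (Ψ.eventually_flow_neg_mem hz)
  let ψ := (flowHomeomorph hξ (-t)).transOpenPartialHomeomorph Ψ.chart
  refine GapEstimateAt.gapHolderAt (ψ := ψ) hν (ht t le_rfl) ?_ ?_
    (Ψ.gapEstimateAt h hν hnear hz ht)
  · exact Ψ.contMDiffOn.comp (contMDiff_flow hξ (-t)).contMDiffOn fun x hx => hx
  · exact (contMDiff_flow hξ (- -t)).comp_contMDiffOn Ψ.contMDiffOn_symm

/-- The slope estimate near each critical point, for a pair satisfying the spectral condition. The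
proof is by induction along the decreasing values of `f`: the slope estimate at `q` depends on the
gap estimates at the critical points above `q`. -/
theorem IsMorsePair.exists_isNear (h : IsMorsePair f ξ) (hMS : IsMorseSmale f ξ) {ν : ℝ}
    (hν : 0 < ν) (hratio : ∀ r ∈ spectralRatios f ξ, ν ≤ r) (p : M) :
    ∀ (q : M) (Ψ : AdaptedChart f ξ q), ∃ r > 0, ∃ C ≥ 0,
      ∀ y ∈ Ψ.chart.source, ‖Ψ.chart y‖ < r → y ∈ Wminus ξ p →
        IsNear Ψ.unstableSpace (imageTangent m Ψ.chart (Wminus ξ p) y)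
          (C * ‖expProj Ψ.rate (-1) (Ψ.chart y)‖ ^ ν) := by
  have hwf : ∀ (n : ℕ) (q : M), {p | IsCrit (m := m) f p ∧ f q < f p}.ncard = n →
      ∀ Ψ : AdaptedChart f ξ q, ∃ r > 0, ∃ C ≥ 0,
        ∀ y ∈ Ψ.chart.source, ‖Ψ.chart y‖ < r → y ∈ Wminus ξ p →
          IsNear Ψ.unstableSpace (imageTangent m Ψ.chart (Wminus ξ p) y)
            (C * ‖expProj Ψ.rate (-1) (Ψ.chart y)‖ ^ ν) := by
    -- strong induction on the number of critical points above `q`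
    intro n
    induction n using Nat.strong_induction_on with
    | _ n ih =>
      intro q hq Ψ
      refine Ψ.exists_isNear h hMS (lt_min hν one_pos) (fun p' hp' hlt z hz => ?_) hν
        fun h0 hm => hratio _ ⟨q, Ψ.isCrit h, h0, hm, Ψ, rfl⟩
      obtain ⟨Ψ'⟩ := h.adapted p' hp'
      refine Ψ'.gapHolderAt h hν (ih _ ?_ p' rfl Ψ') hz
      rw [← hq]
      refine Set.ncard_lt_ncard ?_ (h.finite_crit.subset fun x hx => hx.1)
      exact ⟨fun x hx => ⟨hx.1, hlt.trans hx.2⟩, fun hsub => lt_irrefl _ (hsub ⟨hp', hlt⟩).2⟩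
  exact fun q => hwf _ q rfl

end Estimate

/-! ### The frontier property -/

section Frontier

variable {m : ℕ} {M : Type*} [TopologicalSpace M] [ChartedSpace (EuclideanSpace ℝ (Fin m)) M]
  {f : M → ℝ} {ξ : (x : M) → TangentSpace (𝓡 m) x} {p q x z : M}

theorem morseIndex_le : morseIndex (m := m) f p ≤ m := by
  refine csSup_le' ?_
  rintro d ⟨V, rfl, -⟩
  simpa using V.finrank_le

/-- The unstable spaces are coordinate subspaces, so they can be compared by their dimension even
at different critical points. -/
theorem AdaptedChart.morseIndex_le_of_finrank_le (Ψ : AdaptedChart f ξ q) (Ψ' : AdaptedChart f ξ p)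
    (h : Module.finrank ℝ Ψ.unstableSpace ≤ Module.finrank ℝ Ψ'.unstableSpace) :
    morseIndex (m := m) f q ≤ morseIndex (m := m) f p := by
  by_contra! hlt
  have hm : morseIndex (m := m) f p < m := hlt.trans_le morseIndex_le
  refine (Submodule.finrank_lt_finrank_of_lt (SetLike.lt_iff_le_and_exists.2 ⟨fun u hu => ?_,
    EuclideanSpace.single ⟨_, hm⟩ 1, ?_, fun hcon => ?_⟩)).not_ge h
  · rw [mem_unstableSpace_iff_apply] at hu ⊢
    exact fun i hi => hu i (hlt.le.trans hi)
  · rw [mem_unstableSpace_iff_apply]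
    intro i hi
    have : i ≠ ⟨_, hm⟩ := fun h => by
      rw [h] at hi
      exact hi.not_gt hlt
    simp [this]
  · rw [mem_unstableSpace_iff_apply] at hcon
    simpa using hcon ⟨_, hm⟩ le_rfl

variable [IsManifold (𝓡 m) ω M] [CompactSpace M] [T2Space M]

/-- The dimension of `W⁻_p` at any of its points is at most that of the unstable space at `p`. -/
theorem AdaptedChart.finrank_imageTangent_le (h : IsMorsePair f ξ) (Ψ : AdaptedChart f ξ p)
    {N : ℕ} (φ : M → EuclideanSpace ℝ (Fin N)) (hx : x ∈ Wminus ξ p) :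
    Module.finrank ℝ (imageTangent m φ (Wminus ξ p) x) ≤ Module.finrank ℝ Ψ.unstableSpace := by
  have hξ := h.contMDiff_field
  obtain ⟨r, hr, hflat⟩ := Ψ.exists_expProj_eq_zero h (σ := -1) (by norm_num)
  obtain ⟨t, hts, htr⟩ := ((Ψ.eventually_flow_neg_mem hx).and
    (Ψ.eventually_norm_chart_flow_neg_lt hx hr)).exists
  have hx' : flow ξ (-t) x ∈ limitSet ξ (-1) p := by
    rw [limitSet_neg_one]
    exact flow_mem_Wminus hξ (-t) hx
  have hle : imageTangent m Ψ.chart (Wminus ξ p) (flow ξ (-t) x) ≤ Ψ.unstableSpace := fun w hw =>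
    Ψ.expProj_eq_zero_of_mem_imageTangent h (by norm_num) hts (hflat _ hts htr hx')
      (by rwa [limitSet_neg_one])
  have hinj : Function.Injective (mfderiv (𝓡 m) 𝓘(ℝ, EuclideanSpace ℝ (Fin m))
      (fun y => Ψ.chart (flow ξ (-t) y)) x) := by
    have h1 := HasMFDerivAt.comp x (Ψ.mdifferentiableAt hts).hasMFDerivAt
      (mdifferentiable_flow hξ (-t) x).hasMFDerivAt
    have h2 : mfderiv (𝓡 m) 𝓘(ℝ, EuclideanSpace ℝ (Fin m)) (fun y => Ψ.chart (flow ξ (-t) y)) x =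
      _ := h1.mfderiv
    rw [h2]
    refine (Ψ.mfderiv_injective hts).comp ?_
    have h3 := HasMFDerivAt.comp x (mdifferentiable_flow hξ t (flow ξ (-t) x)).hasMFDerivAt
      (mdifferentiable_flow hξ (-t) x).hasMFDerivAt
    have h4 := hasMFDerivAt_unique h3 ((hasMFDerivAt_id x).congr_of_eventuallyEq
      (Eventually.of_forall fun y => flow_flow_neg hξ t y))
    exact Function.LeftInverse.injective (g := mfderiv (𝓡 m) (𝓡 m) (flow ξ t) (flow ξ (-t) x))
      fun v => DFunLike.congr_fun h4 v
  have : FiniteDimensional ℝ (TangentSpace (𝓡 m) x) :=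
    inferInstanceAs (FiniteDimensional ℝ (EuclideanSpace ℝ (Fin m)))
  calc Module.finrank ℝ (imageTangent m φ (Wminus ξ p) x)
      ≤ Module.finrank ℝ (tangentAt m (Wminus ξ p) x) := Submodule.finrank_map_le _ _
    _ = Module.finrank ℝ
          (imageTangent m (fun y => Ψ.chart (flow ξ (-t) y)) (Wminus ξ p) x) :=
        (Submodule.equivMapOfInjective _ hinj _).finrank_eq
    _ ≤ Module.finrank ℝ Ψ.unstableSpace := by
        rw [imageTangent_comp_flow hξ (fun t y hy => flow_mem_Wminus hξ t hy) (-t)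
          (Ψ.mdifferentiableAt hts)]
        exact Submodule.finrank_mono hle

/-- If the closure of `W⁻_p` meets `W⁻_q`, then the index of `q` is at most that of `p`. -/
theorem IsMorsePair.morseIndex_le_of_mem_closure (h : IsMorsePair f ξ) (hMS : IsMorseSmale f ξ)
    {ν : ℝ} (hν : 0 < ν) (hratio : ∀ r ∈ spectralRatios f ξ, ν ≤ r)
    (hp : IsCrit (m := m) f p) (hq : IsCrit (m := m) f q) (hz : z ∈ Wminus ξ q)
    (hzp : z ∈ closure (Wminus ξ p)) : morseIndex (m := m) f q ≤ morseIndex (m := m) f p := by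
  have hξ := h.contMDiff_field
  obtain ⟨Ψ⟩ := h.adapted q hq
  obtain ⟨Ψ'⟩ := h.adapted p hp
  obtain ⟨r₁, hr₁, C, hC, hnear⟩ := h.exists_isNear hMS hν hratio p q Ψ
  obtain ⟨r₂, hr₂, hflat⟩ := Ψ.exists_expProj_eq_zero h (σ := -1) (by norm_num)
  obtain ⟨t, hts, htr⟩ := ((Ψ.eventually_flow_neg_mem hz).and
    (Ψ.eventually_norm_chart_flow_neg_lt hz (lt_min hr₁ hr₂))).exists
  have hz' : flow ξ (-t) z ∈ limitSet ξ (-1) q := by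
    rw [limitSet_neg_one]
    exact flow_mem_Wminus hξ (-t) hz
  have hz0 := hflat _ hts (htr.trans_le (min_le_right _ _)) hz'
  have hΨc := Ψ.continuousAt hts
  have hsmall : ∀ᶠ y in 𝓝 (flow ξ (-t) z),
      C * ‖expProj Ψ.rate (-1) (Ψ.chart y)‖ ^ ν < 1 := by
    have h1 : ContinuousAt (fun y => C * ‖expProj Ψ.rate (-1) (Ψ.chart y)‖ ^ ν)
        (flow ξ (-t) z) := continuousAt_const.mul
      ((((expProj Ψ.rate (-1)).continuous.continuousAt.comp hΨc).norm).rpow_const (Or.inr hν.le))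
    exact h1.eventually_lt_const (by simp [hz0, Real.zero_rpow hν.ne'])
  have hev := (hsmall.and ((hΨc.norm.eventually_lt_const (htr.trans_le (min_le_left _ _))).and
    (Ψ.chart.open_source.mem_nhds hts)))
  have hc : ContinuousAt (flow ξ (-t)) z := (contMDiff_flow hξ (-t)).continuous.continuousAt
  obtain ⟨y, ⟨hy1, hyr, hys⟩, hyp⟩ := mem_closure_iff_nhds.1 hzp _ (hc.eventually hev)
  have hN := hnear _ hys hyr (flow_mem_Wminus hξ (-t) hyp)
  exact Ψ.morseIndex_le_of_finrank_le Ψ' ((hN.finrank_le hy1).trans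
    (Ψ'.finrank_imageTangent_le h _ (flow_mem_Wminus hξ (-t) hyp)))

theorem IsMorsePair.isClosed_skeleton (h : IsMorsePair f ξ) (hMS : IsMorseSmale f ξ)
    {ν : ℝ} (hν : 0 < ν) (hratio : ∀ r ∈ spectralRatios f ξ, ν ≤ r) (k : ℤ) :
    IsClosed (skeleton f ξ k) := by
  set s : Set M := {p | IsCrit (m := m) f p ∧ (morseIndex (m := m) f p : ℤ) ≤ k} with hs
  have hskel : skeleton f ξ k = ⋃ p ∈ s, Wminus ξ p := by
    ext x
    simp only [skeleton, hs, mem_ofPred_eq, mem_iUnion, exists_prop, and_assoc]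
  refine isClosed_of_closure_subset fun z hz => ?_
  rw [hskel, (h.finite_crit.subset fun p hp => hp.1 : s.Finite).closure_biUnion] at hz
  obtain ⟨p, ⟨hp, hpk⟩, hzp⟩ := mem_iUnion₂.1 hz
  obtain ⟨q, hq, hzq⟩ := h.exists_mem_Wminus z
  have := h.morseIndex_le_of_mem_closure hMS hν hratio hp hq hzq hzp
  exact ⟨q, hq, by omega, hzq⟩

end Frontier

end MorseFlow

theorem mainTheorem6 {m : ℕ} {M : Type*} [TopologicalSpace M]
    [ChartedSpace (EuclideanSpace ℝ (Fin m)) M] [IsManifold (𝓡 m) ω M]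
    [CompactSpace M] [T2Space M]
    (f : M → ℝ) (ξ : (x : M) → TangentSpace (𝓡 m) x)
    (hpair : MorseFlow.IsMorsePair f ξ)
    (hMS : MorseFlow.IsMorseSmale f ξ)
    (ν : ℝ) (hν : 0 < ν)
    (hmin : (MorseFlow.spectralRatios f ξ).Nonempty →
      IsLeast (MorseFlow.spectralRatios f ξ) ν)
    (hdiff : MorseFlow.IsTimesDifferentiable (⌊ν⌋₊ + 1) ξ) :
    -- the frontier property, for the filtration and for its successive differences
    (∀ k : ℤ,
      closure (MorseFlow.skeleton f ξ k) \ MorseFlow.skeleton f ξ k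
        ⊆ MorseFlow.skeleton f ξ (k - 1) ∧
      closure (MorseFlow.skeleton f ξ k \ MorseFlow.skeleton f ξ (k - 1)) \
          (MorseFlow.skeleton f ξ k \ MorseFlow.skeleton f ξ (k - 1))
        ⊆ MorseFlow.skeleton f ξ (k - 1)) ∧
    (∀ p q : M, MorseFlow.IsCrit (m := m) f p → MorseFlow.IsCrit (m := m) f q →
      ∀ z ∈ MorseFlow.Wminus ξ q ∩ closure (MorseFlow.Wminus ξ p),
        -- the estimate in the adapted coordinates at `q`, carried along `W⁻_q` by the flow
        (∀ Ψ : MorseFlow.AdaptedChart f ξ q,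
          (∀ᶠ t in atTop, MorseFlow.flow ξ (-t) z ∈ Ψ.chart.source) ∧
          ∀ t : ℝ, (∀ s, t ≤ s → MorseFlow.flow ξ (-s) z ∈ Ψ.chart.source) →
            MorseFlow.GapEstimateAt m (fun x => Ψ.chart (MorseFlow.flow ξ (-t) x))
              (MorseFlow.Wminus ξ q) (MorseFlow.Wminus ξ p) z ν) ∧
        -- the estimate in arbitrary `C²` coordinates
        MorseFlow.GapHolderAt m (MorseFlow.Wminus ξ q) (MorseFlow.Wminus ξ p) z (min ν 1) ∧
        -- Verdier regularity
        (1 ≤ ν →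
          MorseFlow.VerdierRegularAt m (MorseFlow.Wminus ξ q) (MorseFlow.Wminus ξ p) z)) := by
  have hratio : ∀ r ∈ MorseFlow.spectralRatios f ξ, ν ≤ r := fun r hr => (hmin ⟨r, hr⟩).2 hr
  have hclosed := hpair.isClosed_skeleton hMS hν hratio
  refine ⟨fun k => ⟨?_, ?_⟩, fun p q hp hq z hz => ?_⟩
  · rw [(hclosed k).closure_eq, sdiff_self]
    exact empty_subset _
  · rintro x ⟨hx, hxk⟩
    by_contra hx'
    exact hxk ⟨(hclosed k).closure_subset_iff.2 sdiff_subset hx, hx'⟩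
  · have hholder : MorseFlow.GapHolderAt m (MorseFlow.Wminus ξ q) (MorseFlow.Wminus ξ p) z
        (min ν 1) := by
      obtain ⟨Ψ⟩ := hpair.adapted q hq
      exact Ψ.gapHolderAt hpair hν (hpair.exists_isNear hMS hν hratio p q Ψ) hz.1
    refine ⟨fun Ψ => ⟨Ψ.eventually_flow_neg_mem hz.1, fun t ht => ?_⟩, hholder, fun h1 => ?_⟩
    · exact Ψ.gapEstimateAt hpair hν (hpair.exists_isNear hMS hν hratio p q Ψ) hz.1 ht
    · rwa [min_eq_right h1] at hholder
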